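/- **Setting.** Let $r\ge 1$, $m\ge 0$. Functions depend on the times $t_1=x,t_2,t_3,\dots$: they are formal power series in $t_2,t_3,\dots$ whose coefficients lie in a commutative differential $\mathbb{Q}$-algebra $(B,\partial)$, $\partial=\partial_x$, with an element $x$, $\partial x=1$. Pseudo-differential operators are formal power series in $t_2,t_3,\dots$ whose coefficients are operators $\sum_{n\le N}a_nD^n$, $a_n\in B$, composed by the generalized Leibniz rule; $A_+$, $A_-$ are the parts with $n\ge 0$, $n<0$; $A^*$ is the conjugate ($D^*=-D$, $(AB)^*=B^*A^*$); $A(f)$ is the action on a function. To give $\partial_x^{-1}$ a meaning, fix a $\partial$-stable subalgebra $C\subset B$ containing $x$, two $\partial$-stable $C$-submodules $F,G\subset B$, and an ideal $N$ of $C$ such that $FG\subset N$ and $\partial:N\to N$ is bijective; $\partial_x^{-1}$ is its inverse, applied coefficientwise. A solution of the constrained KP hierarchy $\mathrm{cKP}_{r,m}$ consists of $W=1+\sum_{n\ge1}w_nD^{-n}$ and functions $\Phi_1,\dots,\Phi_m,\Psi_1,\dots,\Psi_m$ (coefficients of $w_n,\Phi_i,\Psi_i$ in $C,F,G$ respectively)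 such that, with $L=WD^rW^{-1}$ and $L^{l/r}=WD^lW^{-1}$, $$\partial_{t_l}W=-(L^{l/r})_-W,\qquad \partial_{t_l}\Phi_i=(L^{l/r})_+(\Phi_i),\qquad \partial_{t_l}\Psi_i=-\big((L^{l/r})_+\big)^*(\Psi_i)\qquad(l\ge1),$$ $$L=L_++\sum_{i=1}^m\Phi_iD^{-1}\Psi_i .$$ Put $M=W\big(\sum_{l\ge1}\tfrac lr t_lD^{l-r}\big)W^{-1}$, $\;L(f)=L_+(f)+\sum_j\Phi_j\,\partial_x^{-1}(\Psi_jf)$, $\;L^*(g)=(L_+)^*(g)-\sum_j\Psi_j\,\partial_x^{-1}(\Phi_jg)$, and $$Y_k=\sum_{i=1}^m\sum_{j=0}^{k-2}\big(j-\tfrac12(k-2)\big)L^{k-2-j}(\Phi_i)\,D^{-1}\,(L^*)^j(\Psi_i)\qquad(Y_0=Y_1=0),$$ acting by $(aD^{-1}b)(f)=a\,\partial_x^{-1}(bf)$, $(aD^{-1}b)^*(g)=-b\,\partial_x^{-1}(ag)$. For $k\ge0$ define the vector field $\partial^*_k$ on the solutions by $$\partial^*_kW=\big(-(ML^k)_-+Y_k\big)W,$$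 $$\partial^*_k\Phi_i=(ML^k)_+(\Phi_i)+\tfrac k2L^{k-1}(\Phi_i)+Y_k(\Phi_i),\qquad \partial^*_k\Psi_i=-\big((ML^k)_+\big)^*(\Psi_i)+\tfrac k2(L^*)^{k-1}(\Psi_i)-Y_k^*(\Psi_i)$$ (the middle terms being $0$ for $k=0$). The derivative $\partial^*_kF$ of an expression $F$ in the data is the coefficient of $\varepsilon$ in its value at the data displaced by $\varepsilon\,\partial^*_k(\cdot)$, $\varepsilon^2=0$. **Proposition.** For every solution of $\mathrm{cKP}_{r,m}$: 1. For all $k\ge0$, $\;\partial^*_kL=[-(ML^k)_-+Y_k,\;L]$. 2. The flows preserve the form of $L$: $\partial^*_kL$ has order at most $r-2$ and $(\partial^*_kL)_-=\sum_{i}\big((\partial^*_k\Phi_i)D^{-1}\Psi_i+\Phi_iD^{-1}(\partial^*_k\Psi_i)\big)$. 3. $\partial^*_k$ commutes with all isospectral flows $\partial_{t_l}$, $l\ge1$, on $L$ and on $W,\Phi_i,\Psi_i$; the data displaced by $\varepsilon\,\partial^*_k(\cdot)$ are again a solution of $\mathrm{cKP}_{r,m}$, over $B[\varepsilon]/(\varepsilon^2)$.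 4. The flows satisfy the relations of the Virasoro algebra (generators $\mathcal L_n$, $n\ge-1$, with $\mathcal L_{k-1}\sim-\partial^*_k$): for all $\ell,k\ge0$, $$[\partial^*_\ell,\partial^*_k]=(k-\ell)\,\partial^*_{k+\ell-1}$$ on $L$ and on $W,\Phi_i,\Psi_i$; in particular this holds for the $sl(2)$ generators $\ell=0,1,2$ and arbitrary $k$. -/

import Mathlib

set_option linter.unusedSectionVars false

open scoped Differential

universe u

section Coefficients
variable {B : Type u} [CommRing B]

variable (B) in
/-- Coefficient sequences `ℤ → B` that vanish in all large degrees. -/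
def boundedAbove : AddSubgroup (ℤ → B) where
  carrier := {a | ∃ N : ℤ, ∀ n, N < n → a n = 0}
  zero_mem' := ⟨0, fun _ _ => rfl⟩
  add_mem' := by
    rintro a b ⟨N, hN⟩ ⟨M, hM⟩
    refine ⟨max N M, fun n hn => ?_⟩
    rw [Pi.add_apply, hN n (by omega), hM n (by omega), add_zero]
  neg_mem' := by
    rintro a ⟨N, hN⟩
    exact ⟨N, fun n hn => by rw [Pi.neg_apply, hN n hn, neg_zero]⟩

variable (B) in
/-- Pseudo-differential operators `∑_{n ≤ N} aₙ Dⁿ` with coefficients in the differential ring `B`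
(coefficients on the left). -/
def PDO : Type u := boundedAbove B

namespace PDO

/-- The coefficient of `Dⁿ`. -/
def coeff (P : PDO B) (n : ℤ) : B := P.1 n

noncomputable instance : AddCommGroup (PDO B) := inferInstanceAs (AddCommGroup (boundedAbove B))

lemma bdd (P : PDO B) : ∃ N : ℤ, ∀ n, N < n → P.coeff n = 0 := P.2

lemma bdd_of_imp {C : Type*} [CommRing C] (P : PDO B) {a : ℤ → C}
    (h : ∀ n, P.coeff n = 0 → a n = 0) : ∃ N : ℤ, ∀ n, N < n → a n = 0 := by
  obtain ⟨N, hN⟩ := P.bdd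
  exact ⟨N, fun n hn => h n (hN n hn)⟩

@[ext] lemma ext {P Q : PDO B} (h : ∀ n, P.coeff n = Q.coeff n) : P = Q :=
  Subtype.ext (funext h)

@[simp] lemma coeff_add (P Q : PDO B) (n : ℤ) : (P + Q).coeff n = P.coeff n + Q.coeff n := rfl

@[simp] lemma coeff_zero (n : ℤ) : (0 : PDO B).coeff n = 0 := rfl

@[simp] lemma coeff_neg (P : PDO B) (n : ℤ) : (-P).coeff n = -P.coeff n := rfl

@[simp] lemma coeff_sub (P Q : PDO B) (n : ℤ) : (P - Q).coeff n = P.coeff n - Q.coeff n := rfl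

/-- The operator `b Dⁿ`. -/
def monomial (n : ℤ) (b : B) : PDO B :=
  ⟨fun k => if k = n then b else 0, n, fun _ hk => if_neg hk.ne'⟩

lemma coeff_monomial (n k : ℤ) (b : B) : (monomial n b).coeff k = if k = n then b else 0 := rfl

end PDO

end Coefficients

section PDO
variable {B : Type u} [CommRing B] [Differential B]

/-- The `j`-th iterated derivative `∂ʲ b`. -/
def iterD (j : ℕ) (b : B) : B := (fun c : B => c′)^[j] b

lemma iterD_zero (b : B) : iterD 0 b = b := rfl

lemma iterD_succ (j : ℕ) (b : B) : iterD (j + 1) b = (iterD j b)′ := by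
  simp only [iterD, Function.iterate_succ_apply']

lemma iterD_map_zero (j : ℕ) : iterD j (0 : B) = 0 := by
  induction j with
  | zero => rfl
  | succ j ih => rw [iterD_succ, ih, map_zero]

lemma iterD_add (j : ℕ) (b c : B) : iterD j (b + c) = iterD j b + iterD j c := by
  induction j with
  | zero => rfl
  | succ j ih => simp only [iterD_succ, ih, map_add]

lemma iterD_zsmul (j : ℕ) (z : ℤ) (b : B) : iterD j (z • b) = z • iterD j b := by
  induction j with
  | zero => rfl
  | succ j ih => simp only [iterD_succ, ih, map_zsmul]

lemma iterD_sum {ι : Type*} (j : ℕ) (s : Finset ι) (f : ι → B) :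
    iterD j (∑ i ∈ s, f i) = ∑ i ∈ s, iterD j (f i) := by
  induction j with
  | zero => rfl
  | succ j ih => simp only [iterD_succ, ih, map_sum]

lemma iterD_iterD (i j : ℕ) (b : B) : iterD i (iterD j b) = iterD (i + j) b := by
  simp only [iterD, Function.iterate_add_apply]

lemma iterD_one (j : ℕ) : iterD (j + 1) (1 : B) = 0 := by
  induction j with
  | zero => rw [iterD_succ, iterD_zero, Derivation.map_one_eq_zero]
  | succ j ih => rw [iterD_succ, ih, map_zero]

lemma iterD_mul (n : ℕ) (b c : B) :
    iterD n (b * c) =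
      ∑ k ∈ Finset.range (n + 1), n.choose k • (iterD k b * iterD (n - k) c) := by
  rw [← Finset.Nat.sum_antidiagonal_eq_sum_range_succ
    (fun i j => n.choose i • (iterD i b * iterD j c))]
  induction n with
  | zero => simp [iterD_zero]
  | succ n ih =>
    rw [iterD_succ, ih,
      Finset.sum_antidiagonal_choose_succ_nsmul (fun i j => iterD i b * iterD j c) n, map_sum,
      ← Finset.sum_add_distrib]
    refine Finset.sum_congr rfl fun ij _ => ?_
    have hs : n.choose ij.2 = n.choose ij.1 := by
      rename_i h
      have := Finset.HasAntidiagonal.mem_antidiagonal.1 h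
      exact (Nat.choose_symm_of_eq_add this.symm).symm
    rw [hs, map_nsmul, Derivation.leibniz, iterD_succ, iterD_succ, smul_add, smul_eq_mul,
      smul_eq_mul, mul_comm (iterD ij.2 c)]

/-- The coefficient of `Dⁿ` in `Dᵖ ∘ ∑ c_q D^q`, by the generalized Leibniz rule
`Dᵖ f = ∑_j (p choose j) (∂ʲ f) Dᵖ⁻ʲ`. -/
noncomputable def leibnizCoeff (p : ℤ) (c : ℤ → B) (n : ℤ) : B :=
  ∑ᶠ j : ℕ, Ring.choose p j • iterD j (c (n - p + j))

/-- The coefficient of `Dⁿ` in `(∑ a_p Dᵖ) ∘ (∑ c_q D^q)`. -/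
noncomputable def mulCoeff (a c : ℤ → B) (n : ℤ) : B :=
  ∑ᶠ p : ℤ, a p * leibnizCoeff p c n

lemma leibnizCoeff_eq {c : ℤ → B} {N : ℤ} (hc : ∀ n, N < n → c n = 0) {p n : ℤ} {J : ℕ}
    (hJ : N < n - p + J) :
    leibnizCoeff p c n = ∑ j ∈ Finset.range J, Ring.choose p j • iterD j (c (n - p + j)) := by
  refine finsum_eq_sum_of_support_subset _ fun j hj => ?_
  simp only [Finset.coe_range, Set.mem_Iio]
  by_contra h
  exact hj (by simp only [hc (n - p + j) (by omega), iterD_map_zero, smul_zero])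

lemma leibnizCoeff_eq_zero {c : ℤ → B} {N : ℤ} (hc : ∀ n, N < n → c n = 0) {p n : ℤ}
    (h : N + p < n) : leibnizCoeff p c n = 0 := by
  rw [leibnizCoeff_eq hc (J := 0) (by push_cast; omega), Finset.sum_range_zero]

lemma mulCoeff_eq {a c : ℤ → B} {Na N : ℤ} (ha : ∀ n, Na < n → a n = 0)
    (hc : ∀ n, N < n → c n = 0) {n lo hi : ℤ} (hlo : lo + N ≤ n) (hhi : Na ≤ hi) :
    mulCoeff a c n = ∑ p ∈ Finset.Icc lo hi, a p * leibnizCoeff p c n := by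
  refine finsum_eq_sum_of_support_subset _ fun p hp => ?_
  simp only [Finset.coe_Icc, Set.mem_Icc]
  by_contra h
  rcases lt_or_ge hi p with h1 | h1
  · exact hp (by simp only [ha p (by omega), zero_mul])
  · exact hp (by simp only [leibnizCoeff_eq_zero hc (show N + p < n by omega), mul_zero])

lemma mulCoeff_eq_zero {a c : ℤ → B} {Na N : ℤ} (ha : ∀ n, Na < n → a n = 0)
    (hc : ∀ n, N < n → c n = 0) {n : ℤ} (h : Na + N < n) : mulCoeff a c n = 0 := by
  rw [mulCoeff_eq ha hc (lo := n - N) (hi := Na) (by omega) le_rfl,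
    Finset.Icc_eq_empty (by omega), Finset.sum_empty]

lemma leibnizCoeff_comp {c : ℤ → B} {N : ℤ} (hc : ∀ n, N < n → c n = 0) (p q n : ℤ) :
    leibnizCoeff p (leibnizCoeff q c) n = leibnizCoeff (p + q) c n := by
  obtain ⟨J, hJ⟩ : ∃ J : ℕ, N < n - p - q + J := ⟨(N - (n - p - q) + 1).toNat, by omega⟩
  rw [leibnizCoeff_eq (N := N + q) (fun m hm => leibnizCoeff_eq_zero hc (by omega))
      (J := J) (by omega), leibnizCoeff_eq hc (J := J) (by omega)]
  have h1 : ∀ j ∈ Finset.range J, Ring.choose p j • iterD j (leibnizCoeff q c (n - p + j)) =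
      ∑ i ∈ Finset.range (J - j), (Ring.choose p j * Ring.choose q i) •
        iterD (j + i) (c (n - (p + q) + ((j + i : ℕ) : ℤ))) := by
    intro j hj
    have := Finset.mem_range.1 hj
    rw [leibnizCoeff_eq hc (J := J - j) (by omega), iterD_sum, Finset.smul_sum]
    refine Finset.sum_congr rfl fun i _ => ?_
    rw [iterD_zsmul, iterD_iterD, smul_smul]
    congr 3
    push_cast; ring
  rw [Finset.sum_congr rfl h1, ← Finset.sum_range_diag_flip J (fun j i =>
    (Ring.choose p j * Ring.choose q i) • iterD (j + i) (c (n - (p + q) + ((j + i : ℕ) : ℤ))))]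
  refine Finset.sum_congr rfl fun k _ => ?_
  rw [Ring.add_choose_eq k (Commute.all p q),
    Finset.Nat.sum_antidiagonal_eq_sum_range_succ (fun i j => Ring.choose p i * Ring.choose q j),
    Finset.sum_smul]
  refine Finset.sum_congr rfl fun i hi => ?_
  have := Finset.mem_range.1 hi
  rw [show i + (k - i) = k by omega]

lemma leibnizCoeff_mul_left {c : ℤ → B} {N : ℤ} (hc : ∀ n, N < n → c n = 0) (b : B)
    (p n : ℤ) {J : ℕ} (hJ : N < n - p + J) :
    leibnizCoeff p (fun m => b * c m) n =
      ∑ j ∈ Finset.range J, (Ring.choose p j • iterD j b) * leibnizCoeff (p - j) c n := by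
  rw [leibnizCoeff_eq (N := N) (fun m hm => by rw [hc m hm, mul_zero]) hJ]
  have h1 : ∀ j ∈ Finset.range J, (Ring.choose p j • iterD j b) * leibnizCoeff (p - j) c n =
      ∑ i ∈ Finset.range (J - j), ((j + i).choose j • Ring.choose p (j + i)) •
        (iterD j b * iterD i (c (n - p + ((j + i : ℕ) : ℤ)))) := by
    intro j hj
    have := Finset.mem_range.1 hj
    rw [leibnizCoeff_eq hc (J := J - j) (by omega), Finset.mul_sum]
    refine Finset.sum_congr rfl fun i _ => ?_
    rw [Ring.choose_smul_choose p (Nat.le_add_right j i), smul_mul_smul_comm,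
      Nat.add_sub_cancel_left]
    congr 4
    push_cast; ring
  rw [Finset.sum_congr rfl h1, ← Finset.sum_range_diag_flip J (fun j i =>
    ((j + i).choose j • Ring.choose p (j + i)) •
        (iterD j b * iterD i (c (n - p + ((j + i : ℕ) : ℤ)))))]
  refine Finset.sum_congr rfl fun k _ => ?_
  rw [iterD_mul, Finset.smul_sum]
  refine Finset.sum_congr rfl fun i hi => ?_
  have := Finset.mem_range.1 hi
  rw [show i + (k - i) = k by omega, smul_assoc, smul_comm]

lemma leibnizCoeff_sum {ι : Type*} (s : Finset ι) {f : ι → ℤ → B} {N : ℤ}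
    (hf : ∀ i ∈ s, ∀ n, N < n → f i n = 0) (p n : ℤ) :
    leibnizCoeff p (fun m => ∑ i ∈ s, f i m) n = ∑ i ∈ s, leibnizCoeff p (f i) n := by
  obtain ⟨J, hJ⟩ : ∃ J : ℕ, N < n - p + J := ⟨(N - (n - p) + 1).toNat, by omega⟩
  rw [leibnizCoeff_eq (N := N) (fun m hm => Finset.sum_eq_zero fun i hi => hf i hi m hm) hJ,
    Finset.sum_congr rfl fun i hi => leibnizCoeff_eq (hf i hi) hJ, Finset.sum_comm]
  simp only [iterD_sum, Finset.smul_sum]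

lemma leibnizCoeff_congr {c d : ℤ → B} {p n : ℤ} (h : ∀ m, n - p ≤ m → c m = d m) :
    leibnizCoeff p c n = leibnizCoeff p d n :=
  finsum_congr fun j => by rw [h _ (by omega)]

lemma mulCoeff_assoc {a b c : ℤ → B} {N : ℤ} (ha : ∀ n, N < n → a n = 0)
    (hb : ∀ n, N < n → b n = 0) (hc : ∀ n, N < n → c n = 0) (n : ℤ) :
    mulCoeff (mulCoeff a b) c n = mulCoeff a (mulCoeff b c) n := by
  obtain ⟨J, hJ⟩ : ∃ J : ℕ, 3 * N - n < J := ⟨(3 * N - n + 1).toNat, by omega⟩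
  rw [mulCoeff_eq (Na := N + N) (fun m hm => mulCoeff_eq_zero ha hb hm) hc
      (lo := n - N) (hi := 2 * N) (by omega) (by omega),
    mulCoeff_eq (N := N + N) ha (fun m hm => mulCoeff_eq_zero hb hc hm)
      (lo := n - 2 * N) (hi := N) (by omega) (by omega)]
  have hL : ∀ t ∈ Finset.Icc (n - N) (2 * N), mulCoeff a b t * leibnizCoeff t c n =
      ∑ p ∈ Finset.Icc (n - 2 * N) N, ∑ j ∈ Finset.range J,
        a p * (Ring.choose p j • (iterD j (b (t - p + j)) * leibnizCoeff t c n)) := by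
    intro t ht
    have ht := Finset.mem_Icc.1 ht
    rw [mulCoeff_eq ha hb (lo := n - 2 * N) (hi := N) (by omega) le_rfl, Finset.sum_mul]
    refine Finset.sum_congr rfl fun p hp => ?_
    have hp := Finset.mem_Icc.1 hp
    rw [leibnizCoeff_eq hb (J := J) (by omega), mul_assoc, Finset.sum_mul, Finset.mul_sum]
    simp only [smul_mul_assoc]
  have hR : ∀ p ∈ Finset.Icc (n - 2 * N) N, a p * leibnizCoeff p (mulCoeff b c) n =
      ∑ j ∈ Finset.range J, ∑ q ∈ Finset.Icc (n - 2 * N) N,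
        a p * (Ring.choose p j • (iterD j (b q) * leibnizCoeff (p - j + q) c n)) := by
    intro p hp
    have hp := Finset.mem_Icc.1 hp
    rw [leibnizCoeff_congr (d := fun m => ∑ q ∈ Finset.Icc (n - 2 * N) N,
        b q * leibnizCoeff q c m) (fun m hm => mulCoeff_eq hb hc (by omega) le_rfl),
      leibnizCoeff_sum (N := 2 * N) _ (fun q hq m hm => by
        have hq := Finset.mem_Icc.1 hq
        rw [leibnizCoeff_eq_zero hc (by omega), mul_zero]), Finset.sum_comm, Finset.mul_sum]
    refine Finset.sum_congr rfl fun q hq => ?_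
    have hq := Finset.mem_Icc.1 hq
    rw [leibnizCoeff_mul_left (N := N + q) (fun m hm => leibnizCoeff_eq_zero hc (by omega)) _ _ _
      (J := J) (by omega), Finset.mul_sum]
    refine Finset.sum_congr rfl fun j _ => ?_
    rw [leibnizCoeff_comp hc, smul_mul_assoc]
  rw [Finset.sum_congr rfl hL, Finset.sum_congr rfl hR, Finset.sum_comm]
  refine Finset.sum_congr rfl fun p hp => ?_
  have hp := Finset.mem_Icc.1 hp
  rw [Finset.sum_comm]
  refine Finset.sum_congr rfl fun j _ => ?_
  simp only [← Finset.mul_sum, ← Finset.smul_sum]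
  congr 2
  have h0 : ∀ q, (N < q ∨ p - j + q < n - N) →
      iterD j (b q) * leibnizCoeff (p - j + q) c n = 0 := by
    rintro q (h | h)
    · rw [hb q h, iterD_map_zero, zero_mul]
    · rw [leibnizCoeff_eq_zero hc (by omega), mul_zero]
  have h1 : ∑ q ∈ Finset.Icc (n - 2 * N) N, iterD j (b q) * leibnizCoeff (p - j + q) c n =
      ∑ᶠ q : ℤ, iterD j (b q) * leibnizCoeff (p - j + q) c n := by
    refine (finsum_eq_sum_of_support_subset _ fun q hq => ?_).symm
    by_contra h
    rw [Finset.coe_Icc, Set.mem_Icc] at h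
    exact hq (h0 q (by omega))
  have h2 : ∑ t ∈ Finset.Icc (n - N) (2 * N), iterD j (b (t - p + j)) * leibnizCoeff t c n =
      ∑ᶠ t : ℤ, iterD j (b (t - p + j)) * leibnizCoeff t c n := by
    refine (finsum_eq_sum_of_support_subset _ fun t ht => ?_).symm
    by_contra h
    rw [Finset.coe_Icc, Set.mem_Icc] at h
    have := h0 (t - p + j) (by omega)
    rw [show p - j + (t - p + j) = t by ring] at this
    exact ht this
  rw [h1, h2]
  refine finsum_eq_of_bijective (fun t : ℤ => t - p + j)
    ⟨fun t t' h => by simp only at h; omega, fun q => ⟨q + p - j, by simp only; omega⟩⟩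
    fun t => ?_
  rw [show p - j + (t - p + j) = t by ring]

namespace PDO

/-- Composition of pseudo-differential operators. -/
noncomputable instance : Mul (PDO B) where
  mul P Q := ⟨mulCoeff P.coeff Q.coeff, by
    obtain ⟨N, hN⟩ := P.bdd
    obtain ⟨M, hM⟩ := Q.bdd
    exact ⟨N + M, fun n hn => mulCoeff_eq_zero hN hM hn⟩⟩

noncomputable instance : One (PDO B) := ⟨monomial 0 1⟩

lemma coeff_mul (P Q : PDO B) (n : ℤ) : (P * Q).coeff n = mulCoeff P.coeff Q.coeff n := rfl

lemma coeff_one (n : ℤ) : (1 : PDO B).coeff n = if n = 0 then 1 else 0 := coeff_monomial 0 n 1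

lemma bdd₃ (P Q R : PDO B) : ∃ N : ℤ, (∀ n, N < n → P.coeff n = 0) ∧
    (∀ n, N < n → Q.coeff n = 0) ∧ (∀ n, N < n → R.coeff n = 0) := by
  obtain ⟨N, hN⟩ := P.bdd
  obtain ⟨M, hM⟩ := Q.bdd
  obtain ⟨K, hK⟩ := R.bdd
  exact ⟨max N (max M K), fun n hn => hN n (by omega), fun n hn => hM n (by omega),
    fun n hn => hK n (by omega)⟩

noncomputable instance : Ring (PDO B) where
  __ := (inferInstance : AddCommGroup (PDO B))
  mul_assoc P Q R := by
    obtain ⟨N, hP, hQ, hR⟩ := bdd₃ P Q R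
    exact ext fun n => mulCoeff_assoc hP hQ hR n
  left_distrib P Q R := by
    obtain ⟨N, hP, hQ, hR⟩ := bdd₃ P Q R
    refine ext fun n => ?_
    simp only [coeff_mul, coeff_add]
    rw [mulCoeff_eq hP (N := N) (fun m hm => by rw [coeff_add, hQ m hm, hR m hm, add_zero])
        (lo := n - N) (hi := N) (by omega) le_rfl,
      mulCoeff_eq hP hQ (lo := n - N) (hi := N) (by omega) le_rfl,
      mulCoeff_eq hP hR (lo := n - N) (hi := N) (by omega) le_rfl, ← Finset.sum_add_distrib]
    refine Finset.sum_congr rfl fun p _ => ?_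
    obtain ⟨J, hJ⟩ : ∃ J : ℕ, N < n - p + J := ⟨(N - (n - p) + 1).toNat, by omega⟩
    rw [leibnizCoeff_eq (N := N) (fun m hm => by rw [coeff_add, hQ m hm, hR m hm, add_zero]) hJ,
      leibnizCoeff_eq hQ hJ, leibnizCoeff_eq hR hJ]
    simp only [coeff_add, iterD_add, smul_add, Finset.sum_add_distrib, mul_add]
  right_distrib P Q R := by
    obtain ⟨N, hP, hQ, hR⟩ := bdd₃ P Q R
    refine ext fun n => ?_
    simp only [coeff_mul, coeff_add]
    rw [mulCoeff_eq (Na := N) (fun m hm => by rw [coeff_add, hP m hm, hQ m hm, add_zero]) hR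
        (lo := n - N) (hi := N) (by omega) le_rfl,
      mulCoeff_eq hP hR (lo := n - N) (hi := N) (by omega) le_rfl,
      mulCoeff_eq hQ hR (lo := n - N) (hi := N) (by omega) le_rfl, ← Finset.sum_add_distrib]
    simp only [coeff_add, add_mul]
  zero_mul P := by
    refine ext fun n => ?_
    simp only [coeff_mul, mulCoeff, coeff_zero, zero_mul, finsum_zero]
  mul_zero P := by
    refine ext fun n => ?_
    simp only [coeff_mul, mulCoeff, leibnizCoeff, coeff_zero, iterD_map_zero, smul_zero,
      finsum_zero, mul_zero]
  one_mul P := by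
    obtain ⟨N, hN⟩ := P.bdd
    refine ext fun n => ?_
    rw [coeff_mul, mulCoeff, finsum_eq_single _ 0 (fun p hp => by
      rw [coeff_one, if_neg hp, zero_mul]), coeff_one, if_pos rfl, one_mul, leibnizCoeff,
      finsum_eq_single _ 0 (fun j hj => by
        rw [Ring.choose_zero_pos ℤ (Nat.pos_of_ne_zero hj), zero_smul])]
    simp [iterD_zero]
  mul_one P := by
    refine ext fun n => ?_
    have h1 : ∀ p, leibnizCoeff p (1 : PDO B).coeff n = if p = n then 1 else 0 := by
      intro p
      rw [leibnizCoeff, finsum_eq_single _ 0 (fun j hj => by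
        obtain ⟨i, rfl⟩ := Nat.exists_eq_succ_of_ne_zero hj
        rw [coeff_one]
        split_ifs
        · rw [Nat.succ_eq_add_one, iterD_one, smul_zero]
        · rw [iterD_map_zero, smul_zero])]
      rw [Ring.choose_zero_right, one_smul, iterD_zero, coeff_one]
      simp only [Nat.cast_zero, add_zero, sub_eq_zero, eq_comm]
    rw [coeff_mul, mulCoeff, finsum_eq_single _ n (fun p hp => by
      rw [h1, if_neg hp, mul_zero]), h1, if_pos rfl, mul_one]
  neg_add_cancel := neg_add_cancel
  zsmul := fun n a => n • a
  nsmul := fun n a => n • a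

/-- The purely differential part `P₊ = ∑_{n ≥ 0} aₙ Dⁿ`. -/
def pos (P : PDO B) : PDO B :=
  ⟨fun n => if 0 ≤ n then P.coeff n else 0, bdd_of_imp P fun n h => by rw [h, ite_self]⟩

/-- The purely pseudo-differential part `P₋ = ∑_{n < 0} aₙ Dⁿ`. -/
def neg (P : PDO B) : PDO B :=
  ⟨fun n => if n < 0 then P.coeff n else 0, bdd_of_imp P fun n h => by rw [h, ite_self]⟩

/-- The derivation `∑ aₙ Dⁿ ↦ ∑ (∂ aₙ) Dⁿ`. -/
def dx (P : PDO B) : PDO B :=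
  ⟨fun n => (P.coeff n)′, bdd_of_imp P fun n h => by rw [h, map_zero]⟩

/-- The conjugate `P* = ∑ (-D)ⁿ aₙ`; by the Leibniz rule the coefficient of `Dⁿ` is
`∑_j (-1)ⁿ⁺ʲ (n + j choose j) ∂ʲ aₙ₊ⱼ`. -/
noncomputable def adjoint (P : PDO B) : PDO B :=
  ⟨fun n => ∑ᶠ j : ℕ, (((n + j).negOnePow : ℤ) * Ring.choose (n + j) j) •
      iterD j (P.coeff (n + j)), by
    obtain ⟨N, hN⟩ := P.bdd
    refine ⟨N, fun n hn => finsum_eq_zero_of_forall_eq_zero fun j => ?_⟩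
    rw [hN (n + j) (by omega), iterD_map_zero, smul_zero]⟩

/-- The action `∑_{n ≥ 0} aₙ ∂ⁿ f` of the differential part of `P` on a function `f`. -/
noncomputable def act (P : PDO B) (f : B) : B := ∑ᶠ n : ℕ, P.coeff n * iterD n f

end PDO

end PDO

section Functions
variable {B : Type u} [CommRing B] [Differential B]

variable (B) in
/-- Functions of `x = t₁` and of the higher times: formal power series in `t₂, t₃, …`
(the variable with index `n` is `tₙ₊₂`) whose coefficients are functions of `x`. -/
abbrev Fn : Type u := MvPowerSeries ℕ B

variable (B) in
/-- Pseudo-differential operators in `x` depending on the higher times: formal power series in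
`t₂, t₃, …` (which commute with `D`) with coefficients in `PDO B`.
The order in `D` may grow along the series. -/
abbrev Op : Type u := MvPowerSeries ℕ (PDO B)

/-- Apply a map to every coefficient of a power series. -/
def mapCoeff {R S : Type*} (f : R → S) (F : MvPowerSeries ℕ R) : MvPowerSeries ℕ S :=
  fun μ => f (F μ)

/-- The derivation `∂/∂t_l` (`l ≥ 1`), where `dx` is the derivation `∂/∂t₁ = ∂/∂x` on coefficients.
The index `l = 0` is not used. -/
noncomputable def timeDeriv {R : Type*} [AddCommMonoid R] (dx : R → R) :
    ℕ → MvPowerSeries ℕ R → MvPowerSeries ℕ R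
  | 0, _ => 0
  | 1, F => mapCoeff dx F
  | n + 2, F => fun μ => (μ n + 1) • F (μ + Finsupp.single n 1)

/-- `∂f/∂t_l` for a function `f`. -/
noncomputable def dtFn (l : ℕ) (f : Fn B) : Fn B := timeDeriv (fun b : B => b′) l f

/-- `∂P/∂t_l` (coefficientwise) for an operator `P`. -/
noncomputable def dtOp (l : ℕ) (P : Op B) : Op B := timeDeriv PDO.dx l P

/-- The operator of multiplication by a function. -/
def mulOp (f : Fn B) : Op B := mapCoeff (PDO.monomial 0) f

/-- The operator `Dⁿ`. -/
noncomputable def Dpow (n : ℤ) : Op B := MvPowerSeries.C (PDO.monomial n 1)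

/-- The differential part `P₊`. -/
def plusPart (P : Op B) : Op B := mapCoeff PDO.pos P

/-- The pseudo-differential part `P₋`. -/
def minusPart (P : Op B) : Op B := mapCoeff PDO.neg P

/-- The conjugate `P*`. -/
noncomputable def adjointOp (P : Op B) : Op B := mapCoeff PDO.adjoint P

/-- The action `P(f)` of a differential operator `P` on a function `f`. -/
noncomputable def applyDiff (P : Op B) (f : Fn B) : Fn B :=
  fun μ => ∑ p ∈ Finset.HasAntidiagonal.antidiagonal μ, PDO.act (P p.1) (f p.2)

variable (B) in
/-- The classes of functions of `x` in which the objects of the hierarchy live, chosen such that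
`∂⁻¹` is unambiguous where it is applied: `coeffs` contains the coefficients of the dressing
operator, `eig` the eigenfunctions and `adj` the adjoint eigenfunctions; products of the latter
two lie in `pot`, on which `∂` is invertible. -/
structure FunctionClass [Algebra ℚ B] where
  coeffs : Subalgebra ℚ B
  eig : Submodule coeffs B
  adj : Submodule coeffs B
  pot : Submodule coeffs B
  x : B
  x_mem : x ∈ coeffs
  deriv_x : x′ = 1
  deriv_coeffs : ∀ b ∈ coeffs, b′ ∈ coeffs
  deriv_eig : ∀ f ∈ eig, f′ ∈ eig
  deriv_adj : ∀ g ∈ adj, g′ ∈ adj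
  eig_mul_adj : ∀ f ∈ eig, ∀ g ∈ adj, f * g ∈ pot
  pot_subset : ∀ h ∈ pot, h ∈ coeffs
  bijOn_deriv : Set.BijOn (fun h : B => h′) pot pot

end Functions

section Hierarchy
variable {B : Type u} [CommRing B] [Algebra ℚ B] [Differential B] {m : ℕ}

/-- The inverse of `∂` on `K.pot`. -/
noncomputable def FunctionClass.antideriv (K : FunctionClass B) (f : B) : B :=
  Function.invFunOn (fun h : B => h′) (K.pot : Set B) f

/-- `∂ₓ⁻¹` on functions of all times. -/
noncomputable def FunctionClass.intx (K : FunctionClass B) (f : Fn B) : Fn B :=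
  mapCoeff K.antideriv f

/-- The time `t_l` as a function (`t₁ = x`). -/
noncomputable def FunctionClass.time (K : FunctionClass B) : ℕ → Fn B
  | 0 => 0
  | 1 => MvPowerSeries.C K.x
  | n + 2 => MvPowerSeries.X n

variable (B m) in
/-- A dressing operator `W` with `m` functions `Φᵢ` and `m` functions `Ψᵢ`; also used for
variations `(δW, δΦ, δΨ)` of such data. -/
structure State where
  W : Op B
  Φ : Fin m → Fn B
  Ψ : Fin m → Fn B

/-- `W D^l W⁻¹`, which is `L^{l/r}` for `L = W Dʳ W⁻¹`. -/
noncomputable def dressedPow (l : ℕ) (s : State B m) : Op B :=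
  s.W * Dpow l * Ring.inverse s.W

/-- The Lax operator `L = W Dʳ W⁻¹`. -/
noncomputable def lax (r : ℕ) (s : State B m) : Op B := dressedPow r s

/-- `M⁽⁰⁾ = ∑_{l ≥ 1} (l / r) t_l D^{l - r}`: for every monomial in the times its coefficient
is a finite sum. -/
noncomputable def bareM (K : FunctionClass B) (r : ℕ) : Op B :=
  fun μ => ∑ᶠ l : ℕ, PDO.monomial ((l : ℤ) - r) (((l : ℚ) / r) • K.time l μ)

/-- `M = W M⁽⁰⁾ W⁻¹`. -/
noncomputable def opM (K : FunctionClass B) (r : ℕ) (s : State B m) : Op B :=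
  s.W * bareM K r * Ring.inverse s.W

/-- The isospectral flow `∂/∂t_l`:
`∂_l W = -(W D^l W⁻¹)₋ W`, `∂_l Φ = (L^{l/r})₊(Φ)`, `∂_l Ψ = -(L*)^{l/r}₊(Ψ)`. -/
noncomputable def isoFlow (l : ℕ) (s : State B m) : State B m where
  W := -minusPart (dressedPow l s) * s.W
  Φ i := applyDiff (plusPart (dressedPow l s)) (s.Φ i)
  Ψ i := -applyDiff (adjointOp (plusPart (dressedPow l s))) (s.Ψ i)

/-- Time derivative of all the components. -/
noncomputable def State.dt (l : ℕ) (s : State B m) : State B m where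
  W := dtOp l s.W
  Φ i := dtFn l (s.Φ i)
  Ψ i := dtFn l (s.Ψ i)

/-- Solutions of the constrained KP hierarchy `cKP_{r,m}`: a dressing operator
`W = 1 + ∑_{n ≥ 1} wₙ D⁻ⁿ` and (adjoint) eigenfunctions `Φᵢ`, `Ψᵢ` that obey the isospectral flow
equations, such that `L = W Dʳ W⁻¹` is of the form `L = L₊ + ∑ᵢ Φᵢ D⁻¹ Ψᵢ`. -/
structure IsCKP (K : FunctionClass B) (r : ℕ) (s : State B m) : Prop where
  plusPart_W : plusPart s.W = 1
  W_mem : ∀ μ n, (s.W μ).coeff n ∈ K.coeffs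
  Φ_mem : ∀ i μ, s.Φ i μ ∈ K.eig
  Ψ_mem : ∀ i μ, s.Ψ i μ ∈ K.adj
  flow : ∀ l, 1 ≤ l → s.dt l = isoFlow l s
  constraint : minusPart (lax r s) = ∑ i, mulOp (s.Φ i) * Dpow (-1) * mulOp (s.Ψ i)

/-- `L(f) = L₊(f) + ∑ⱼ Φⱼ ∂ₓ⁻¹(Ψⱼ f)`. -/
noncomputable def applyL (K : FunctionClass B) (r : ℕ) (s : State B m) (f : Fn B) : Fn B :=
  applyDiff (plusPart (lax r s)) f + ∑ j, s.Φ j * K.intx (s.Ψ j * f)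

/-- `L*(g) = (L₊)*(g) - ∑ⱼ Ψⱼ ∂ₓ⁻¹(Φⱼ g)`. -/
noncomputable def applyLadj (K : FunctionClass B) (r : ℕ) (s : State B m) (g : Fn B) : Fn B :=
  applyDiff (adjointOp (plusPart (lax r s))) g - ∑ j, s.Ψ j * K.intx (s.Φ j * g)

/-- `L^a(Φᵢ)`. -/
noncomputable def eigPow (K : FunctionClass B) (r : ℕ) (s : State B m) (a : ℕ) (i : Fin m) :
    Fn B :=
  (applyL K r s)^[a] (s.Φ i)

/-- `(L*)^a(Ψᵢ)`. -/
noncomputable def adjPow (K : FunctionClass B) (r : ℕ) (s : State B m) (a : ℕ) (i : Fin m) :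
    Fn B :=
  (applyLadj K r s)^[a] (s.Ψ i)

/-- The coefficient `j - (k - 2) / 2`. -/
def ghostCoeff (k j : ℕ) : ℚ := (j : ℚ) - ((k : ℚ) - 2) / 2

/-- `Y_k = ∑ᵢ ∑_{0 ≤ j ≤ k - 2} (j - (k - 2) / 2) L^{k-2-j}(Φᵢ) D⁻¹ (L*)^j(Ψᵢ)`
(zero for `k = 0, 1`). -/
noncomputable def ghostY (K : FunctionClass B) (r k : ℕ) (s : State B m) : Op B :=
  ∑ i, ∑ j ∈ Finset.range (k - 1),
    mulOp (ghostCoeff k j • eigPow K r s (k - 2 - j) i) * Dpow (-1) * mulOp (adjPow K r s j i)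

/-- `Y_k(f)`, where `(a D⁻¹ b)(f) = a ∂ₓ⁻¹(b f)`. -/
noncomputable def applyY (K : FunctionClass B) (r k : ℕ) (s : State B m) (f : Fn B) : Fn B :=
  ∑ i, ∑ j ∈ Finset.range (k - 1),
    ghostCoeff k j • (eigPow K r s (k - 2 - j) i * K.intx (adjPow K r s j i * f))

/-- `Y_k*(g)`, where `(a D⁻¹ b)*(g) = -b ∂ₓ⁻¹(a g)`. -/
noncomputable def applyYadj (K : FunctionClass B) (r k : ℕ) (s : State B m) (g : Fn B) : Fn B :=
  -∑ i, ∑ j ∈ Finset.range (k - 1),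
    ghostCoeff k j • (adjPow K r s j i * K.intx (eigPow K r s (k - 2 - j) i * g))

/-- The generator `-(M L^k)₋ + Y_k`. -/
noncomputable def starGen (K : FunctionClass B) (r k : ℕ) (s : State B m) : Op B :=
  -minusPart (opM K r s * lax r s ^ k) + ghostY K r k s

/-- The isospectral flow of the Lax operator, `∂_l L = [(L^{l/r})₊, L]`. -/
noncomputable def isoLax (r l : ℕ) (s : State B m) : Op B :=
  plusPart (dressedPow l s) * lax r s - lax r s * plusPart (dressedPow l s)

/-- `∂*_k L = [-(M L^k)₋ + Y_k, L]`. -/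
noncomputable def starLax (K : FunctionClass B) (r k : ℕ) (s : State B m) : Op B :=
  starGen K r k s * lax r s - lax r s * starGen K r k s

/-- The modified additional-symmetry flow `∂*_k`:
`∂*_k W = (-(M L^k)₋ + Y_k) W`,
`∂*_k Φᵢ = (M L^k)₊(Φᵢ) + (k/2) L^{k-1}(Φᵢ) + Y_k(Φᵢ)`,
`∂*_k Ψᵢ = -((M L^k)₊)*(Ψᵢ) + (k/2) (L*)^{k-1}(Ψᵢ) - Y_k*(Ψᵢ)`. -/
noncomputable def starFlow (K : FunctionClass B) (r k : ℕ) (s : State B m) : State B m where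
  W := starGen K r k s * s.W
  Φ i := applyDiff (plusPart (opM K r s * lax r s ^ k)) (s.Φ i)
    + ((k : ℚ) / 2) • eigPow K r s (k - 1) i + applyY K r k s (s.Φ i)
  Ψ i := -applyDiff (adjointOp (plusPart (opM K r s * lax r s ^ k))) (s.Ψ i)
    + ((k : ℚ) / 2) • adjPow K r s (k - 1) i - applyYadj K r k s (s.Ψ i)

end Hierarchy

section Variation
open TrivSqZeroExt
variable {B : Type u} [CommRing B] {m : ℕ}

/-- The derivation of `B` extended to the dual numbers `B[ε]` by `∂ε = 0`. -/
instance DualNumber.differential [Differential B] : Differential (DualNumber B) where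
  deriv := Derivation.mk'
    { toFun := fun z => inl z.fst′ + inr z.snd′
      map_add' := fun z w => by ext <;> simp
      map_smul' := fun c z => by ext <;> simp [mul_comm] }
    (fun z w => by
      ext
      · simp
      · simp
        ring)

/-- `P + ε Q`. -/
def PDO.addEps (P Q : PDO B) : PDO (DualNumber B) :=
  ⟨fun n => inl (P.coeff n) + inr (Q.coeff n), by
    obtain ⟨N, hN⟩ := P.bdd
    obtain ⟨M, hM⟩ := Q.bdd
    refine ⟨max N M, fun n hn => ?_⟩
    simp only [hN n (by omega), hM n (by omega), inl_zero, inr_zero, add_zero]⟩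

/-- The `ε`-component of a pseudo-differential operator over the dual numbers. -/
def PDO.eps (P : PDO (DualNumber B)) : PDO B :=
  ⟨fun n => (P.coeff n).snd, bdd_of_imp P fun n h => by rw [h, snd_zero]⟩

/-- `P + ε Q`. -/
def Op.addEps (P Q : Op B) : Op (DualNumber B) := fun μ => PDO.addEps (P μ) (Q μ)

/-- The `ε`-component of an operator over the dual numbers. -/
def Op.eps (P : Op (DualNumber B)) : Op B := mapCoeff PDO.eps P

/-- `f + ε g`. -/
def Fn.addEps (f g : Fn B) : Fn (DualNumber B) := fun μ => inl (f μ) + inr (g μ)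

/-- The `ε`-component of a function over the dual numbers. -/
def Fn.eps (f : Fn (DualNumber B)) : Fn B := fun μ => (f μ).snd

/-- The infinitesimal displacement `s + ε v`. -/
def State.addEps (s v : State B m) : State (DualNumber B) m where
  W := Op.addEps s.W v.W
  Φ i := Fn.addEps (s.Φ i) (v.Φ i)
  Ψ i := Fn.addEps (s.Ψ i) (v.Ψ i)

/-- The `ε`-component of data over the dual numbers. -/
def State.eps (s : State (DualNumber B) m) : State B m where
  W := Op.eps s.W
  Φ i := Fn.eps (s.Φ i)
  Ψ i := Fn.eps (s.Ψ i)

section Dual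
variable [Algebra ℚ B] [Differential B] (K : FunctionClass B)

/-- All `a + ε b` with `a` and `b` in `K.coeffs`. -/
def FunctionClass.dualCoeffs : Subalgebra ℚ (DualNumber B) where
  carrier := {z | z.fst ∈ K.coeffs ∧ z.snd ∈ K.coeffs}
  mul_mem' := by
    rintro z w ⟨hz, hz'⟩ ⟨hw, hw'⟩
    refine ⟨?_, ?_⟩
    · rw [fst_mul]; exact mul_mem hz hw
    · rw [snd_mul]
      exact add_mem (mul_mem hz hw') (mul_mem hz' hw)
  add_mem' := by
    rintro z w ⟨hz, hz'⟩ ⟨hw, hw'⟩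
    exact ⟨add_mem hz hw, add_mem hz' hw'⟩
  algebraMap_mem' := fun q => ⟨K.coeffs.algebraMap_mem q, K.coeffs.zero_mem⟩

/-- All `a + ε b` with `a` and `b` in the given submodule. -/
def FunctionClass.dualSub (S : Submodule K.coeffs B) :
    Submodule K.dualCoeffs (DualNumber B) where
  carrier := {z | z.fst ∈ S ∧ z.snd ∈ S}
  add_mem' := by
    rintro z w ⟨hz, hz'⟩ ⟨hw, hw'⟩
    exact ⟨add_mem hz hw, add_mem hz' hw'⟩
  zero_mem' := ⟨S.zero_mem, S.zero_mem⟩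
  smul_mem' := by
    rintro ⟨c, hc, hc'⟩ z ⟨hz, hz'⟩
    have h1 : ∀ a ∈ K.coeffs, ∀ b ∈ S, a * b ∈ S := fun a ha b hb => S.smul_mem ⟨a, ha⟩ hb
    change (c * z).fst ∈ S ∧ (c * z).snd ∈ S
    refine ⟨?_, ?_⟩
    · rw [fst_mul]; exact h1 _ hc _ hz
    · rw [snd_mul]
      exact add_mem (h1 _ hc _ hz') (h1 _ hc' _ hz)

lemma DualNumber.fst_deriv (z : DualNumber B) : (z′).fst = (z.fst′) := by
  change (inl z.fst′ + inr z.snd′ : DualNumber B).fst = (z.fst′)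
  simp

lemma DualNumber.snd_deriv (z : DualNumber B) : (z′).snd = (z.snd′) := by
  change (inl z.fst′ + inr z.snd′ : DualNumber B).snd = (z.snd′)
  simp

/-- The function class over `B[ε]` of all `a + ε b` with `a` and `b` in the given one. -/
def FunctionClass.dual : FunctionClass (DualNumber B) where
  coeffs := K.dualCoeffs
  eig := K.dualSub K.eig
  adj := K.dualSub K.adj
  pot := K.dualSub K.pot
  x := inl K.x
  x_mem := ⟨K.x_mem, K.coeffs.zero_mem⟩
  deriv_x := by
    ext
    · rw [DualNumber.fst_deriv, fst_inl, K.deriv_x, fst_one]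
    · rw [DualNumber.snd_deriv, snd_inl, map_zero, snd_one]
  deriv_coeffs := fun z hz =>
    ⟨(DualNumber.fst_deriv z).symm ▸ K.deriv_coeffs _ hz.1,
      (DualNumber.snd_deriv z).symm ▸ K.deriv_coeffs _ hz.2⟩
  deriv_eig := fun z hz =>
    ⟨(DualNumber.fst_deriv z).symm ▸ K.deriv_eig _ hz.1,
      (DualNumber.snd_deriv z).symm ▸ K.deriv_eig _ hz.2⟩
  deriv_adj := fun z hz =>
    ⟨(DualNumber.fst_deriv z).symm ▸ K.deriv_adj _ hz.1,
      (DualNumber.snd_deriv z).symm ▸ K.deriv_adj _ hz.2⟩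
  eig_mul_adj := fun z hz w hw => by
    refine ⟨?_, ?_⟩
    · rw [fst_mul]; exact K.eig_mul_adj _ hz.1 _ hw.1
    · rw [snd_mul]
      exact add_mem (K.eig_mul_adj _ hz.1 _ hw.2) (K.eig_mul_adj _ hz.2 _ hw.1)
  pot_subset := fun z hz => ⟨K.pot_subset _ hz.1, K.pot_subset _ hz.2⟩
  bijOn_deriv := by
    refine ⟨fun z hz => ?_, fun z hz w hw h => ?_, fun z hz => ?_⟩
    · exact ⟨(DualNumber.fst_deriv z).symm ▸ K.bijOn_deriv.mapsTo hz.1,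
        (DualNumber.snd_deriv z).symm ▸ K.bijOn_deriv.mapsTo hz.2⟩
    · have h : z′ = w′ := h
      ext
      · refine K.bijOn_deriv.injOn hz.1 hw.1 ?_
        simp only [← DualNumber.fst_deriv, h]
      · refine K.bijOn_deriv.injOn hz.2 hw.2 ?_
        simp only [← DualNumber.snd_deriv, h]
    · obtain ⟨a, ha, ha'⟩ := K.bijOn_deriv.surjOn hz.1
      obtain ⟨b, hb, hb'⟩ := K.bijOn_deriv.surjOn hz.2
      refine ⟨inl a + inr b, ⟨by simpa using ha, by simpa using hb⟩, ?_⟩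
      ext
      · simpa [DualNumber.fst_deriv] using ha'
      · simpa [DualNumber.snd_deriv] using hb'

end Dual

section Bracket
variable [Algebra ℚ B] [Differential B]

/-- Componentwise difference. -/
noncomputable instance : Sub (State B m) :=
  ⟨fun s t => ⟨s.W - t.W, fun i => s.Φ i - t.Φ i, fun i => s.Ψ i - t.Ψ i⟩⟩

/-- Componentwise integer multiples. -/
noncomputable instance : SMul ℤ (State B m) :=
  ⟨fun z s => ⟨z • s.W, fun i => z • s.Φ i, fun i => z • s.Ψ i⟩⟩

/-- The displacement `s + ε ∂*_k s` of `s` along the flow `∂*_k`. The derivative `∂*_k F` of a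
functional `F` at `s` is the `ε`-component of the value of `F` at this point. -/
noncomputable def starMove (K : FunctionClass B) (r k : ℕ) (s : State B m) :
    State (DualNumber B) m :=
  s.addEps (starFlow K r k s)

/-- `[∂*_l, ∂*_k] = ∂*_l ∂*_k - ∂*_k ∂*_l` applied to `W`, `Φᵢ`, `Ψᵢ`. -/
noncomputable def starBracket (K : FunctionClass B) (r l k : ℕ) (s : State B m) : State B m :=
  (starFlow K.dual r k (starMove K r l s)).eps - (starFlow K.dual r l (starMove K r k s)).eps

/-- `[∂*_l, ∂*_k] L = ∂*_l (∂*_k L) - ∂*_k (∂*_l L)`. -/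
noncomputable def starBracketLax (K : FunctionClass B) (r l k : ℕ) (s : State B m) : Op B :=
  Op.eps (starLax K.dual r k (starMove K r l s)) - Op.eps (starLax K.dual r l (starMove K r k s))

end Bracket

end Variation

/-! The flow `∂*_k` is governed by `A_k = (M Lᵏ)₊ + Y_k`, which equals `G_k + M Lᵏ` with `G_k = -(M
Lᵏ)₋ + Y_k` of negative order. From `[L, M] = 1` come `[M Lᵏ, L] = -Lᵏ` and `[M Lˡ, M Lᵏ] = (l - k)
M L^{k+l-1}` (`mom_commutator_lax`, `mom_commutator`). Hence `∂*_k L = [G_k, L] = [A_k, L] + Lᵏ`,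
where every operator on the right is a differential operator plus a sum of terms `a D⁻¹ b`.

Such operators must also act on functions through `∂ₓ⁻¹`, and the symbol `∑ aᵢ D⁻¹ bᵢ` alone is not
used to recover that action. The proof therefore works in the ring `ActOps` of operators carrying
their actions, and records an integral part by the tensor `∑ aᵢ ⊗ bᵢ`. The kernel of `X Y` is `X ⊗
1` on the kernel of `Y` plus `1 ⊗ Y*` on the kernel of `X` (`HasKernel.mul`). The kernel and the
differential part of the symbol determine the symbol and both actions (`HasKernel.ext`), so an
identity of actions reduces to one identity of tensors and one of symbols modulo negative order.

Preservation of the form of `L`: the kernel of `[L, Y_k]` is a weighted sum of consecutive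
differences of the tensors `∑ᵢ L^{k-1-j}(Φᵢ) ⊗ (L*)ʲ(Ψᵢ)`, whose plain sum is the kernel of `Lᵏ`.
Summation by parts (`sum_ghostCoeff_smul_sub`) leaves `k/2` times the two end terms, which are
exactly the inhomogeneous terms in `∂*_k Φᵢ` and `∂*_k Ψᵢ` (`hasKernel_genAct_commutator`).

Variations along `ε` and along `t_l` are treated together as a `Jet`. Once the variation of `L` as
an acting operator is known (`star_delta_lax`, `time_delta_lax`), induction gives `∂*_k L^a(Φ) =
A_k(L^a(Φ)) + (a + k/2) L^{a+k-1}(Φ)` (`Generates.delE_φPow`), hence the variation of the kernel of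
`Y`. The Virasoro relations become the zero curvature equation `∂*_l A_k - ∂*_k A_l + [A_k, A_l] =
(k - l) A_{k+l-1}` (`star_zero_curvature`): its tensor part is the coefficient identity
`ghostShift_sub`, its symbol part is `mom_commutator`. With `B_l = (L^{l/r})₊`, commutation with the
isospectral flows is `∂_{t_l} A_k = [B_l, A_k] + ∂*_k B_l` (`varies_time_genAct`). The statements on
`L`, `W`, `Φᵢ`, `Ψᵢ` follow by applying these equations, and the `ε`-components of the equations of
the hierarchy are among them. -/

open scoped TensorProduct

/-! ### Pseudo-differential operators in one variable: products, actions, conjugates -/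

namespace PDO

section Coefficients
variable {B : Type u} [CommRing B]

/-- The coefficient of `Dⁿ` as an additive map. -/
def coeffHom (n : ℤ) : PDO B →+ B where
  toFun P := P.coeff n
  map_zero' := rfl
  map_add' _ _ := rfl

lemma coeff_sum {ι : Type*} (s : Finset ι) (f : ι → PDO B) (n : ℤ) :
    (∑ i ∈ s, f i).coeff n = ∑ i ∈ s, (f i).coeff n :=
  map_sum (coeffHom n) f s

/-- `b ↦ b Dⁿ` as an additive map. -/
def monomialHom (n : ℤ) : B →+ PDO B where
  toFun b := monomial n b
  map_zero' := ext fun k => by simp [coeff_monomial]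
  map_add' a b := ext fun k => by
    simp only [coeff_monomial, coeff_add]; split_ifs <;> simp

lemma monomial_zero (n : ℤ) : monomial n (0 : B) = 0 := map_zero (monomialHom n)

lemma monomial_neg (n : ℤ) (a : B) : monomial n (-a) = -monomial n a :=
  map_neg (monomialHom n) a

lemma coeff_monomial_self (n : ℤ) (b : B) : (monomial n b).coeff n = b := by
  rw [coeff_monomial, if_pos rfl]

lemma monomial_injective (n : ℤ) : Function.Injective (monomial (B := B) n) := fun a b h => by
  rw [← coeff_monomial_self n a, h, coeff_monomial_self]

end Coefficients

variable {B : Type u} [CommRing B] [Differential B]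

lemma pos_add_neg (P : PDO B) : P.pos + P.neg = P := ext fun n => by
  simp only [pos, neg]
  change (if 0 ≤ n then P.coeff n else 0) + (if n < 0 then P.coeff n else 0) = _
  split_ifs <;> first | omega | simp

lemma coeff_pos (P : PDO B) (n : ℤ) : P.pos.coeff n = if 0 ≤ n then P.coeff n else 0 := rfl

lemma coeff_neg' (P : PDO B) (n : ℤ) : P.neg.coeff n = if n < 0 then P.coeff n else 0 := rfl

lemma coeff_dx (P : PDO B) (n : ℤ) : P.dx.coeff n = (P.coeff n)′ := rfl

/-- The projection on the differential part as an additive map. -/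
def posHom : PDO B →+ PDO B where
  toFun := pos
  map_zero' := ext fun n => by simp [coeff_pos]
  map_add' P Q := ext fun n => by simp only [coeff_pos, coeff_add]; split_ifs <;> simp

/-- The projection on the pseudo-differential part as an additive map. -/
def negHom : PDO B →+ PDO B where
  toFun := neg
  map_zero' := ext fun n => by simp [coeff_neg']
  map_add' P Q := ext fun n => by simp only [coeff_neg', coeff_add]; split_ifs <;> simp

/-- The coefficients of a product as a finite sum. -/
lemma coeff_mul_eq_sum {P Q : PDO B} {N : ℤ} (hP : ∀ n, N < n → P.coeff n = 0)
    (hQ : ∀ n, N < n → Q.coeff n = 0) {n : ℤ} {J : ℕ} (hJ : 2 * N - n < J) :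
    (P * Q).coeff n = ∑ p ∈ Finset.Icc (n - N) N, ∑ j ∈ Finset.range J,
      Ring.choose p j • (P.coeff p * iterD j (Q.coeff (n - p + j))) := by
  rw [coeff_mul, mulCoeff_eq hP hQ (lo := n - N) (hi := N) (by omega) le_rfl]
  refine Finset.sum_congr rfl fun p hp => ?_
  have := Finset.mem_Icc.1 hp
  rw [leibnizCoeff_eq hQ (J := J) (by omega), Finset.mul_sum]
  simp only [mul_smul_comm]

lemma exists_bound₂ (P Q : PDO B) (n : ℤ) : ∃ N : ℤ, ∃ J : ℕ, (∀ n, N < n → P.coeff n = 0) ∧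
    (∀ n, N < n → Q.coeff n = 0) ∧ 2 * N - n < J := by
  obtain ⟨N, h1, h2, -⟩ := bdd₃ P Q Q
  exact ⟨N, (2 * N - n).toNat + 1, h1, h2, by omega⟩

lemma coeff_mul_eq_zero {P Q : PDO B} {N M : ℤ} (hP : ∀ n, N < n → P.coeff n = 0)
    (hQ : ∀ n, M < n → Q.coeff n = 0) {n : ℤ} (h : N + M < n) : (P * Q).coeff n = 0 :=
  mulCoeff_eq_zero hP hQ h

lemma coeff_monomial_mul (p : ℤ) (a : B) (Q : PDO B) (n : ℤ) :
    (monomial p a * Q).coeff n = a * leibnizCoeff p Q.coeff n := by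
  rw [coeff_mul, mulCoeff, finsum_eq_single _ p fun q hq => by
    rw [coeff_monomial, if_neg hq, zero_mul], coeff_monomial_self]

lemma leibnizCoeff_zero (c : ℤ → B) (n : ℤ) : leibnizCoeff 0 c n = c n := by
  rw [leibnizCoeff, finsum_eq_single _ 0 fun j hj => by
    rw [Ring.choose_zero_pos ℤ (Nat.pos_of_ne_zero hj), zero_smul]]
  simp [iterD_zero]

lemma leibnizCoeff_one (c : ℤ → B) (n : ℤ) : leibnizCoeff 1 c n = c (n - 1) + (c n)′ := by
  have h : ∀ j : ℕ, j ∉ Finset.range 2 → Ring.choose (1 : ℤ) j • iterD j (c (n - 1 + j)) = 0 := by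
    intro j hj
    have h1 : Ring.choose (1 : ℤ) j = 0 := by
      have := Ring.choose_natCast (R := ℤ) 1 j
      rw [Nat.cast_one] at this
      rw [this, Nat.choose_eq_zero_of_lt (by simpa using hj), Nat.cast_zero]
    rw [h1, zero_smul]
  rw [leibnizCoeff, finsum_eq_sum_of_support_subset (s := Finset.range 2) _ fun j hj => by
    by_contra h'
    exact hj (h j (by simpa using h'))]
  simp [Finset.sum_range_succ, iterD_zero, iterD_succ]

lemma leibnizCoeff_monomial_one (p q n : ℤ) :
    leibnizCoeff p (monomial q (1 : B)).coeff n = if n = p + q then 1 else 0 := by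
  rw [leibnizCoeff, finsum_eq_single _ 0 fun j hj => by
    obtain ⟨i, rfl⟩ := Nat.exists_eq_succ_of_ne_zero hj
    rw [coeff_monomial]
    split_ifs
    · rw [Nat.succ_eq_add_one, iterD_one, smul_zero]
    · rw [iterD_map_zero, smul_zero]]
  rw [Ring.choose_zero_right, one_smul, iterD_zero, coeff_monomial]
  congr 1
  simp only [Nat.cast_zero, add_zero, eq_iff_iff]
  omega

lemma coeff_mul_Dpow (P : PDO B) (q n : ℤ) :
    (P * monomial q 1).coeff n = P.coeff (n - q) := by
  rw [coeff_mul, mulCoeff, finsum_eq_single _ (n - q) fun p hp => by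
    rw [leibnizCoeff_monomial_one, if_neg (by omega), mul_zero],
    leibnizCoeff_monomial_one, if_pos (by omega), mul_one]

lemma coeff_fun_mul (a : B) (P : PDO B) (n : ℤ) :
    (monomial 0 a * P).coeff n = a * P.coeff n := by
  rw [coeff_monomial_mul, leibnizCoeff_zero]

lemma coeff_D_mul (P : PDO B) (n : ℤ) :
    (monomial 1 1 * P).coeff n = P.coeff (n - 1) + (P.coeff n)′ := by
  rw [coeff_monomial_mul, leibnizCoeff_one, one_mul]

lemma monomial_mul_Dpow (p q : ℤ) (a : B) :
    monomial p a * monomial q 1 = monomial (p + q) a := ext fun n => by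
  rw [coeff_mul_Dpow, coeff_monomial, coeff_monomial]
  congr 1
  simp only [eq_iff_iff]
  omega

lemma fun_mul_monomial (q : ℤ) (a b : B) :
    monomial 0 a * monomial q b = monomial q (a * b) := ext fun n => by
  rw [coeff_fun_mul, coeff_monomial, coeff_monomial, mul_ite, mul_zero]

lemma monomial_zero_one : monomial 0 (1 : B) = 1 := rfl

lemma monomial_eq (n : ℤ) (a : B) : monomial n a = monomial 0 a * monomial n 1 := by
  rw [fun_mul_monomial, mul_one]

lemma D_mul_fun (a : B) :
    monomial 1 1 * monomial 0 a = monomial 0 a * monomial 1 1 + monomial 0 (a′) :=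
  ext fun n => by
    rw [coeff_D_mul, coeff_add, fun_mul_monomial, mul_one]
    simp only [coeff_monomial]
    by_cases h : n = 0
    · subst h; simp
    · by_cases h' : n = 1
      · subst h'; simp
      · rw [if_neg (by omega), if_neg h, if_neg h', if_neg h, map_zero]

/-- In this form the Leibniz rule of `∂/∂t₁` for products of operators is that of a commutator. -/
lemma dx_eq (P : PDO B) : P.dx = monomial 1 1 * P - P * monomial 1 1 := ext fun n => by
  rw [coeff_dx, coeff_sub, coeff_D_mul, coeff_mul_Dpow, add_sub_cancel_left]

/-- A differential operator is a sum of monomials. -/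
lemma eq_sum_of_neg_eq_zero {P : PDO B} (h : ∀ n < 0, P.coeff n = 0) :
    ∃ N : ℕ, P = ∑ n ∈ Finset.range N, monomial (n : ℤ) (P.coeff n) := by
  obtain ⟨N, hN⟩ := P.bdd
  refine ⟨N.toNat + 1, ext fun k => ?_⟩
  rw [coeff_sum]
  simp only [coeff_monomial]
  by_cases hk : 0 ≤ k ∧ k < N.toNat + 1
  · lift k to ℕ using hk.1
    rw [Finset.sum_eq_single k] <;> simp
    · intro b _ hb hb'
      omega
    · omega
  · rw [Finset.sum_eq_zero]
    · by_cases h0 : 0 ≤ k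
      · exact hN k (by omega)
      · exact h k (by omega)
    · intro i hi
      rw [if_neg]
      have := Finset.mem_range.1 hi
      omega

lemma iterD_mem {I : AddSubgroup B} (hI : ∀ b ∈ I, b′ ∈ I) {b : B} (hb : b ∈ I) (j : ℕ) :
    iterD j b ∈ I := by
  induction j with
  | zero => exact hb
  | succ j ih => rw [iterD_succ]; exact hI _ ih

/-- Composition differentiates only the coefficients of the right factor, so only `J` has to be
stable under the derivation. -/
lemma coeff_mul_mem {I J H : AddSubgroup B} (hJ : ∀ b ∈ J, b′ ∈ J)
    (hIJ : ∀ a ∈ I, ∀ b ∈ J, a * b ∈ H) {P Q : PDO B} (hP : ∀ n, P.coeff n ∈ I)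
    (hQ : ∀ n, Q.coeff n ∈ J) (n : ℤ) : (P * Q).coeff n ∈ H := by
  obtain ⟨N, J', h1, h2, h3⟩ := exists_bound₂ P Q n
  rw [coeff_mul_eq_sum h1 h2 h3]
  exact sum_mem fun p _ => sum_mem fun j _ => zsmul_mem (hIJ _ (hP p) _ (iterD_mem hJ (hQ _) j)) _

lemma act_add (P Q : PDO B) (f : B) : (P + Q).act f = P.act f + Q.act f := by
  obtain ⟨N, hP, hQ, -⟩ := bdd₃ P Q Q
  have key : ∀ R : PDO B, (∀ n, N < n → R.coeff n = 0) → R.act f =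
      ∑ n ∈ Finset.range (N.toNat + 1), R.coeff n * iterD n f := fun R hR =>
    finsum_eq_sum_of_support_subset _ fun n hn => by
      by_contra h
      exact hn (by
        simp only [Finset.coe_range, Set.mem_Iio, not_lt] at h
        simp only [hR n (by omega), zero_mul])
  rw [key P hP, key Q hQ, key (P + Q) fun n hn => by rw [coeff_add, hP n hn, hQ n hn, add_zero],
    ← Finset.sum_add_distrib]
  simp only [coeff_add, add_mul]

lemma act_monomial (n : ℕ) (a f : B) : (monomial (n : ℤ) a).act f = a * iterD n f := by
  rw [act, finsum_eq_single _ n fun k hk => by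
    rw [coeff_monomial, if_neg (by omega), zero_mul], coeff_monomial_self]

/-- The action on `f` as an additive map in the operator. -/
noncomputable def actHom (f : B) : PDO B →+ B where
  toFun P := P.act f
  map_zero' := by simp [act]
  map_add' P Q := act_add P Q f

lemma neg_of_nonneg {P : PDO B} (h : ∀ n < 0, P.coeff n = 0) : P.neg = 0 := ext fun n => by
  rw [coeff_neg', coeff_zero]
  split_ifs with hn
  · exact h n hn
  · rfl

/-- Since `D f D⁻¹ = f + f' D⁻¹`, raising `n` by one splits off the differential operator `Dⁿ f` and
replaces `f` by `f'`. -/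
lemma neg_Dpow_mul_fun (n : ℕ) (f : B) :
    (monomial (n : ℤ) 1 * monomial 0 f * monomial (-1) 1).neg =
      monomial (-1) (iterD n f) := by
  induction n generalizing f with
  | zero =>
    rw [Nat.cast_zero, monomial_zero_one, one_mul, monomial_mul_Dpow]
    refine ext fun n => ?_
    rw [coeff_neg', coeff_monomial, coeff_monomial]
    split_ifs <;> first | omega | rfl
  | succ n ih =>
    have h1 : (monomial ((n + 1 : ℕ) : ℤ) (1 : B)) * monomial 0 f * monomial (-1) 1 =
        monomial (n : ℤ) 1 * monomial 0 f + monomial (n : ℤ) 1 * monomial 0 (f′) *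
          monomial (-1) 1 := by
      rw [Nat.cast_succ, ← monomial_mul_Dpow, mul_assoc (monomial (n : ℤ) 1), D_mul_fun, mul_add,
        add_mul, ← mul_assoc, mul_assoc _ (monomial 1 1), monomial_mul_Dpow, add_neg_cancel,
        monomial_zero_one, mul_one]
    rw [h1]
    refine (negHom.map_add _ _).trans ?_
    change neg _ + neg _ = _
    rw [ih, neg_of_nonneg, zero_add]
    · congr 1
    · intro k hk
      rw [coeff_monomial_mul, one_mul, leibnizCoeff]
      refine finsum_eq_zero_of_forall_eq_zero fun j => ?_
      rw [coeff_monomial]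
      split_ifs with h
      · have h2 : Ring.choose (n : ℤ) j = 0 := by
          rw [Ring.choose_natCast, Nat.choose_eq_zero_of_lt (by omega), Nat.cast_zero]
        rw [h2, zero_smul]
      · rw [iterD_map_zero, smul_zero]

/-- For a differential operator `P`, the pseudo-differential part of `P f D⁻¹` is `P(f) D⁻¹`. -/
lemma neg_mul_fun_mul {P : PDO B} (h : ∀ n < 0, P.coeff n = 0) (f : B) :
    (P * monomial 0 f * monomial (-1) 1).neg = monomial 0 (P.act f) * monomial (-1) 1 := by
  obtain ⟨N, hN⟩ := eq_sum_of_neg_eq_zero h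
  -- Both sides are additive in `P`, which reduces the claim to monomials `a Dⁿ`.
  let F : PDO B →+ PDO B := negHom.comp
    ((AddMonoidHom.mulRight (monomial (-1) 1)).comp (AddMonoidHom.mulRight (monomial 0 f)))
  let G : PDO B →+ PDO B := (AddMonoidHom.mulRight (monomial (-1) 1)).comp
    ((monomialHom 0).comp (actHom f))
  change F P = G P
  rw [hN, map_sum, map_sum]
  refine Finset.sum_congr rfl fun n _ => ?_
  change (monomial (n : ℤ) (P.coeff n) * monomial 0 f * monomial (-1) 1).neg =
    monomial 0 ((monomial (n : ℤ) (P.coeff n)).act f) * monomial (-1) 1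
  rw [act_monomial, monomial_mul_Dpow, zero_add, monomial_eq n, mul_assoc (monomial 0 _),
    mul_assoc (monomial 0 _), ← fun_mul_monomial, ← neg_Dpow_mul_fun]
  refine ext fun k => ?_
  simp only [coeff_neg', coeff_fun_mul, mul_ite, mul_zero]

lemma coeff_adjoint (P : PDO B) (n : ℤ) : P.adjoint.coeff n =
    ∑ᶠ j : ℕ, (((n + j).negOnePow : ℤ) * Ring.choose (n + j) j) • iterD j (P.coeff (n + j)) :=
  rfl

lemma coeff_adjoint_eq_sum {P : PDO B} {N : ℤ} (hP : ∀ n, N < n → P.coeff n = 0) {n : ℤ} {J : ℕ}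
    (hJ : N - n < J) : P.adjoint.coeff n = ∑ j ∈ Finset.range J,
      (((n + j).negOnePow : ℤ) * Ring.choose (n + j) j) • iterD j (P.coeff (n + j)) := by
  rw [coeff_adjoint]
  refine finsum_eq_sum_of_support_subset _ fun j hj => ?_
  simp only [Finset.coe_range, Set.mem_Iio]
  by_contra h
  exact hj (by simp only [hP (n + j) (by omega), iterD_map_zero, smul_zero])

/-- Conjugation as an additive map. -/
noncomputable def adjointHom : PDO B →+ PDO B where
  toFun := adjoint
  map_zero' := ext fun n => by
    rw [coeff_adjoint_eq_sum (N := n) (J := 1) (fun _ _ => rfl) (by simp)]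
    simp [iterD_zero]
  map_add' P Q := ext fun n => by
    obtain ⟨N, hP, hQ, -⟩ := bdd₃ P Q Q
    have hJ : N - n < ((N - n).toNat + 1 : ℕ) := by omega
    rw [coeff_add, coeff_adjoint_eq_sum hP hJ, coeff_adjoint_eq_sum hQ hJ,
      coeff_adjoint_eq_sum (fun n hn => by rw [coeff_add, hP n hn, hQ n hn, add_zero]) hJ,
      ← Finset.sum_add_distrib]
    simp only [coeff_add, iterD_add, smul_add]

/-- The coefficients of `(-D)ⁿ a` are binomial multiples of the derivatives of `a`; letting them act
on `f` reassembles the Leibniz formula for `∂ⁿ(a f)`. -/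
lemma adjoint_monomial_act (n : ℕ) (a f : B) :
    (monomial (n : ℤ) a).adjoint.act f = (-1 : ℤ) ^ n • iterD n (a * f) := by
  have hcoef : ∀ k : ℕ, (monomial (n : ℤ) a).adjoint.coeff k =
      if k ≤ n then ((-1 : ℤ) ^ n * n.choose (n - k)) • iterD (n - k) a else 0 := by
    intro k
    rw [coeff_adjoint, finsum_eq_single _ (n - k) fun j hj => by
      rw [coeff_monomial]
      split_ifs with h
      · omega
      · rw [iterD_map_zero, smul_zero]]
    split_ifs with hk
    · have h1 : (k : ℤ) + ((n - k : ℕ) : ℤ) = n := by omega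
      rw [h1, coeff_monomial_self, Ring.choose_natCast, Int.negOnePow_def]
      simp
    · rw [coeff_monomial, if_neg (by omega), iterD_map_zero, smul_zero]
  rw [act, finsum_eq_sum_of_support_subset (s := Finset.range (n + 1)) _ fun k hk => by
    by_contra h
    exact hk (by
      simp only [Finset.coe_range, Set.mem_Iio, not_lt] at h
      simp only [hcoef k, if_neg (show ¬ k ≤ n by omega), zero_mul]),
    mul_comm a f, iterD_mul, Finset.smul_sum]
  refine Finset.sum_congr rfl fun k hk => ?_
  have := Finset.mem_range.1 hk
  rw [hcoef, if_pos (by omega), Nat.choose_symm (by omega), mul_smul, smul_mul_assoc,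
    smul_mul_assoc, mul_comm (iterD k f)]
  norm_cast

/-- The mirror image of `neg_Dpow_mul_fun`, from `f D = D f - f'`; each step contributes a sign. -/
lemma neg_Dinv_mul_monomial (n : ℕ) (f : B) :
    (monomial (-1) 1 * monomial 0 f * monomial (n : ℤ) 1).neg =
      monomial (-1) 1 * monomial 0 ((-1 : ℤ) ^ n • iterD n f) := by
  induction n generalizing f with
  | zero =>
    rw [Nat.cast_zero, monomial_zero_one, mul_one, iterD_zero, pow_zero, one_smul]
    refine ext fun k => ?_
    rw [coeff_neg', ite_eq_left_iff]
    intro hk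
    refine (coeff_mul_eq_zero (N := -1) (M := 0) ?_ ?_ (by omega)).symm <;>
      exact fun i hi => by rw [coeff_monomial, if_neg (by omega)]
  | succ n ih =>
    have h1 : monomial (-1) (1 : B) * monomial 0 f * monomial ((n + 1 : ℕ) : ℤ) 1 =
        monomial (n : ℤ) f + monomial (-1) 1 * monomial 0 (-f′) * monomial (n : ℤ) 1 := by
      have h2 : monomial 0 f * monomial 1 (1 : B) =
          monomial 1 1 * monomial 0 f + monomial 0 (-f′) := by
        rw [D_mul_fun, monomial_neg]; abel
      rw [Nat.cast_succ, add_comm, ← monomial_mul_Dpow, mul_assoc, ← mul_assoc (monomial 0 f), h2,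
        add_mul, mul_add, ← mul_assoc, ← mul_assoc, monomial_mul_Dpow, neg_add_cancel,
        monomial_zero_one, one_mul, ← monomial_eq, ← mul_assoc]
    rw [h1]
    refine (negHom.map_add _ _).trans ?_
    change neg _ + neg _ = _
    rw [ih, neg_of_nonneg, zero_add]
    · congr 2
      have : iterD n (-f′) = -iterD (n + 1) f := by
        have h3 := iterD_zsmul n (-1) (f′)
        rw [neg_one_smul, neg_one_smul] at h3
        rw [h3, iterD, iterD, Function.iterate_succ_apply]
      rw [this, pow_succ, mul_neg_one, neg_smul, smul_neg]
    · intro k hk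
      rw [coeff_monomial, if_neg (by omega)]

/-- For a differential operator `P`, the pseudo-differential part of `D⁻¹ f P` is `D⁻¹ P*(f)`. -/
lemma neg_Dinv_mul_fun_mul {P : PDO B} (h : ∀ n < 0, P.coeff n = 0) (f : B) :
    (monomial (-1) 1 * monomial 0 f * P).neg =
      monomial (-1) 1 * monomial 0 (P.adjoint.act f) := by
  obtain ⟨N, hN⟩ := eq_sum_of_neg_eq_zero h
  let F : PDO B →+ PDO B := negHom.comp
    (AddMonoidHom.mulLeft (monomial (-1) 1 * monomial 0 f))
  let G : PDO B →+ PDO B := (AddMonoidHom.mulLeft (monomial (-1) 1)).comp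
    ((monomialHom 0).comp ((actHom f).comp adjointHom))
  change F P = G P
  rw [hN, map_sum, map_sum]
  refine Finset.sum_congr rfl fun n _ => ?_
  change (monomial (-1) 1 * monomial 0 f * monomial (n : ℤ) (P.coeff n)).neg =
    monomial (-1) 1 * monomial 0 ((monomial (n : ℤ) (P.coeff n)).adjoint.act f)
  rw [adjoint_monomial_act, monomial_eq n, mul_assoc, ← mul_assoc (monomial 0 f),
    fun_mul_monomial, ← mul_assoc, neg_Dinv_mul_monomial, mul_comm f]

end PDO

/-! ### Power series in the times: order filtration, differential and pseudo-differential parts -/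

section

lemma MvPowerSeries.mul_apply' {R : Type*} [Semiring R] (P Q : MvPowerSeries ℕ R) (μ : ℕ →₀ ℕ) :
    (P * Q) μ = ∑ p ∈ Finset.HasAntidiagonal.antidiagonal μ, P p.1 * Q p.2 :=
  MvPowerSeries.coeff_mul μ P Q

lemma MvPowerSeries.C_apply' {R : Type*} [Semiring R] (a : R) (μ : ℕ →₀ ℕ) :
    (MvPowerSeries.C a : MvPowerSeries ℕ R) μ = if μ = 0 then a else 0 :=
  MvPowerSeries.coeff_C μ a

lemma MvPowerSeries.mul_C_apply' {R : Type*} [Semiring R] (P : MvPowerSeries ℕ R) (a : R)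
    (μ : ℕ →₀ ℕ) : (P * MvPowerSeries.C a : MvPowerSeries ℕ R) μ = P μ * a :=
  MvPowerSeries.coeff_mul_C μ P a

lemma MvPowerSeries.C_mul_apply' {R : Type*} [Semiring R] (P : MvPowerSeries ℕ R) (a : R)
    (μ : ℕ →₀ ℕ) : (MvPowerSeries.C a * P : MvPowerSeries ℕ R) μ = a * P μ :=
  MvPowerSeries.coeff_C_mul μ P a

/-- Coefficientwise application of an additive map. -/
noncomputable def mapCoeffHom {R S : Type*} [AddCommGroup R] [AddCommGroup S] (f : R →+ S) :
    MvPowerSeries ℕ R →+ MvPowerSeries ℕ S where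
  toFun := mapCoeff f
  map_zero' := funext fun _ => map_zero f
  map_add' P Q := funext fun μ => map_add f (P μ) (Q μ)

namespace timeDeriv
variable {R : Type*} [Ring R]

/-- `∂/∂tₙ₊₂` as an additive map. -/
noncomputable def shift (n : ℕ) : MvPowerSeries ℕ R →+ MvPowerSeries ℕ R where
  toFun F := fun μ => (μ n + 1) • F (μ + Finsupp.single n 1)
  map_zero' := funext fun _ => smul_zero _
  map_add' _ _ := funext fun _ => smul_add _ _ _

lemma X_mul_shift (n : ℕ) (F : MvPowerSeries ℕ R) (μ : ℕ →₀ ℕ) :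
    (MvPowerSeries.X n * shift n F : MvPowerSeries ℕ R) μ = μ n • F μ := by
  classical
  have := MvPowerSeries.coeff_monomial_mul μ (Finsupp.single n 1) (shift n F) (1 : R)
  rw [← MvPowerSeries.X_def] at this
  refine this.trans ?_
  split_ifs with h
  · rw [one_mul]
    change (_ + 1) • F _ = _
    rw [tsub_add_cancel_of_le h]
    congr 1
    have h1 := h n
    simp only [Finsupp.single_eq_same, Finsupp.coe_tsub, Pi.sub_apply] at h1 ⊢
    omega
  · have : μ n = 0 := by
      by_contra h'
      exact h (Finsupp.single_le_iff.2 (Nat.one_le_iff_ne_zero.2 h'))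
    rw [this, zero_smul]

lemma X_mul_injective (n : ℕ) {F G : MvPowerSeries ℕ R}
    (h : MvPowerSeries.X n * F = MvPowerSeries.X n * G) : F = G := by
  refine funext fun μ => ?_
  have h1 : ∀ F : MvPowerSeries ℕ R,
      (MvPowerSeries.X n * F : MvPowerSeries ℕ R) (Finsupp.single n 1 + μ) = F μ := fun F => by
    have := MvPowerSeries.coeff_add_monomial_mul (Finsupp.single n 1) μ F (1 : R)
    rw [← MvPowerSeries.X_def, one_mul] at this
    exact this
  rw [← h1 F, h, h1]

/-- After multiplication by the central and cancellable variable `X n` the map becomes the Euler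
operator, which multiplies the coefficient at `μ` by `μ n`; the Leibniz rule is then the additivity
of `μ n` along the antidiagonal. -/
lemma shift_mul (n : ℕ) (F G : MvPowerSeries ℕ R) :
    shift n (F * G) = shift n F * G + F * shift n G := by
  refine X_mul_injective n ?_
  rw [mul_add, ← mul_assoc, ← mul_assoc, MvPowerSeries.X_mul (φ := F), mul_assoc F]
  refine funext fun μ => ?_
  rw [X_mul_shift]
  change _ = (_ : MvPowerSeries ℕ R) μ + (_ : MvPowerSeries ℕ R) μ
  rw [MvPowerSeries.mul_apply', MvPowerSeries.mul_apply', MvPowerSeries.mul_apply',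
    Finset.smul_sum, ← Finset.sum_add_distrib]
  refine Finset.sum_congr rfl fun p hp => ?_
  rw [X_mul_shift, X_mul_shift, ← Finset.HasAntidiagonal.mem_antidiagonal.1 hp, Finsupp.add_apply,
    smul_mul_assoc, mul_smul_comm, add_smul]

end timeDeriv

section
variable {B : Type u} [CommRing B]

lemma Op.ext' {P Q : Op B} (h : ∀ μ n, (P μ).coeff n = (Q μ).coeff n) : P = Q :=
  funext fun μ => PDO.ext (h μ)

end

variable {B : Type u} [CommRing B] [Differential B]

section Filtration

variable (B) in
/-- Operators all of whose coefficients have order at most `n`. -/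
def ordLE (n : ℤ) : AddSubgroup (Op B) where
  carrier := {P | ∀ μ k, n < k → (P μ).coeff k = 0}
  zero_mem' := fun _ _ _ => rfl
  add_mem' := fun {P Q} hP hQ μ k hk => by
    change (P μ + Q μ).coeff k = 0
    rw [PDO.coeff_add, hP μ k hk, hQ μ k hk, add_zero]
  neg_mem' := fun {P} hP μ k hk => by
    change (-P μ).coeff k = 0
    rw [PDO.coeff_neg, hP μ k hk, neg_zero]

lemma ordLE_mul {p q : ℤ} {P Q : Op B} (hP : P ∈ ordLE B p) (hQ : Q ∈ ordLE B q) :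
    P * Q ∈ ordLE B (p + q) := fun μ k hk => by
  rw [MvPowerSeries.mul_apply', PDO.coeff_sum]
  exact Finset.sum_eq_zero fun a _ => PDO.coeff_mul_eq_zero (hP a.1) (hQ a.2) hk

lemma ordLE_mono {p q : ℤ} (h : p ≤ q) {P : Op B} (hP : P ∈ ordLE B p) : P ∈ ordLE B q :=
  fun μ k hk => hP μ k (by omega)

lemma mulOp_mem_ordLE (f : Fn B) : mulOp f ∈ ordLE B 0 := fun μ k hk => by
  change (PDO.monomial 0 (f μ)).coeff k = 0
  rw [PDO.coeff_monomial, if_neg (by omega)]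

lemma Dpow_apply (n : ℤ) (μ : ℕ →₀ ℕ) :
    (Dpow n : Op B) μ = if μ = 0 then PDO.monomial n 1 else 0 :=
  MvPowerSeries.C_apply' _ _

lemma Dpow_mem_ordLE (n : ℤ) : (Dpow n : Op B) ∈ ordLE B n := fun μ k hk => by
  rw [Dpow_apply]
  split_ifs
  · rw [PDO.coeff_monomial, if_neg (by omega)]
  · rfl

/-- The filtration by order is separated, which is what makes the Neumann series below converge to
an actual inverse. -/
lemma eq_zero_of_forall_mem_ordLE {P : Op B} (h : ∀ k : ℕ, P ∈ ordLE B (-(k : ℤ))) : P = 0 :=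
  Op.ext' fun μ n => h ((-n).toNat + 1) μ n (by omega)

end Filtration

section Multiplication

/-- Multiplication operators form a commutative ring of operators. -/
noncomputable def mulOpHom : Fn B →+* Op B where
  toFun := mulOp
  map_zero' := (mapCoeffHom (PDO.monomialHom (B := B) 0)).map_zero
  map_add' := (mapCoeffHom (PDO.monomialHom (B := B) 0)).map_add
  map_one' := by
    classical
    refine funext fun μ => ?_
    have h1 := MvPowerSeries.C_apply' (1 : B) μ
    have h2 := MvPowerSeries.C_apply' (1 : PDO B) μ
    rw [map_one] at h1 h2
    change PDO.monomial 0 ((1 : Fn B) μ) = _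
    rw [h1, h2]
    split_ifs
    · rfl
    · exact PDO.monomial_zero 0
  map_mul' f g := funext fun μ => by
    change PDO.monomialHom 0 ((f * g) μ) = _
    rw [MvPowerSeries.mul_apply', MvPowerSeries.mul_apply', map_sum]
    exact Finset.sum_congr rfl fun p _ => (PDO.fun_mul_monomial 0 _ _).symm

lemma mulOp_apply (f : Fn B) (μ : ℕ →₀ ℕ) : mulOp f μ = PDO.monomial 0 (f μ) := rfl

lemma mulOp_zero : mulOp (0 : Fn B) = 0 := mulOpHom.map_zero

lemma mulOp_one : mulOp (1 : Fn B) = 1 := mulOpHom.map_one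

lemma mulOp_add (f g : Fn B) : mulOp (f + g) = mulOp f + mulOp g := mulOpHom.map_add f g

lemma mulOp_neg (f : Fn B) : mulOp (-f) = -mulOp f := mulOpHom.map_neg f

lemma mulOp_mul (f g : Fn B) : mulOp (f * g) = mulOp f * mulOp g := mulOpHom.map_mul f g

lemma mulOp_injective : Function.Injective (mulOp (B := B)) := fun _ _ h =>
  funext fun μ => PDO.monomial_injective 0 (congrFun h μ)

lemma Dpow_zero : (Dpow 0 : Op B) = 1 := map_one MvPowerSeries.C

lemma Dpow_mul_Dpow (p q : ℤ) : (Dpow p * Dpow q : Op B) = Dpow (p + q) := by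
  rw [Dpow, Dpow, ← map_mul, PDO.monomial_mul_Dpow, Dpow]

lemma Dpow_mul_cancel {p q : ℤ} (h : p + q = 0) (P : Op B) : Dpow p * (Dpow q * P) = P := by
  rw [← mul_assoc, Dpow_mul_Dpow, h, Dpow_zero, one_mul]

lemma mul_Dpow_cancel {p q : ℤ} (h : p + q = 0) (P : Op B) : P * Dpow p * Dpow q = P := by
  rw [mul_assoc, Dpow_mul_Dpow, h, Dpow_zero, mul_one]

/-- The derivative in `x` of a function of all times. -/
noncomputable def Fn.dx : Fn B →+ Fn B :=
  mapCoeffHom (Differential.deriv (R := B)).toLinearMap.toAddMonoidHom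

lemma Dpow_one_mul_mulOp (f : Fn B) :
    Dpow 1 * mulOp f = mulOp f * Dpow 1 + mulOp (Fn.dx f) := funext fun μ => by
  change _ = (mulOp f * Dpow 1 : Op B) μ + mulOp (Fn.dx f) μ
  rw [Dpow, MvPowerSeries.C_mul_apply', MvPowerSeries.mul_C_apply', mulOp_apply, mulOp_apply,
    PDO.D_mul_fun]
  rfl

/-- `f'` is the commutator of `D` with the multiplication operator `f`. -/
lemma Fn.dx_mul (f g : Fn B) : Fn.dx (f * g) = Fn.dx f * g + f * Fn.dx g := by
  apply mulOp_injective
  have h (f : Fn B) := eq_sub_of_add_eq' (Dpow_one_mul_mulOp f).symm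
  rw [mulOp_add, mulOp_mul, mulOp_mul, h, h, h, mulOp_mul]
  noncomm_ring

/-- `D⁻¹ f' D⁻¹ = f D⁻¹ - D⁻¹ f`. -/
lemma Dinv_mul_dx_mul_Dinv (f : Fn B) : Dpow (-1) * mulOp (Fn.dx f) * Dpow (-1) =
    mulOp f * Dpow (-1) - Dpow (-1) * mulOp f := by
  rw [eq_sub_of_add_eq' (Dpow_one_mul_mulOp f).symm, mul_sub, Dpow_mul_cancel (neg_add_cancel 1), sub_mul,
    mul_assoc, mul_assoc (mulOp f), Dpow_mul_Dpow, add_neg_cancel, Dpow_zero, mul_one]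

end Multiplication

section Parts

lemma plusPart_apply (P : Op B) (μ : ℕ →₀ ℕ) : plusPart P μ = (P μ).pos := rfl

lemma minusPart_apply (P : Op B) (μ : ℕ →₀ ℕ) : minusPart P μ = (P μ).neg := rfl

/-- `P ↦ P₊` as an additive map. -/
noncomputable def plusHom : Op B →+ Op B := mapCoeffHom PDO.posHom

/-- `P ↦ P₋` as an additive map. -/
noncomputable def minusHom : Op B →+ Op B := mapCoeffHom PDO.negHom

lemma plusPart_add (P Q : Op B) : plusPart (P + Q) = plusPart P + plusPart Q :=
  plusHom.map_add P Q

lemma plusPart_sub (P Q : Op B) : plusPart (P - Q) = plusPart P - plusPart Q :=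
  plusHom.map_sub P Q

lemma minusPart_add (P Q : Op B) : minusPart (P + Q) = minusPart P + minusPart Q :=
  minusHom.map_add P Q

lemma plusPart_zero : plusPart (0 : Op B) = 0 := plusHom.map_zero

lemma plusPart_add_minusPart (P : Op B) : plusPart P + minusPart P = P :=
  funext fun μ => PDO.pos_add_neg (P μ)

lemma minusPart_eq (P : Op B) : minusPart P = P - plusPart P :=
  eq_sub_of_add_eq' (plusPart_add_minusPart P)

lemma minusPart_mem (P : Op B) : minusPart P ∈ ordLE B (-1) := fun μ k hk => by
  rw [minusPart_apply, PDO.coeff_neg', if_neg (by omega)]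

lemma minusPart_of_mem {P : Op B} (h : P ∈ ordLE B (-1)) : minusPart P = P :=
  Op.ext' fun μ n => by
    rw [minusPart_apply, PDO.coeff_neg']
    split_ifs with hn
    · rfl
    · exact (h μ n (by omega)).symm

lemma plusPart_of_mem {P : Op B} (h : P ∈ ordLE B (-1)) : plusPart P = 0 := by
  have := plusPart_add_minusPart P
  rwa [minusPart_of_mem h, add_eq_right] at this

lemma mem_ordLE_of_plusPart {P : Op B} (h : plusPart P = 0) : P ∈ ordLE B (-1) := by
  rw [← plusPart_add_minusPart P, h, zero_add]
  exact minusPart_mem P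

variable (B) in
/-- The ring of differential operators. -/
def diffOps : Subring (Op B) where
  carrier := {P | ∀ μ, ∀ n < 0, (P μ).coeff n = 0}
  zero_mem' := fun _ _ _ => rfl
  one_mem' := fun μ n hn => by
    have h := MvPowerSeries.C_apply' (1 : PDO B) μ
    rw [map_one] at h
    rw [h]
    split_ifs
    · rw [PDO.coeff_one, if_neg (by omega)]
    · rfl
  add_mem' := fun {P Q} hP hQ μ k hk => by
    change (P μ + Q μ).coeff k = 0
    rw [PDO.coeff_add, hP μ k hk, hQ μ k hk, add_zero]
  neg_mem' := fun {P} hP μ k hk => by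
    change (-P μ).coeff k = 0
    rw [PDO.coeff_neg, hP μ k hk, neg_zero]
  mul_mem' := fun {P Q} hP hQ μ k hk => by
    rw [MvPowerSeries.mul_apply', PDO.coeff_sum]
    refine Finset.sum_eq_zero fun a _ => ?_
    obtain ⟨N, J, h1, h2, h3⟩ := PDO.exists_bound₂ (P a.1) (Q a.2) k
    rw [PDO.coeff_mul_eq_sum h1 h2 h3]
    refine Finset.sum_eq_zero fun p _ => Finset.sum_eq_zero fun j _ => ?_
    by_cases hp : p < 0
    · rw [hP _ p hp, zero_mul, smul_zero]
    · by_cases hj : k - p + j < 0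
      · rw [hQ _ _ hj, iterD_map_zero, mul_zero, smul_zero]
      · lift p to ℕ using by omega
        rw [Ring.choose_natCast, Nat.choose_eq_zero_of_lt (by omega), Nat.cast_zero, zero_smul]

lemma plusPart_mem (P : Op B) : plusPart P ∈ diffOps B := fun μ k hk => by
  rw [plusPart_apply, PDO.coeff_pos, if_neg (by omega)]

lemma plusPart_of_diff {P : Op B} (h : P ∈ diffOps B) : plusPart P = P :=
  Op.ext' fun μ n => by
    rw [plusPart_apply, PDO.coeff_pos]
    split_ifs with hn
    · rfl
    · exact (h μ n (by omega)).symm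

lemma minusPart_of_diff {P : Op B} (h : P ∈ diffOps B) : minusPart P = 0 := by
  rw [minusPart_eq, plusPart_of_diff h, sub_self]

lemma mulOp_mem_diff (f : Fn B) : mulOp f ∈ diffOps B := fun μ k hk => by
  rw [mulOp_apply, PDO.coeff_monomial, if_neg (by omega)]

lemma Dpow_mem_diff (n : ℕ) : (Dpow n : Op B) ∈ diffOps B := fun μ k hk => by
  rw [Dpow_apply]
  split_ifs
  · rw [PDO.coeff_monomial, if_neg (by omega)]
  · rfl

lemma Dpow_one_mem_diff : (Dpow 1 : Op B) ∈ diffOps B := Dpow_mem_diff 1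

lemma plusPart_eq_of_sub_mem {P Q : Op B} (h : P - Q ∈ ordLE B (-1)) : plusPart P = plusPart Q := by
  rw [← sub_eq_zero, ← plusPart_sub, plusPart_of_mem h]

lemma plusPart_mul_of_mem {P Q : Op B} (hP : P ∈ ordLE B (-1)) (hQ : Q ∈ ordLE B 0) :
    plusPart (P * Q) = 0 :=
  plusPart_of_mem (ordLE_mono (by omega) (ordLE_mul hP hQ))

end Parts

section Action

/-- For a differential operator `P`, the pseudo-differential part of `P f D⁻¹` is `P(f) D⁻¹`. -/
lemma minusPart_mul_mulOp_mul_Dinv {P : Op B} (h : P ∈ diffOps B) (f : Fn B) :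
    minusPart (P * mulOp f * Dpow (-1)) = mulOp (applyDiff P f) * Dpow (-1) := funext fun μ => by
  rw [minusPart_apply, Dpow, MvPowerSeries.mul_C_apply', MvPowerSeries.mul_C_apply',
    MvPowerSeries.mul_apply', mulOp_apply, applyDiff, Finset.sum_mul]
  change PDO.negHom _ = PDO.monomialHom 0 _ * _
  rw [map_sum, map_sum, Finset.sum_mul]
  exact Finset.sum_congr rfl fun p _ => PDO.neg_mul_fun_mul (h p.1) (f p.2)

/-- For a differential operator `P`, the pseudo-differential part of `D⁻¹ f P` is `D⁻¹ P*(f)`. -/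
lemma minusPart_Dinv_mul_mulOp_mul {P : Op B} (h : P ∈ diffOps B) (f : Fn B) :
    minusPart (Dpow (-1) * mulOp f * P) = Dpow (-1) * mulOp (applyDiff (adjointOp P) f) :=
  funext fun μ => by
    rw [minusPart_apply, Dpow, MvPowerSeries.C_mul_apply', mul_assoc, MvPowerSeries.C_mul_apply',
      MvPowerSeries.mul_apply', mulOp_apply, applyDiff, Finset.mul_sum]
    change PDO.negHom _ = _ * PDO.monomialHom 0 _
    rw [map_sum, map_sum, Finset.mul_sum]
    refine (Finset.sum_congr rfl fun p _ => ?_).trans (Finsupp.sum_antidiagonal_swap μ fun a b =>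
      PDO.monomial (-1) 1 * PDO.monomialHom 0 ((P b).adjoint.act (f a)))
    rw [← mul_assoc]
    exact PDO.neg_Dinv_mul_fun_mul (h p.2) (f p.1)

end Action

end

/-! ### Actions as remainders of division by `D`, classes of coefficients, Neumann series -/

section

variable {B : Type u} [CommRing B] [Differential B]

section Action

/-- The action `P*(g)` of the conjugate of a differential operator. -/
noncomputable abbrev applyAdj (P : Op B) (g : Fn B) : Fn B := applyDiff (adjointOp P) g

/-- Division of `P f` by `D` on the right: the quotient is `(P f D⁻¹)₊`, and `P(f)` is the
remainder. -/
lemma exists_mul_mulOp {P : Op B} (h : P ∈ diffOps B) (f : Fn B) :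
    ∃ S ∈ diffOps B, P * mulOp f = mulOp (applyDiff P f) + S * Dpow 1 := by
  refine ⟨_, plusPart_mem (P * mulOp f * Dpow (-1)), ?_⟩
  have h1 := plusPart_add_minusPart (P * mulOp f * Dpow (-1))
  rw [minusPart_mul_mulOp_mul_Dinv h] at h1
  have h2 : ∀ X : Op B, X * Dpow (-1) * Dpow 1 = X := mul_Dpow_cancel (neg_add_cancel 1)
  rw [eq_sub_of_add_eq h1, sub_mul, h2, h2, add_sub_cancel]

/-- The remainder is unique because a differential quotient does not contribute to the part of
negative order. The rules for `applyDiff` below are read off from this characterization, without the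
explicit formula for the action. -/
lemma applyDiff_unique {P S : Op B} {f g : Fn B} (h : P ∈ diffOps B) (hS : S ∈ diffOps B)
    (e : P * mulOp f = mulOp g + S * Dpow 1) : applyDiff P f = g := by
  have h1 := minusPart_mul_mulOp_mul_Dinv h f
  have h2 : (mulOp g : Op B) * Dpow (-1) ∈ ordLE B (-1) :=
    ordLE_mono (by omega) (ordLE_mul (mulOp_mem_ordLE g) (Dpow_mem_ordLE (-1)))
  rw [e, add_mul, mul_Dpow_cancel (add_neg_cancel 1), minusPart_add, minusPart_of_diff hS, add_zero,
    minusPart_of_mem h2] at h1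
  apply mulOp_injective
  have h3 : ∀ X : Op B, X * Dpow (-1) * Dpow 1 = X := mul_Dpow_cancel (neg_add_cancel 1)
  rw [← h3 (mulOp (applyDiff P f)), ← h1, h3]

/-- The conjugate action is the remainder of `f P` in the division by `D` on the left, so `P*` is
handled without manipulating its coefficients. -/
lemma exists_mulOp_mul {P : Op B} (h : P ∈ diffOps B) (f : Fn B) :
    ∃ S ∈ diffOps B, mulOp f * P = mulOp (applyAdj P f) + Dpow 1 * S := by
  refine ⟨_, plusPart_mem (Dpow (-1) * mulOp f * P), ?_⟩
  have h1 := plusPart_add_minusPart (Dpow (-1) * mulOp f * P)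
  rw [minusPart_Dinv_mul_mulOp_mul h] at h1
  have h2 : ∀ X : Op B, Dpow 1 * (Dpow (-1) * X) = X := Dpow_mul_cancel (add_neg_cancel 1)
  rw [eq_sub_of_add_eq h1, mul_sub, mul_assoc (Dpow (-1)) (mulOp f) P, h2 (mulOp f * P),
    h2 (mulOp (applyAdj P f)), add_sub_cancel]

lemma applyAdj_unique {P S : Op B} {f g : Fn B} (h : P ∈ diffOps B) (hS : S ∈ diffOps B)
    (e : mulOp f * P = mulOp g + Dpow 1 * S) : applyAdj P f = g := by
  have h1 := minusPart_Dinv_mul_mulOp_mul h f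
  have h2 : (Dpow (-1) : Op B) * mulOp g ∈ ordLE B (-1) :=
    ordLE_mono (by omega) (ordLE_mul (Dpow_mem_ordLE (-1)) (mulOp_mem_ordLE g))
  rw [mul_assoc, e, mul_add, Dpow_mul_cancel (neg_add_cancel 1) S, minusPart_add, minusPart_of_diff hS, add_zero,
    minusPart_of_mem h2] at h1
  apply mulOp_injective
  have h3 : ∀ X : Op B, Dpow 1 * (Dpow (-1) * X) = X := Dpow_mul_cancel (add_neg_cancel 1)
  rw [← h3 (mulOp (applyAdj P f)), ← h1, h3 (mulOp g)]

lemma applyDiff_mulOp (a f : Fn B) : applyDiff (mulOp a) f = a * f :=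
  applyDiff_unique (mulOp_mem_diff a) (zero_mem _) (by rw [zero_mul, add_zero, mulOp_mul])

lemma applyAdj_mulOp (a f : Fn B) : applyAdj (mulOp a) f = a * f :=
  applyAdj_unique (mulOp_mem_diff a) (zero_mem _)
    (by rw [mul_zero, add_zero, ← mulOp_mul, mul_comm])

lemma applyDiff_one (f : Fn B) : applyDiff 1 f = f := by
  rw [← mulOp_one, applyDiff_mulOp, one_mul]

lemma applyAdj_one (f : Fn B) : applyAdj 1 f = f := by
  rw [← mulOp_one, applyAdj_mulOp, one_mul]

lemma applyDiff_D (f : Fn B) : applyDiff (Dpow 1) f = Fn.dx f :=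
  applyDiff_unique Dpow_one_mem_diff (mulOp_mem_diff f)
    (by rw [Dpow_one_mul_mulOp, add_comm])

lemma applyAdj_D (f : Fn B) : applyAdj (Dpow 1) f = -Fn.dx f :=
  applyAdj_unique Dpow_one_mem_diff (mulOp_mem_diff f)
    (by rw [Dpow_one_mul_mulOp, mulOp_neg]; abel)

lemma applyDiff_add_left {P Q : Op B} (hP : P ∈ diffOps B) (hQ : Q ∈ diffOps B) (f : Fn B) :
    applyDiff (P + Q) f = applyDiff P f + applyDiff Q f := by
  obtain ⟨S, hS, e⟩ := exists_mul_mulOp hP f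
  obtain ⟨T, hT, e'⟩ := exists_mul_mulOp hQ f
  refine applyDiff_unique (add_mem hP hQ) (add_mem hS hT) ?_
  rw [add_mul, e, e', mulOp_add, add_mul]
  abel

lemma applyDiff_add {P : Op B} (hP : P ∈ diffOps B) (f g : Fn B) :
    applyDiff P (f + g) = applyDiff P f + applyDiff P g := by
  obtain ⟨S, hS, e⟩ := exists_mul_mulOp hP f
  obtain ⟨T, hT, e'⟩ := exists_mul_mulOp hP g
  refine applyDiff_unique hP (add_mem hS hT) ?_
  rw [mulOp_add, mul_add, e, e', mulOp_add, add_mul]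
  abel

lemma applyDiff_zero_left (f : Fn B) : applyDiff 0 f = 0 := by
  rw [← mulOp_zero, applyDiff_mulOp, zero_mul]

lemma applyAdj_zero_left (f : Fn B) : applyAdj 0 f = 0 := by
  rw [← mulOp_zero, applyAdj_mulOp, zero_mul]

lemma applyDiff_mul {P Q : Op B} (hP : P ∈ diffOps B) (hQ : Q ∈ diffOps B) (f : Fn B) :
    applyDiff (P * Q) f = applyDiff P (applyDiff Q f) := by
  obtain ⟨S, hS, e⟩ := exists_mul_mulOp hQ f
  obtain ⟨T, hT, e'⟩ := exists_mul_mulOp hP (applyDiff Q f)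
  refine applyDiff_unique (mul_mem hP hQ) (add_mem hT (mul_mem hP hS)) ?_
  rw [mul_assoc, e, mul_add, e', add_mul, mul_assoc, add_assoc]

lemma applyAdj_add_left {P Q : Op B} (hP : P ∈ diffOps B) (hQ : Q ∈ diffOps B) (f : Fn B) :
    applyAdj (P + Q) f = applyAdj P f + applyAdj Q f := by
  obtain ⟨S, hS, e⟩ := exists_mulOp_mul hP f
  obtain ⟨T, hT, e'⟩ := exists_mulOp_mul hQ f
  refine applyAdj_unique (add_mem hP hQ) (add_mem hS hT) ?_
  rw [mul_add, e, e', mulOp_add, mul_add]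
  abel

lemma applyAdj_add {P : Op B} (hP : P ∈ diffOps B) (f g : Fn B) :
    applyAdj P (f + g) = applyAdj P f + applyAdj P g := by
  obtain ⟨S, hS, e⟩ := exists_mulOp_mul hP f
  obtain ⟨T, hT, e'⟩ := exists_mulOp_mul hP g
  refine applyAdj_unique hP (add_mem hS hT) ?_
  rw [mulOp_add, add_mul, e, e', mulOp_add, mul_add]
  abel

lemma applyAdj_mul {P Q : Op B} (hP : P ∈ diffOps B) (hQ : Q ∈ diffOps B) (f : Fn B) :
    applyAdj (P * Q) f = applyAdj Q (applyAdj P f) := by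
  obtain ⟨S, hS, e⟩ := exists_mulOp_mul hP f
  obtain ⟨T, hT, e'⟩ := exists_mulOp_mul hQ (applyAdj P f)
  refine applyAdj_unique (mul_mem hP hQ) (add_mem hT (mul_mem hS hQ)) ?_
  rw [← mul_assoc, e, add_mul, e', mul_add, mul_assoc, add_assoc]

/-- The Lagrange identity between a differential operator and its conjugate. -/
lemma applyDiff_mul_eq {P S : Op B} {a : Fn B} (hP : P ∈ diffOps B) (hS : S ∈ diffOps B)
    (e : P * mulOp a = mulOp (applyDiff P a) + S * Dpow 1) (g : Fn B) :
    applyDiff P a * g = a * applyAdj P g + Fn.dx (applyAdj S g) := by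
  -- Conjugating the division identity and applying it to `g` gives `a P*(g) = P(a) g - ∂(S*(g))`.
  have h : applyAdj (P * mulOp a) g = applyAdj (mulOp (applyDiff P a) + S * Dpow 1) g := by rw [e]
  rw [applyAdj_mul hP (mulOp_mem_diff a), applyAdj_add_left (mulOp_mem_diff _)
    (mul_mem hS Dpow_one_mem_diff), applyAdj_mul hS Dpow_one_mem_diff, applyAdj_mulOp,
    applyAdj_mulOp, applyAdj_D] at h
  rw [h]
  abel

end Action

section Coefficients

/-- Operators whose coefficients lie in `I`. -/
def coeffsIn (I : AddSubgroup B) : AddSubgroup (Op B) where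
  carrier := {P | ∀ μ n, (P μ).coeff n ∈ I}
  zero_mem' := fun _ _ => zero_mem I
  add_mem' := fun hP hQ μ n => add_mem (hP μ n) (hQ μ n)
  neg_mem' := fun hP μ n => neg_mem (hP μ n)

/-- Functions of all times whose coefficients lie in `I`. -/
def valuesIn (I : AddSubgroup B) : AddSubgroup (Fn B) where
  carrier := {f | ∀ μ, f μ ∈ I}
  zero_mem' := fun _ => zero_mem I
  add_mem' := fun hf hg μ => add_mem (hf μ) (hg μ)
  neg_mem' := fun hf μ => neg_mem (hf μ)

/-- Stability under the derivation. -/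
def derivStable (I : AddSubgroup B) : Prop := ∀ b ∈ I, b′ ∈ I

variable {I J H : AddSubgroup B}

lemma mulOp_mem_coeffsIn {f : Fn B} (hf : f ∈ valuesIn I) : mulOp f ∈ coeffsIn I := fun μ n => by
  rw [mulOp_apply, PDO.coeff_monomial]
  split_ifs
  · exact hf μ
  · exact zero_mem I

lemma Dpow_mem_coeffsIn (h : 1 ∈ I) (n : ℤ) : Dpow n ∈ coeffsIn I := fun μ k => by
  rw [Dpow_apply]
  split_ifs
  · rw [PDO.coeff_monomial]
    split_ifs
    · exact h
    · exact zero_mem I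
  · exact zero_mem I

lemma mul_mem_coeffsIn (hJ : derivStable J) (hIJ : ∀ a ∈ I, ∀ b ∈ J, a * b ∈ H) {P Q : Op B}
    (hP : P ∈ coeffsIn I) (hQ : Q ∈ coeffsIn J) : P * Q ∈ coeffsIn H := fun μ n => by
  rw [MvPowerSeries.mul_apply', PDO.coeff_sum]
  exact sum_mem fun p _ => PDO.coeff_mul_mem hJ hIJ (hP p.1) (hQ p.2) n

lemma Dpow_mul_mem_coeffsIn (hI : derivStable I) (n : ℤ) {P : Op B} (hP : P ∈ coeffsIn I) :
    Dpow n * P ∈ coeffsIn I := by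
  -- The coefficients of `Dⁿ` are integers, so no unit is required in `I`.
  refine mul_mem_coeffsIn (I := AddSubgroup.zmultiples 1) hI ?_
    (Dpow_mem_coeffsIn (AddSubgroup.mem_zmultiples 1) n) hP
  rintro _ ⟨z, rfl⟩ b hb
  change z • (1 : B) * b ∈ I
  rw [smul_mul_assoc, one_mul]
  exact zsmul_mem hb z

lemma mul_Dpow_mem_coeffsIn (n : ℤ) {P : Op B} (hP : P ∈ coeffsIn I) :
    P * Dpow n ∈ coeffsIn I := fun μ k => by
  rw [Dpow, MvPowerSeries.mul_C_apply', PDO.coeff_mul_Dpow]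
  exact hP μ _

lemma plusPart_mem_coeffsIn {P : Op B} (hP : P ∈ coeffsIn I) : plusPart P ∈ coeffsIn I :=
  fun μ n => by
    rw [plusPart_apply, PDO.coeff_pos]
    split_ifs
    · exact hP μ n
    · exact zero_mem I

lemma minusPart_mem_coeffsIn {P : Op B} (hP : P ∈ coeffsIn I) : minusPart P ∈ coeffsIn I := by
  rw [minusPart_eq]
  exact sub_mem hP (plusPart_mem_coeffsIn hP)

lemma mem_valuesIn_of_mulOp_mul_Dpow {f : Fn B} {n : ℤ} (h : mulOp f * Dpow n ∈ coeffsIn I) :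
    f ∈ valuesIn I := fun μ => by
  have := h μ n
  rw [Dpow, MvPowerSeries.mul_C_apply', mulOp_apply, PDO.monomial_mul_Dpow, zero_add,
    PDO.coeff_monomial_self] at this
  exact this

lemma mul_mem_valuesIn (hIJ : ∀ a ∈ I, ∀ b ∈ J, a * b ∈ H) {f g : Fn B} (hf : f ∈ valuesIn I)
    (hg : g ∈ valuesIn J) : f * g ∈ valuesIn H := fun μ => by
  rw [MvPowerSeries.mul_apply']
  exact sum_mem fun p _ => hIJ _ (hf _) _ (hg _)

lemma dx_mem_valuesIn (hI : derivStable I) {f : Fn B} (hf : f ∈ valuesIn I) :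
    Fn.dx f ∈ valuesIn I := fun μ => hI _ (hf μ)

lemma applyDiff_mem_valuesIn (hJ : derivStable J) (hIJ : ∀ a ∈ I, ∀ b ∈ J, a * b ∈ H)
    {P : Op B} (h : P ∈ diffOps B) (hP : P ∈ coeffsIn I) {f : Fn B} (hf : f ∈ valuesIn J) :
    applyDiff P f ∈ valuesIn H := by
  refine mem_valuesIn_of_mulOp_mul_Dpow (n := -1) ?_
  rw [← minusPart_mul_mulOp_mul_Dinv h]
  exact minusPart_mem_coeffsIn (mul_Dpow_mem_coeffsIn _
    (mul_mem_coeffsIn hJ hIJ hP (mulOp_mem_coeffsIn hf)))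

lemma applyAdj_mem_valuesIn (hI : derivStable I) (hH : derivStable H)
    (hIJ : ∀ a ∈ I, ∀ b ∈ J, a * b ∈ H)
    {P : Op B} (h : P ∈ diffOps B) (hP : P ∈ coeffsIn I) {f : Fn B} (hf : f ∈ valuesIn J) :
    applyAdj P f ∈ valuesIn H := by
  refine mem_valuesIn_of_mulOp_mul_Dpow (n := 0) ?_
  rw [Dpow_zero, mul_one]
  have h1 := minusPart_Dinv_mul_mulOp_mul h f
  have h2 : minusPart (Dpow (-1) * mulOp f * P) ∈ coeffsIn H := by
    rw [mul_assoc]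
    exact minusPart_mem_coeffsIn (Dpow_mul_mem_coeffsIn hH _
      (mul_mem_coeffsIn hI (fun a ha b hb => mul_comm b a ▸ hIJ b hb a ha)
        (mulOp_mem_coeffsIn hf) hP))
  rw [h1] at h2
  have h3 := Dpow_mul_mem_coeffsIn hH 1 h2
  rwa [← mul_assoc, Dpow_mul_Dpow, add_neg_cancel, Dpow_zero, one_mul] at h3

end Coefficients

section Inverse

/-- A Neumann series: the operators congruent to `1` modulo negative order are invertible. -/
theorem exists_inverse {P : Op B} (hP : plusPart P = 1) : ∃ V : Op B, P * V = 1 ∧ V * P = 1 ∧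
    plusPart V = 1 ∧ ∀ I : AddSubgroup B, derivStable I → (1 : B) ∈ I →
      (∀ a ∈ I, ∀ b ∈ I, a * b ∈ I) → P ∈ coeffsIn I → V ∈ coeffsIn I := by
  set N : Op B := 1 - P with hN
  have h1 : plusPart (1 : Op B) = 1 := plusPart_of_diff (one_mem _)
  have hN1 : N ∈ ordLE B (-1) := mem_ordLE_of_plusPart (by rw [hN, plusPart_sub, hP, h1, sub_self])
  have hNk : ∀ k : ℕ, N ^ k ∈ ordLE B (-(k : ℤ)) := by
    intro k
    induction k with
    | zero =>
      rw [pow_zero, ← mulOp_one]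
      exact mulOp_mem_ordLE 1
    | succ k ih =>
      rw [pow_succ]
      exact ordLE_mono (by push_cast; omega) (ordLE_mul ih hN1)
  let S : ℕ → Op B := fun K => ∑ k ∈ Finset.range K, N ^ k
  have hS : ∀ K L : ℕ, K ≤ L → S L - S K ∈ ordLE B (-(K : ℤ)) := by
    intro K L hKL
    rw [← Finset.sum_Ico_eq_sub _ hKL]
    refine sum_mem fun k hk => ordLE_mono ?_ (hNk k)
    have := Finset.mem_Ico.1 hk
    omega
  have hcoef : ∀ (K L : ℕ) (μ) (n : ℤ), -(K : ℤ) < n → -(L : ℤ) < n →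
      (S L μ).coeff n = (S K μ).coeff n := by
    have key : ∀ (K L : ℕ) (μ) (n : ℤ), K ≤ L → -(K : ℤ) < n →
        (S L μ).coeff n = (S K μ).coeff n := fun K L μ n hKL hK => by
      have h := hS K L hKL μ n hK
      exact sub_eq_zero.1 h
    intro K L μ n hK hL
    rcases le_total K L with h | h
    · exact key K L μ n h hK
    · exact (key L K μ n h hL).symm
  have hord : ∀ K, S K ∈ ordLE B 0 := fun K =>
    sum_mem fun k _ => ordLE_mono (by omega) (hNk k)
  -- The coefficient of `Dⁿ` in the partial sum `S K` no longer changes once `-K < n`, and `K =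
  -- (-n).toNat + 1` is large enough.
  let V : Op B := fun μ => ⟨fun n => (S ((-n).toNat + 1) μ).coeff n, 0,
    fun n hn => hord _ μ n hn⟩
  have hV : ∀ K : ℕ, V - S K ∈ ordLE B (-(K : ℤ)) := fun K μ n hn => by
    change (S ((-n).toNat + 1) μ).coeff n - (S K μ).coeff n = 0
    rw [hcoef K ((-n).toNat + 1) μ n hn (by omega), sub_self]
  have hP0 : P ∈ ordLE B 0 := by
    rw [show P = 1 - N by rw [hN]; abel]
    exact sub_mem (by rw [← mulOp_one]; exact mulOp_mem_ordLE 1) (ordLE_mono (by omega) hN1)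
  have hPN : P = 1 - N := by rw [hN]; abel
  refine ⟨V, ?_, ?_, ?_, ?_⟩
  · rw [← sub_eq_zero]
    refine eq_zero_of_forall_mem_ordLE fun K => ?_
    -- The geometric sum gives `P S_K = 1 - N^K`; both terms on the right have order at most `-K`.
    have e : P * V - 1 = P * (V - S K) - N ^ K := by
      have := mul_neg_geom_sum N K
      rw [← hPN] at this
      rw [mul_sub, this]
      abel
    rw [e]
    exact sub_mem (ordLE_mono (by omega) (ordLE_mul hP0 (hV K))) (hNk K)
  · rw [← sub_eq_zero]
    refine eq_zero_of_forall_mem_ordLE fun K => ?_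
    have e : V * P - 1 = (V - S K) * P - N ^ K := by
      have := geom_sum_mul_neg N K
      rw [← hPN] at this
      rw [sub_mul, this]
      abel
    rw [e]
    exact sub_mem (ordLE_mono (by omega) (ordLE_mul (hV K) hP0)) (hNk K)
  · rw [← h1]
    refine plusPart_eq_of_sub_mem ?_
    have := hV 1
    simpa [S] using this
  · intro I hI h1I hmul hPI
    have h1' : (1 : Op B) ∈ coeffsIn I := by
      rw [← Dpow_zero]
      exact Dpow_mem_coeffsIn h1I 0
    have hNI : ∀ k, N ^ k ∈ coeffsIn I := by
      intro k
      induction k with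
      | zero => rwa [pow_zero]
      | succ k ih =>
        rw [pow_succ]
        exact mul_mem_coeffsIn hI hmul ih (sub_mem h1' hPI)
    have hSI : ∀ K, S K ∈ coeffsIn I := fun K => sum_mem fun k _ => hNI k
    exact fun μ n => hSI _ μ n

end Inverse

end

/-! ### Function classes, `∂ₓ⁻¹`, and operators carrying their actions -/

section

variable {B : Type u} [CommRing B] [Algebra ℚ B] [Differential B]

namespace FunctionClass
variable (K : FunctionClass B)

section Classes

/-- The additive group of `K.coeffs`. -/
def coeffGroup : AddSubgroup B := (Subalgebra.toSubmodule K.coeffs).toAddSubgroup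

/-- The additive group of `K.eig`. -/
def eigGroup : AddSubgroup B := K.eig.toAddSubgroup

/-- The additive group of `K.adj`. -/
def adjGroup : AddSubgroup B := K.adj.toAddSubgroup

/-- The additive group of `K.pot`. -/
def potGroup : AddSubgroup B := K.pot.toAddSubgroup

lemma coeffGroup_stable : derivStable K.coeffGroup := K.deriv_coeffs

lemma eigGroup_stable : derivStable K.eigGroup := K.deriv_eig

lemma adjGroup_stable : derivStable K.adjGroup := K.deriv_adj

lemma potGroup_stable : derivStable K.potGroup := fun _ hb => K.bijOn_deriv.mapsTo hb

lemma coeff_mul_coeff : ∀ a ∈ K.coeffGroup, ∀ b ∈ K.coeffGroup, a * b ∈ K.coeffGroup :=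
  fun _ ha _ hb => K.coeffs.mul_mem ha hb

lemma coeff_mul_eig : ∀ a ∈ K.coeffGroup, ∀ b ∈ K.eigGroup, a * b ∈ K.eigGroup :=
  fun a ha _ hb => K.eig.smul_mem ⟨a, ha⟩ hb

lemma coeff_mul_adj : ∀ a ∈ K.coeffGroup, ∀ b ∈ K.adjGroup, a * b ∈ K.adjGroup :=
  fun a ha _ hb => K.adj.smul_mem ⟨a, ha⟩ hb

lemma eig_mul_coeff : ∀ a ∈ K.eigGroup, ∀ b ∈ K.coeffGroup, a * b ∈ K.eigGroup :=
  fun a ha b hb => mul_comm b a ▸ K.coeff_mul_eig b hb a ha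

lemma adj_mul_coeff : ∀ a ∈ K.adjGroup, ∀ b ∈ K.coeffGroup, a * b ∈ K.adjGroup :=
  fun a ha b hb => mul_comm b a ▸ K.coeff_mul_adj b hb a ha

lemma eig_mul_adj_mem : ∀ a ∈ K.eigGroup, ∀ b ∈ K.adjGroup, a * b ∈ K.potGroup :=
  K.eig_mul_adj

lemma adj_mul_eig_mem : ∀ a ∈ K.adjGroup, ∀ b ∈ K.eigGroup, a * b ∈ K.potGroup :=
  fun a ha b hb => mul_comm b a ▸ K.eig_mul_adj b hb a ha

lemma pot_mul_pot : ∀ a ∈ K.potGroup, ∀ b ∈ K.potGroup, a * b ∈ K.potGroup :=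
  fun a ha _ hb => K.pot.smul_mem ⟨a, K.pot_subset a ha⟩ hb

lemma potGroup_le : K.potGroup ≤ K.coeffGroup := K.pot_subset

lemma valuesIn_pot_le {f : Fn B} (hf : f ∈ valuesIn K.potGroup) : f ∈ valuesIn K.coeffGroup :=
  fun μ => K.pot_subset _ (hf μ)

lemma one_mem_coeffGroup : (1 : B) ∈ K.coeffGroup := K.coeffs.one_mem

/-- Functions of all times with values in `K.eig`. -/
def EigFn : Submodule ℚ (Fn B) where
  __ := valuesIn K.eigGroup
  smul_mem' q _ hf := fun μ => K.eig.smul_of_tower_mem q (hf μ)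

/-- Functions of all times with values in `K.adj`. -/
def AdjFn : Submodule ℚ (Fn B) where
  __ := valuesIn K.adjGroup
  smul_mem' q _ hf := fun μ => K.adj.smul_of_tower_mem q (hf μ)

lemma mul_mem_pot {f g : Fn B} (hf : f ∈ K.EigFn) (hg : g ∈ K.AdjFn) :
    f * g ∈ valuesIn K.potGroup :=
  mul_mem_valuesIn K.eig_mul_adj_mem hf hg

lemma mul_mem_pot' {f g : Fn B} (hf : f ∈ K.EigFn) (hg : g ∈ K.AdjFn) :
    g * f ∈ valuesIn K.potGroup :=
  mul_mem_valuesIn K.adj_mul_eig_mem hg hf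

lemma mul_mem_eig {f g : Fn B} (hf : f ∈ K.EigFn) (hg : g ∈ valuesIn K.potGroup) :
    f * g ∈ K.EigFn :=
  mul_mem_valuesIn K.eig_mul_coeff hf (K.valuesIn_pot_le hg)

lemma mul_mem_adj {f g : Fn B} (hf : f ∈ K.AdjFn) (hg : g ∈ valuesIn K.potGroup) :
    f * g ∈ K.AdjFn :=
  mul_mem_valuesIn K.adj_mul_coeff hf (K.valuesIn_pot_le hg)

end Classes

section Integral
variable {K}

lemma intx_mem {f : Fn B} (hf : f ∈ valuesIn K.potGroup) : K.intx f ∈ valuesIn K.potGroup :=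
  fun μ => K.bijOn_deriv.surjOn.mapsTo_invFunOn (hf μ)

lemma dx_intx {f : Fn B} (hf : f ∈ valuesIn K.potGroup) : Fn.dx (K.intx f) = f :=
  funext fun μ => K.bijOn_deriv.surjOn.rightInvOn_invFunOn (hf μ)

lemma eq_of_dx_eq {f g : Fn B} (hf : f ∈ valuesIn K.potGroup) (hg : g ∈ valuesIn K.potGroup)
    (h : Fn.dx f = Fn.dx g) : f = g :=
  funext fun μ => K.bijOn_deriv.injOn (hf μ) (hg μ) (congrFun h μ)

/-- Antiderivatives within `pot` are unique, so an identity for `∂ₓ⁻¹` only has to be checked after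
differentiation, together with membership in `pot`. -/
lemma intx_eq {f g : Fn B} (hg : g ∈ valuesIn K.potGroup) (h : Fn.dx g = f) : K.intx f = g := by
  have hf : f ∈ valuesIn K.potGroup := h ▸ dx_mem_valuesIn K.potGroup_stable hg
  exact eq_of_dx_eq (intx_mem hf) hg (by rw [dx_intx hf, h])

lemma intx_add {f g : Fn B} (hf : f ∈ valuesIn K.potGroup) (hg : g ∈ valuesIn K.potGroup) :
    K.intx (f + g) = K.intx f + K.intx g :=
  intx_eq (add_mem (intx_mem hf) (intx_mem hg)) (by rw [map_add, dx_intx hf, dx_intx hg])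

/-- Integration by parts. -/
lemma intx_mul_intx {f g : Fn B} (hf : f ∈ valuesIn K.potGroup) (hg : g ∈ valuesIn K.potGroup) :
    K.intx (f * K.intx g) = K.intx f * K.intx g - K.intx (K.intx f * g) := by
  have h {f g : Fn B} := mul_mem_valuesIn (f := f) (g := g) K.pot_mul_pot
  refine intx_eq (sub_mem (h (intx_mem hf) (intx_mem hg)) (intx_mem (h (intx_mem hf) hg))) ?_
  rw [map_sub, Fn.dx_mul, dx_intx hf, dx_intx hg, dx_intx (h (intx_mem hf) hg)]
  abel

end Integral

section Operators

/-- Operators with coefficients in `K.coeffs`. -/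
noncomputable def coeffOps : Subring (Op B) where
  __ := coeffsIn K.coeffGroup
  one_mem' := by
    rw [← Dpow_zero]
    exact Dpow_mem_coeffsIn K.one_mem_coeffGroup 0
  mul_mem' := mul_mem_coeffsIn K.coeffGroup_stable K.coeff_mul_coeff

/-- Differential operators with coefficients in `K.coeffs`. -/
noncomputable def diffOps : Subring (Op B) := _root_.diffOps B ⊓ K.coeffOps

variable {K}

lemma plusPart_mem_diffOps {P : Op B} (h : P ∈ K.coeffOps) : plusPart P ∈ K.diffOps :=
  ⟨plusPart_mem P, plusPart_mem_coeffsIn h⟩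

lemma applyDiff_mem {P : Op B} (hP : P ∈ K.diffOps) {f : Fn B} (hf : f ∈ K.EigFn) :
    applyDiff P f ∈ K.EigFn :=
  applyDiff_mem_valuesIn K.eigGroup_stable K.coeff_mul_eig hP.1 hP.2 hf

lemma applyAdj_mem {P : Op B} (hP : P ∈ K.diffOps) {f : Fn B} (hf : f ∈ K.AdjFn) :
    applyAdj P f ∈ K.AdjFn :=
  applyAdj_mem_valuesIn K.coeffGroup_stable K.adjGroup_stable K.coeff_mul_adj hP.1 hP.2 hf

variable (K)

/-- The ring in which the differential operators and the integral operators `a D⁻¹ b` are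
represented together with their actions on eigenfunctions and adjoint eigenfunctions. -/
def ActOps : Type u := Op B × Module.End ℚ K.EigFn × (Module.End ℚ K.AdjFn)ᵐᵒᵖ

noncomputable instance : Ring K.ActOps :=
  inferInstanceAs (Ring (Op B × Module.End ℚ K.EigFn × (Module.End ℚ K.AdjFn)ᵐᵒᵖ))

variable {K}

namespace ActOps

/-- An operator with given actions. -/
def of (P : Op B) (α : Module.End ℚ K.EigFn) (β : Module.End ℚ K.AdjFn) : K.ActOps :=
  (P, α, .op β)

/-- The underlying operator. -/
noncomputable def op : K.ActOps →+* Op B := RingHom.fst _ _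

/-- The action on eigenfunctions. -/
noncomputable def eig : K.ActOps →+* Module.End ℚ K.EigFn :=
  (RingHom.fst _ _).comp (RingHom.snd (Op B) (Module.End ℚ K.EigFn × (Module.End ℚ K.AdjFn)ᵐᵒᵖ))

/-- The action of the conjugate on adjoint eigenfunctions. -/
noncomputable def adj (X : K.ActOps) : Module.End ℚ K.AdjFn :=
  ((RingHom.snd _ _).comp
    (RingHom.snd (Op B) (Module.End ℚ K.EigFn × (Module.End ℚ K.AdjFn)ᵐᵒᵖ)) X).unop

lemma adj_add (X Y : K.ActOps) : (X + Y).adj = X.adj + Y.adj := rfl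

lemma adj_sub (X Y : K.ActOps) : (X - Y).adj = X.adj - Y.adj := rfl

lemma adj_zero : (0 : K.ActOps).adj = 0 := rfl

lemma adj_mul (X Y : K.ActOps) : (X * Y).adj = Y.adj * X.adj := rfl

lemma coe_eig_mul (X Y : K.ActOps) (f : K.EigFn) :
    ((X * Y).eig f : Fn B) = X.eig (Y.eig f) := rfl

lemma coe_eig_add (X Y : K.ActOps) (f : K.EigFn) :
    ((X + Y).eig f : Fn B) = X.eig f + Y.eig f := rfl

lemma coe_adj_mul (X Y : K.ActOps) (g : K.AdjFn) :
    ((X * Y).adj g : Fn B) = Y.adj (X.adj g) := rfl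

lemma coe_adj_add (X Y : K.ActOps) (g : K.AdjFn) :
    ((X + Y).adj g : Fn B) = X.adj g + Y.adj g := rfl

lemma ext {X Y : K.ActOps} (h : X.op = Y.op)
    (h1 : ∀ f, (X.eig f : Fn B) = Y.eig f) (h2 : ∀ g, (X.adj g : Fn B) = Y.adj g) : X = Y :=
  Prod.ext h <| Prod.ext (LinearMap.ext fun f => Subtype.ext (h1 f))
    (MulOpposite.unop_injective <| LinearMap.ext fun g => Subtype.ext (h2 g))

end ActOps

variable (K)

/-- A differential operator with its actions. -/
noncomputable def diff : K.diffOps →+* K.ActOps where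
  toFun P := .of P
    (AddMonoidHom.toRatLinearMap
      { toFun f := ⟨applyDiff P f, applyDiff_mem P.2 f.2⟩
        map_zero' := Subtype.ext <| by
          simpa using applyDiff_add P.2.1 0 0
        map_add' f g := Subtype.ext <| applyDiff_add P.2.1 f g })
    (AddMonoidHom.toRatLinearMap
      { toFun f := ⟨applyAdj P f, applyAdj_mem P.2 f.2⟩
        map_zero' := Subtype.ext <| by
          simpa using applyAdj_add P.2.1 0 0
        map_add' f g := Subtype.ext <| applyAdj_add P.2.1 f g })
  map_one' := ActOps.ext rfl (fun f => applyDiff_one f.1) fun g => applyAdj_one g.1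
  map_mul' P Q := ActOps.ext rfl (fun f => applyDiff_mul P.2.1 Q.2.1 f.1)
    fun g => applyAdj_mul P.2.1 Q.2.1 g.1
  map_zero' := ActOps.ext rfl
    (fun f => applyDiff_zero_left f.1) fun g => applyAdj_zero_left g.1
  map_add' P Q := ActOps.ext rfl (fun f => applyDiff_add_left P.2.1 Q.2.1 f.1)
    fun g => applyAdj_add_left P.2.1 Q.2.1 g.1

/-- The integral operator `a D⁻¹ b` with its actions. -/
noncomputable def pair (a : K.EigFn) (b : K.AdjFn) : K.ActOps :=
  .of (mulOp a * Dpow (-1) * mulOp b)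
    (AddMonoidHom.toRatLinearMap (AddMonoidHom.mk'
      (fun f => (⟨a * K.intx (b * f),
        K.mul_mem_eig a.2 (intx_mem (K.mul_mem_pot' f.2 b.2))⟩ : K.EigFn))
      fun f g => Subtype.ext <| by
        change a * K.intx (b * ((f : Fn B) + g)) = a * K.intx (b * f) + a * K.intx (b * g)
        rw [mul_add, intx_add (K.mul_mem_pot' f.2 b.2) (K.mul_mem_pot' g.2 b.2), mul_add]))
    (AddMonoidHom.toRatLinearMap (AddMonoidHom.mk'
      (fun g => (⟨-(b * K.intx (a * g)),
        neg_mem (K.mul_mem_adj b.2 (intx_mem (K.mul_mem_pot a.2 g.2)))⟩ : K.AdjFn))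
      fun f g => Subtype.ext <| by
        change -(b * K.intx (a * ((f : Fn B) + g))) =
          -(b * K.intx (a * f)) + -(b * K.intx (a * g))
        rw [mul_add, intx_add (K.mul_mem_pot a.2 f.2) (K.mul_mem_pot a.2 g.2), mul_add, neg_add]))

variable {K}

lemma coe_diff_eig (P : K.diffOps) (f : K.EigFn) :
    ((K.diff P).eig f : Fn B) = applyDiff P f := rfl

lemma coe_diff_adj (P : K.diffOps) (g : K.AdjFn) :
    ((K.diff P).adj g : Fn B) = applyAdj P g := rfl

lemma op_diff (P : K.diffOps) : (K.diff P).op = P := rfl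

lemma coe_pair_eig (a f : K.EigFn) (b : K.AdjFn) :
    ((K.pair a b).eig f : Fn B) = a * K.intx (b * f) := rfl

lemma coe_pair_adj (a : K.EigFn) (b g : K.AdjFn) :
    ((K.pair a b).adj g : Fn B) = -(b * K.intx (a * g)) := rfl

lemma op_pair (a : K.EigFn) (b : K.AdjFn) :
    (K.pair a b).op = mulOp a * Dpow (-1) * mulOp b := rfl

lemma pair_add_left (a a' : K.EigFn) (b : K.AdjFn) :
    K.pair (a + a') b = K.pair a b + K.pair a' b := by
  refine ActOps.ext ?_ (fun f => ?_) fun g => ?_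
  · change mulOp ((a : Fn B) + (a' : Fn B)) * _ * _ =
      mulOp (a : Fn B) * _ * _ + mulOp (a' : Fn B) * _ * _
    rw [mulOp_add, add_mul, add_mul]
  · exact add_mul (a : Fn B) a' _
  · change -((b : Fn B) * K.intx (((a : Fn B) + a') * g)) =
      -(b * K.intx (a * g)) + -(b * K.intx (a' * g))
    rw [add_mul, intx_add (K.mul_mem_pot a.2 g.2) (K.mul_mem_pot a'.2 g.2), mul_add, neg_add]

lemma pair_add_right (a : K.EigFn) (b b' : K.AdjFn) :
    K.pair a (b + b') = K.pair a b + K.pair a b' := by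
  refine ActOps.ext ?_ (fun f => ?_) fun g => ?_
  · change _ * mulOp ((b : Fn B) + (b' : Fn B)) =
      _ * mulOp (b : Fn B) + _ * mulOp (b' : Fn B)
    rw [mulOp_add, mul_add]
  · change (a : Fn B) * K.intx (((b : Fn B) + b') * f) =
      a * K.intx (b * f) + a * K.intx (b' * f)
    rw [add_mul, intx_add (K.mul_mem_pot' f.2 b.2) (K.mul_mem_pot' f.2 b'.2), mul_add]
  · change -(((b : Fn B) + b') * K.intx (a * g)) =
      -(b * K.intx (a * g)) + -(b' * K.intx (a * g))
    rw [add_mul, neg_add]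

/-- A rational constant as a multiplication operator. -/
lemma smul_eq_C_mul (q : ℚ) (f : Fn B) :
    q • f = MvPowerSeries.C (algebraMap ℚ B q) * f := funext fun μ => by
  rw [MvPowerSeries.C_mul_apply']
  exact Algebra.smul_def q (f μ)

/-- Rational constants have derivative zero: the derivation is additive between `ℚ`-modules, hence
`ℚ`-linear. This covers negative powers of `D` as well. -/
lemma Dpow_mul_mulOp_C (q : ℚ) (n : ℤ) :
    (Dpow n : Op B) * mulOp (MvPowerSeries.C (algebraMap ℚ B q)) =
      mulOp (MvPowerSeries.C (algebraMap ℚ B q)) * Dpow n := by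
  have h : mulOp (MvPowerSeries.C (algebraMap ℚ B q)) =
      MvPowerSeries.C (PDO.monomial 0 (algebraMap ℚ B q)) := funext fun μ => by
    rw [mulOp_apply, MvPowerSeries.C_apply', MvPowerSeries.C_apply']
    split_ifs
    · rfl
    · exact PDO.monomial_zero 0
  rw [h, Dpow, ← map_mul, ← map_mul, PDO.monomial_mul_Dpow, zero_add]
  congr 1
  refine PDO.ext fun k => ?_
  have hq : ∀ j : ℕ, iterD (j + 1) (algebraMap ℚ B q) = 0 := by
    intro j
    have h0 : (algebraMap ℚ B q)′ = 0 := by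
      have := (Differential.deriv (R := B)).toLinearMap.toAddMonoidHom.toRatLinearMap.map_smul q 1
      rw [Algebra.algebraMap_eq_smul_one]
      refine this.trans ?_
      change q • (1 : B)′ = 0
      rw [Derivation.map_one_eq_zero, smul_zero]
    rw [iterD, Function.iterate_succ_apply, h0]
    exact iterD_map_zero j
  rw [PDO.coeff_monomial_mul, one_mul, leibnizCoeff, finsum_eq_single _ 0 fun j hj => by
    obtain ⟨i, rfl⟩ := Nat.exists_eq_succ_of_ne_zero hj
    rw [PDO.coeff_monomial]
    split_ifs
    · rw [Nat.succ_eq_add_one, hq, smul_zero]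
    · rw [iterD_map_zero, smul_zero]]
  rw [Ring.choose_zero_right, one_smul, iterD_zero, PDO.coeff_monomial, PDO.coeff_monomial]
  congr 1
  simp only [Nat.cast_zero, add_zero, sub_eq_zero]

/-- This balancing condition is what lets `a D⁻¹ b`, with both of its actions, factor through the
tensor product over `ℚ`. -/
lemma pair_smul (q : ℚ) (a : K.EigFn) (b : K.AdjFn) : K.pair (q • a) b = K.pair a (q • b) := by
  have hq : ∀ f : Fn B, q • f = MvPowerSeries.C (algebraMap ℚ B q) * f := smul_eq_C_mul q
  have hs : ∀ f ∈ valuesIn K.potGroup, K.intx (q • f) = q • K.intx f := by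
    intro f hf
    let I : valuesIn K.potGroup →+ Fn B := AddMonoidHom.mk' (fun f => K.intx f)
      fun f g => intx_add f.2 g.2
    have hmem : q • f ∈ valuesIn K.potGroup := fun μ => K.pot.smul_of_tower_mem q (hf μ)
    refine intx_eq (fun μ => K.pot.smul_of_tower_mem q (intx_mem hf μ)) ?_
    have h : Fn.dx (q • K.intx f) = q • Fn.dx (K.intx f) :=
      (Fn.dx (B := B)).toRatLinearMap.map_smul q _
    rw [h, dx_intx hf]
  refine ActOps.ext ?_ (fun f => ?_) fun g => ?_
  · change mulOp (q • (a : Fn B)) * _ * mulOp b = mulOp a * Dpow (-1) * mulOp (q • (b : Fn B))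
    rw [hq, hq, mulOp_mul, mulOp_mul, ← mul_assoc, mul_assoc (mulOp (a : Fn B)),
      Dpow_mul_mulOp_C, ← mul_assoc, ← mulOp_mul, ← mulOp_mul, mul_comm]
  · change (q • (a : Fn B)) * K.intx (b * f) = a * K.intx ((q • (b : Fn B)) * f)
    rw [smul_mul_assoc, smul_mul_assoc, hs _ (K.mul_mem_pot' f.2 b.2), mul_smul_comm]
  · change -((b : Fn B) * K.intx ((q • (a : Fn B)) * g)) = -((q • (b : Fn B)) * K.intx (a * g))
    rw [smul_mul_assoc, smul_mul_assoc, hs _ (K.mul_mem_pot a.2 g.2), mul_smul_comm]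

variable (K)

/-- The integral operator with kernel `∑ aᵢ ⊗ bᵢ`. -/
noncomputable def ofKernel : K.EigFn ⊗[ℚ] K.AdjFn →+ K.ActOps :=
  TensorProduct.liftAddHom
    { toFun a :=
        { toFun := K.pair a
          map_zero' := by simpa using pair_add_right a 0 0
          map_add' := pair_add_right a }
      map_zero' := AddMonoidHom.ext fun b => by simpa using pair_add_left 0 0 b
      map_add' a a' := AddMonoidHom.ext fun b => pair_add_left a a' b }
    fun q a b => pair_smul q a b

variable {K}

lemma ofKernel_tmul (a : K.EigFn) (b : K.AdjFn) : K.ofKernel (a ⊗ₜ b) = K.pair a b := rfl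

end Operators

end FunctionClass

end

/-! ### Products of differential and integral operators; kernels as tensors -/

section

variable {B : Type u} [CommRing B] [Algebra ℚ B] [Differential B]

namespace FunctionClass
variable {K : FunctionClass B}

section Products

/-- `P ∘ a D⁻¹ b = P(a) D⁻¹ b` up to a differential operator. -/
lemma diff_mul_pair (P : K.diffOps) (a : K.EigFn) (b : K.AdjFn) :
    ∃ R : K.diffOps, K.diff P * K.pair a b = K.pair ((K.diff P).eig a) b + K.diff R := by
  obtain ⟨S, hS, e⟩ := exists_mul_mulOp P.2.1 a
  have hScoef : S ∈ coeffsIn K.eigGroup := by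
    have h1 : S = ((P : Op B) * mulOp a - mulOp (applyDiff P a)) * Dpow (-1) := by
      rw [e, add_sub_cancel_left, mul_Dpow_cancel (add_neg_cancel 1)]
    rw [h1]
    exact mul_Dpow_mem_coeffsIn _ (sub_mem
      (mul_mem_coeffsIn K.eigGroup_stable K.coeff_mul_eig P.2.2 (mulOp_mem_coeffsIn a.2))
      (mulOp_mem_coeffsIn (applyDiff_mem P.2 a.2)))
  have hSb : S * mulOp b ∈ K.diffOps := ⟨mul_mem hS (mulOp_mem_diff _),
    mul_mem_coeffsIn K.adjGroup_stable
      (fun x hx y hy => K.potGroup_le (K.eig_mul_adj_mem x hx y hy)) hScoef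
      (mulOp_mem_coeffsIn b.2)⟩
  refine ⟨⟨_, hSb⟩, ActOps.ext ?_ (fun f => ?_) fun g => ?_⟩
  · change (P : Op B) * (mulOp a * Dpow (-1) * mulOp b) =
      mulOp (applyDiff P a) * Dpow (-1) * mulOp b + S * mulOp b
    rw [← mul_assoc, ← mul_assoc, e, add_mul, add_mul, mul_Dpow_cancel (add_neg_cancel 1)]
  · rw [ActOps.coe_eig_mul, ActOps.coe_eig_add, coe_diff_eig, coe_pair_eig, coe_pair_eig,
      coe_diff_eig, coe_diff_eig]
    have hbf := K.mul_mem_pot' f.2 b.2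
    -- With `u = ∂ₓ⁻¹(b f)`, the division identity for `P a` gives `P(a u) = P(a) u + S(b f)`, and
    -- `S b` is the differential remainder.
    have h := congrArg (fun X => applyDiff X (K.intx (b * f))) e
    change applyDiff (_ * _) _ = applyDiff (_ + _) _ at h
    rw [applyDiff_mul P.2.1 (mulOp_mem_diff _), applyDiff_mulOp,
      applyDiff_add_left (mulOp_mem_diff _) (mul_mem hS Dpow_one_mem_diff), applyDiff_mulOp,
      applyDiff_mul hS Dpow_one_mem_diff, applyDiff_D, dx_intx hbf] at h
    rw [h, applyDiff_mul hS (mulOp_mem_diff _), applyDiff_mulOp]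
  · rw [ActOps.coe_adj_mul, ActOps.coe_adj_add, coe_diff_adj, coe_pair_adj, coe_pair_adj,
      coe_diff_eig, coe_diff_adj]
    have hSg : applyAdj S g ∈ valuesIn K.potGroup :=
      applyAdj_mem_valuesIn K.eigGroup_stable K.potGroup_stable K.eig_mul_adj_mem hS hScoef g.2
    -- By the Lagrange identity `P(a) g` and `a P*(g)` differ by `∂(S*(g))`; since `S*(g)` lies in
    -- `pot`, `∂ₓ⁻¹` returns it unchanged.
    rw [applyAdj_mul hS (mulOp_mem_diff _), applyAdj_mulOp, applyDiff_mul_eq P.2.1 hS e,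
      intx_add (K.mul_mem_pot a.2 (applyAdj_mem P.2 g.2)) (dx_mem_valuesIn K.potGroup_stable hSg),
      intx_eq hSg rfl]
    ring

/-- `a D⁻¹ b ∘ P = a D⁻¹ P*(b)` up to a differential operator. -/
lemma pair_mul_diff (P : K.diffOps) (a : K.EigFn) (b : K.AdjFn) :
    ∃ R : K.diffOps, K.pair a b * K.diff P = K.pair a ((K.diff P).adj b) + K.diff R := by
  obtain ⟨S, hS, e⟩ := exists_mulOp_mul P.2.1 b
  have hScoef : S ∈ coeffsIn K.adjGroup := by
    have h1 : S = Dpow (-1) * (mulOp b * (P : Op B) - mulOp (applyAdj P b)) := by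
      rw [e, add_sub_cancel_left, Dpow_mul_cancel (neg_add_cancel 1)]
    rw [h1]
    exact Dpow_mul_mem_coeffsIn K.adjGroup_stable _ (sub_mem
      (mul_mem_coeffsIn K.coeffGroup_stable K.adj_mul_coeff (mulOp_mem_coeffsIn b.2) P.2.2)
      (mulOp_mem_coeffsIn (applyAdj_mem P.2 b.2)))
  have haS : mulOp a * S ∈ K.diffOps := ⟨mul_mem (mulOp_mem_diff _) hS,
    mul_mem_coeffsIn K.adjGroup_stable
      (fun x hx y hy => K.potGroup_le (K.eig_mul_adj_mem x hx y hy))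
      (mulOp_mem_coeffsIn a.2) hScoef⟩
  refine ⟨⟨_, haS⟩, ActOps.ext ?_ (fun f => ?_) fun g => ?_⟩
  · change mulOp a * Dpow (-1) * mulOp b * (P : Op B) =
      mulOp a * Dpow (-1) * mulOp (applyAdj P b) + mulOp a * S
    rw [mul_assoc, e, mul_add, mul_assoc (mulOp (a : Fn B)) _ (Dpow 1 * S),
      Dpow_mul_cancel (neg_add_cancel 1)]
  · rw [ActOps.coe_eig_mul, ActOps.coe_eig_add, coe_diff_eig, coe_pair_eig, coe_pair_eig,
      coe_diff_eig, coe_diff_adj]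
    have hSf : applyDiff S f ∈ valuesIn K.potGroup :=
      applyDiff_mem_valuesIn K.eigGroup_stable K.adj_mul_eig_mem hS hScoef f.2
    -- The division identity for `b P` applied to `f` reads `b P(f) = P*(b) f + ∂(S(f))`.
    have h := congrArg (fun X => applyDiff X (f : Fn B)) e
    change applyDiff (_ * _) _ = applyDiff (_ + _) _ at h
    rw [applyDiff_mul (mulOp_mem_diff _) P.2.1, applyDiff_mulOp,
      applyDiff_add_left (mulOp_mem_diff _) (mul_mem Dpow_one_mem_diff hS), applyDiff_mulOp,
      applyDiff_mul Dpow_one_mem_diff hS, applyDiff_D] at h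
    rw [h, intx_add (K.mul_mem_pot' f.2 (applyAdj_mem P.2 b.2))
      (dx_mem_valuesIn K.potGroup_stable hSf), intx_eq hSf rfl,
      applyDiff_mul (mulOp_mem_diff _) hS, applyDiff_mulOp, mul_add]
  · rw [ActOps.coe_adj_mul, ActOps.coe_adj_add, coe_diff_adj, coe_pair_adj, coe_pair_adj,
      coe_diff_adj, coe_diff_adj]
    have hag := K.mul_mem_pot a.2 g.2
    -- The sign is that of the conjugate of `a D⁻¹ b`; the derivative in the conjugate of `D S`
    -- undoes `∂ₓ⁻¹`.
    have h := congrArg (fun X => applyAdj X (-K.intx (a * g))) e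
    change applyAdj (_ * _) _ = applyAdj (_ + _) _ at h
    rw [applyAdj_mul (mulOp_mem_diff _) P.2.1, applyAdj_mulOp,
      applyAdj_add_left (mulOp_mem_diff _) (mul_mem Dpow_one_mem_diff hS), applyAdj_mulOp,
      applyAdj_mul Dpow_one_mem_diff hS, applyAdj_D, map_neg, neg_neg, dx_intx hag,
      mul_neg, mul_neg] at h
    rw [h, applyAdj_mul (mulOp_mem_diff _) hS, applyAdj_mulOp]

/-- With `u = ∂ₓ⁻¹(b c)` the symbol identity is `D⁻¹ u' D⁻¹ = u D⁻¹ - D⁻¹ u`, and for both actions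
it is integration by parts. No differential remainder appears. -/
lemma pair_mul_pair (a c : K.EigFn) (b d : K.AdjFn) :
    K.pair a b * K.pair c d = K.pair ((K.pair a b).eig c) d + K.pair a ((K.pair c d).adj b) := by
  have hbc := K.mul_mem_pot' c.2 b.2
  have hcb : (c : Fn B) * b = b * c := mul_comm _ _
  refine ActOps.ext ?_ (fun f => ?_) fun g => ?_
  · change mulOp a * Dpow (-1) * mulOp b * (mulOp c * Dpow (-1) * mulOp d) =
      mulOp ((a : Fn B) * K.intx (b * c)) * Dpow (-1) * mulOp d +
        mulOp a * Dpow (-1) * mulOp (-((d : Fn B) * K.intx (c * b)))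
    have h := Dinv_mul_dx_mul_Dinv (K.intx ((b : Fn B) * c))
    rw [dx_intx hbc, mulOp_mul] at h
    have h1 : mulOp a * Dpow (-1) * mulOp b * (mulOp c * Dpow (-1) * mulOp d) =
      mulOp a * (Dpow (-1) * (mulOp b * mulOp c) * Dpow (-1)) * mulOp (d : Fn B) := by
      noncomm_ring
    rw [h1, h, hcb, mulOp_mul, mulOp_neg, mul_comm (d : Fn B), mulOp_mul]
    noncomm_ring
  · change (a : Fn B) * K.intx (b * (c * K.intx (d * f))) =
      a * K.intx (b * c) * K.intx (d * f) + a * K.intx (-((d : Fn B) * K.intx (c * b)) * f)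
    have hdf := K.mul_mem_pot' f.2 d.2
    have hm := mul_mem_valuesIn K.pot_mul_pot (intx_mem hbc) hdf
    have h2 : -((d : Fn B) * K.intx (b * c)) * f = -(K.intx (b * c) * (d * f)) := by ring
    have h3 : K.intx (-(K.intx ((b : Fn B) * c) * (d * f))) =
        -K.intx (K.intx (b * c) * (d * f)) :=
      intx_eq (neg_mem (intx_mem hm)) (by rw [map_neg, dx_intx hm])
    rw [← mul_assoc, intx_mul_intx hbc hdf, hcb, h2, h3]
    ring
  · change -((d : Fn B) * K.intx (c * -(b * K.intx (a * g)))) =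
      -(d * K.intx (a * K.intx (b * c) * g)) + -(-(d * K.intx (c * b)) * K.intx (a * g))
    have hag := K.mul_mem_pot a.2 g.2
    have hm := mul_mem_valuesIn K.pot_mul_pot hbc (intx_mem hag)
    have h2 : (c : Fn B) * -(b * K.intx (a * g)) = -(b * c * K.intx (a * g)) := by ring
    have h3 : K.intx (-((b : Fn B) * c * K.intx (a * g))) = -K.intx (b * c * K.intx (a * g)) :=
      intx_eq (neg_mem (intx_mem hm)) (by rw [map_neg, dx_intx hm])
    have h4 : (a : Fn B) * K.intx (b * c) * g = K.intx (b * c) * (a * g) := by ring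
    rw [h2, h3, intx_mul_intx hbc hag, hcb, h4]
    ring

end Products

section Kernels

/-- `X` is the sum of a differential operator and the integral operator with kernel `T`. -/
def HasKernel (X : K.ActOps) (T : K.EigFn ⊗[ℚ] K.AdjFn) : Prop :=
  ∃ P : K.diffOps, X = K.diff P + K.ofKernel T

lemma hasKernel_diff (P : K.diffOps) : HasKernel (K.diff P) 0 := ⟨P, by rw [map_zero, add_zero]⟩

lemma hasKernel_ofKernel (T : K.EigFn ⊗[ℚ] K.AdjFn) : HasKernel (K.ofKernel T) T :=
  ⟨0, by rw [map_zero, zero_add]⟩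

lemma hasKernel_mk (P : K.diffOps) (T : K.EigFn ⊗[ℚ] K.AdjFn) :
    HasKernel (K.diff P + K.ofKernel T) T := ⟨P, rfl⟩

namespace HasKernel
variable {X Y : K.ActOps} {T S : K.EigFn ⊗[ℚ] K.AdjFn}

lemma add (hX : HasKernel X T) (hY : HasKernel Y S) : HasKernel (X + Y) (T + S) := by
  obtain ⟨P, rfl⟩ := hX
  obtain ⟨Q, rfl⟩ := hY
  exact ⟨P + Q, by rw [map_add, map_add]; abel⟩

lemma neg (hX : HasKernel X T) : HasKernel (-X) (-T) := by
  obtain ⟨P, rfl⟩ := hX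
  exact ⟨-P, by rw [map_neg K.diff P, map_neg K.ofKernel T]; abel⟩

lemma sub (hX : HasKernel X T) (hY : HasKernel Y S) : HasKernel (X - Y) (T - S) := by
  rw [sub_eq_add_neg, sub_eq_add_neg]
  exact hX.add hY.neg

lemma diff_mul (P : K.diffOps) (T : K.EigFn ⊗[ℚ] K.AdjFn) :
    HasKernel (K.diff P * K.ofKernel T) ((K.diff P).eig.rTensor K.AdjFn T) := by
  induction T with
  | zero => simpa using hasKernel_diff (K := K) 0
  | tmul a b =>
    obtain ⟨R, hR⟩ := diff_mul_pair P a b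
    exact ⟨R, by rw [ofKernel_tmul, hR, LinearMap.rTensor_tmul, ofKernel_tmul, add_comm]⟩
  | add T S hT hS => rw [map_add, map_add, mul_add]; exact hT.add hS

lemma mul_diff (T : K.EigFn ⊗[ℚ] K.AdjFn) (P : K.diffOps) :
    HasKernel (K.ofKernel T * K.diff P) ((K.diff P).adj.lTensor K.EigFn T) := by
  induction T with
  | zero => simpa using hasKernel_diff (K := K) 0
  | tmul a b =>
    obtain ⟨R, hR⟩ := pair_mul_diff P a b
    exact ⟨R, by rw [ofKernel_tmul, hR, LinearMap.lTensor_tmul, ofKernel_tmul, add_comm]⟩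
  | add T S hT hS => rw [map_add, map_add, add_mul]; exact hT.add hS

lemma _root_.FunctionClass.ofKernel_mul (T S : K.EigFn ⊗[ℚ] K.AdjFn) :
    K.ofKernel T * K.ofKernel S = K.ofKernel ((K.ofKernel T).eig.rTensor K.AdjFn S +
      (K.ofKernel S).adj.lTensor K.EigFn T) := by
  induction T with
  | zero => simp
  | add T T' hT hT' =>
    rw [map_add, add_mul, hT, hT']
    simp only [map_add, LinearMap.rTensor_add, LinearMap.add_apply]
    abel
  | tmul a b =>
    induction S with
    | zero => simp [ActOps.adj_zero]
    | add S S' hS hS' =>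
      rw [map_add, mul_add, hS, hS', ActOps.adj_add]
      simp only [map_add, LinearMap.lTensor_add, LinearMap.add_apply]
      abel
    | tmul c d =>
      rw [ofKernel_tmul, ofKernel_tmul, pair_mul_pair, LinearMap.rTensor_tmul,
        LinearMap.lTensor_tmul, map_add, ofKernel_tmul, ofKernel_tmul]

/-- Of the four products of parts, only differential times differential has no kernel. The other
three assemble, since the action of a sum is the sum of the actions, into the full actions of `X`
and `Y*` on the two legs. -/
lemma mul (hX : HasKernel X T) (hY : HasKernel Y S) :
    HasKernel (X * Y) (X.eig.rTensor K.AdjFn S + Y.adj.lTensor K.EigFn T) := by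
  obtain ⟨P, rfl⟩ := hX
  obtain ⟨Q, rfl⟩ := hY
  have h := ((hasKernel_diff (P * Q)).add ((diff_mul P S).add (mul_diff T Q))).add
    (hasKernel_ofKernel ((K.ofKernel T).eig.rTensor K.AdjFn S +
      (K.ofKernel S).adj.lTensor K.EigFn T))
  convert h using 1
  · rw [map_mul, ← ofKernel_mul]
    noncomm_ring
  · rw [map_add, ActOps.adj_add, LinearMap.rTensor_add, LinearMap.lTensor_add,
      LinearMap.add_apply, LinearMap.add_apply]
    abel

lemma _root_.FunctionClass.op_ofKernel_mem (T : K.EigFn ⊗[ℚ] K.AdjFn) :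
    (K.ofKernel T).op ∈ ordLE B (-1) := by
  induction T with
  | zero => rw [map_zero, map_zero]; exact zero_mem _
  | add T S hT hS => rw [map_add, map_add]; exact add_mem hT hS
  | tmul a b =>
    rw [ofKernel_tmul, op_pair]
    exact ordLE_mono (by omega) (ordLE_mul (ordLE_mul (mulOp_mem_ordLE _) (Dpow_mem_ordLE (-1)))
      (mulOp_mem_ordLE _))

lemma minusPart_op (h : HasKernel X T) : minusPart X.op = (K.ofKernel T).op := by
  obtain ⟨P, rfl⟩ := h
  rw [map_add, op_diff, minusPart_add, minusPart_of_diff P.2.1, zero_add,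
    minusPart_of_mem (op_ofKernel_mem T)]

/-- An operator is determined by its kernel and its differential part. -/
lemma ext (hX : HasKernel X T) (hY : HasKernel Y T) (h : plusPart X.op = plusPart Y.op) :
    X = Y := by
  obtain ⟨P, rfl⟩ := hX
  obtain ⟨Q, rfl⟩ := hY
  rw [map_add, map_add, plusPart_add, plusPart_add, op_diff, op_diff, plusPart_of_diff P.2.1,
    plusPart_of_diff Q.2.1, add_left_inj] at h
  rw [Subtype.ext h]

end HasKernel

lemma op_ofKernel_mem_coeffOps (T : K.EigFn ⊗[ℚ] K.AdjFn) : (K.ofKernel T).op ∈ K.coeffOps := by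
  induction T with
  | zero => rw [map_zero, map_zero]; exact zero_mem _
  | add T S hT hS => rw [map_add, map_add]; exact add_mem hT hS
  | tmul a b =>
    rw [ofKernel_tmul, op_pair]
    exact mul_mem_coeffsIn K.adjGroup_stable
      (fun x hx y hy => K.potGroup_le (K.eig_mul_adj_mem x hx y hy))
      (mul_Dpow_mem_coeffsIn _ (mulOp_mem_coeffsIn a.2)) (mulOp_mem_coeffsIn b.2)

end Kernels

end FunctionClass

end

/-! ### First order variations of operators, functions and actions -/

section

lemma mulOp_add_mul_D_inj {B : Type u} [CommRing B] [Differential B] {a b : Fn B} {S T : Op B}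
    (hS : S ∈ diffOps B) (hT : T ∈ diffOps B)
    (h : mulOp a + S * Dpow 1 = mulOp b + T * Dpow 1) : a = b := by
  have h1 : applyDiff (mulOp a) 1 = b := by
    refine applyDiff_unique (mulOp_mem_diff a) (sub_mem hT hS) ?_
    rw [mulOp_one, mul_one, sub_mul, ← add_sub_assoc, ← h, add_sub_cancel_right]
  rwa [applyDiff_mulOp, mul_one] at h1

lemma mulOp_add_D_mul_inj {B : Type u} [CommRing B] [Differential B] {a b : Fn B} {S T : Op B}
    (hS : S ∈ diffOps B) (hT : T ∈ diffOps B)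
    (h : mulOp a + Dpow 1 * S = mulOp b + Dpow 1 * T) : a = b := by
  have h1 : applyAdj (mulOp a) 1 = b := by
    refine applyAdj_unique (mulOp_mem_diff a) (sub_mem hT hS) ?_
    rw [mulOp_one, one_mul, mul_sub, ← add_sub_assoc, ← h, add_sub_cancel_right]
  rwa [applyAdj_mulOp, mul_one] at h1

variable {B' B : Type u} [CommRing B'] [Algebra ℚ B'] [Differential B']
  [CommRing B] [Algebra ℚ B] [Differential B]

/-- A first order infinitesimal variation: a homomorphism `base` from the operators and functions
over `B'` to those over `B`, and a derivation `del` along it, compatible with all structures. -/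
structure Jet (K' : FunctionClass B') (K : FunctionClass B) where
  base : Op B' →+* Op B
  del : Op B' →+ Op B
  baseFn : Fn B' →+ Fn B
  delFn : Fn B' →+ Fn B
  del_mul : ∀ P Q, del (P * Q) = del P * base Q + base P * del Q
  base_mulOp : ∀ f, base (mulOp f) = mulOp (baseFn f)
  del_mulOp : ∀ f, del (mulOp f) = mulOp (delFn f)
  base_Dpow : ∀ n, base (Dpow n) = Dpow n
  del_Dpow : ∀ n, del (Dpow n) = 0
  base_plusPart : ∀ P, base (plusPart P) = plusPart (base P)
  del_plusPart : ∀ P, del (plusPart P) = plusPart (del P)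
  base_mem_coeffs : ∀ P ∈ K'.coeffOps, base P ∈ K.coeffOps
  del_mem_coeffs : ∀ P ∈ K'.coeffOps, del P ∈ K.coeffOps
  base_mem_eig : ∀ f ∈ K'.EigFn, baseFn f ∈ K.EigFn
  del_mem_eig : ∀ f ∈ K'.EigFn, delFn f ∈ K.EigFn
  base_mem_adj : ∀ f ∈ K'.AdjFn, baseFn f ∈ K.AdjFn
  del_mem_adj : ∀ f ∈ K'.AdjFn, delFn f ∈ K.AdjFn
  base_mem_pot : ∀ f ∈ valuesIn K'.potGroup, baseFn f ∈ valuesIn K.potGroup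
  del_mem_pot : ∀ f ∈ valuesIn K'.potGroup, delFn f ∈ valuesIn K.potGroup

namespace Jet
variable {K' : FunctionClass B'} {K : FunctionClass B} (j : Jet K' K)

lemma base_minusPart (P : Op B') : j.base (minusPart P) = minusPart (j.base P) := by
  rw [minusPart_eq, minusPart_eq, map_sub, j.base_plusPart]

lemma del_minusPart (P : Op B') : j.del (minusPart P) = minusPart (j.del P) := by
  rw [minusPart_eq, minusPart_eq, map_sub, j.del_plusPart]

lemma del_one : j.del 1 = 0 := by rw [← Dpow_zero, j.del_Dpow]

lemma base_mem_diff {P : Op B'} (hP : P ∈ diffOps B') : j.base P ∈ diffOps B := by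
  rw [← plusPart_of_diff hP, j.base_plusPart]
  exact plusPart_mem _

lemma del_mem_diff {P : Op B'} (hP : P ∈ diffOps B') : j.del P ∈ diffOps B := by
  rw [← plusPart_of_diff hP, j.del_plusPart]
  exact plusPart_mem _

lemma baseFn_mul (f g : Fn B') : j.baseFn (f * g) = j.baseFn f * j.baseFn g := by
  apply mulOp_injective
  rw [← j.base_mulOp, mulOp_mul, map_mul, j.base_mulOp, j.base_mulOp, mulOp_mul]

lemma delFn_mul (f g : Fn B') :
    j.delFn (f * g) = j.delFn f * j.baseFn g + j.baseFn f * j.delFn g := by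
  apply mulOp_injective
  rw [← j.del_mulOp, mulOp_mul, j.del_mul, j.base_mulOp, j.base_mulOp, j.del_mulOp, j.del_mulOp,
    mulOp_add, mulOp_mul, mulOp_mul]

lemma baseFn_applyDiff {P : Op B'} (hP : P ∈ diffOps B') (f : Fn B') :
    j.baseFn (applyDiff P f) = applyDiff (j.base P) (j.baseFn f) := by
  obtain ⟨S, hS, e⟩ := exists_mul_mulOp hP f
  refine (applyDiff_unique (j.base_mem_diff hP) (j.base_mem_diff hS) ?_).symm
  rw [← j.base_mulOp, ← map_mul, e, map_add, map_mul, j.base_Dpow, j.base_mulOp]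

lemma baseFn_applyAdj {P : Op B'} (hP : P ∈ diffOps B') (f : Fn B') :
    j.baseFn (applyAdj P f) = applyAdj (j.base P) (j.baseFn f) := by
  obtain ⟨S, hS, e⟩ := exists_mulOp_mul hP f
  refine (applyAdj_unique (j.base_mem_diff hP) (j.base_mem_diff hS) ?_).symm
  rw [← j.base_mulOp, ← map_mul, e, map_add, map_mul, j.base_Dpow, j.base_mulOp]

/-- The division identity for `P f` is differentiated. As `D` does not vary, the result is again a
division by `D`, and the remainders can be compared. -/
lemma delFn_applyDiff {P : Op B'} (hP : P ∈ diffOps B') (f : Fn B') :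
    j.delFn (applyDiff P f) =
      applyDiff (j.del P) (j.baseFn f) + applyDiff (j.base P) (j.delFn f) := by
  obtain ⟨S, hS, e⟩ := exists_mul_mulOp hP f
  obtain ⟨S₁, hS₁, e₁⟩ := exists_mul_mulOp (j.del_mem_diff hP) (j.baseFn f)
  obtain ⟨S₂, hS₂, e₂⟩ := exists_mul_mulOp (j.base_mem_diff hP) (j.delFn f)
  refine mulOp_add_mul_D_inj (j.del_mem_diff hS) (add_mem hS₁ hS₂) ?_
  have h := congrArg j.del e
  rw [j.del_mul, map_add, j.del_mul, j.base_mulOp, j.del_mulOp, j.del_mulOp, j.base_Dpow,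
    j.del_Dpow, mul_zero, add_zero, e₁, e₂] at h
  rw [← h, mulOp_add, add_mul]
  abel

lemma delFn_applyAdj {P : Op B'} (hP : P ∈ diffOps B') (f : Fn B') :
    j.delFn (applyAdj P f) =
      applyAdj (j.del P) (j.baseFn f) + applyAdj (j.base P) (j.delFn f) := by
  obtain ⟨S, hS, e⟩ := exists_mulOp_mul hP f
  obtain ⟨S₁, hS₁, e₁⟩ := exists_mulOp_mul (j.del_mem_diff hP) (j.baseFn f)
  obtain ⟨S₂, hS₂, e₂⟩ := exists_mulOp_mul (j.base_mem_diff hP) (j.delFn f)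
  refine mulOp_add_D_mul_inj (j.del_mem_diff hS) (add_mem hS₁ hS₂) ?_
  have h := congrArg j.del e
  rw [j.del_mul, map_add, j.del_mul, j.base_mulOp, j.del_mulOp, j.del_mulOp, j.base_Dpow,
    j.del_Dpow, zero_mul, zero_add, e₁, e₂] at h
  rw [← h, mulOp_add, mul_add]
  abel

lemma baseFn_dx (f : Fn B') : j.baseFn (Fn.dx f) = Fn.dx (j.baseFn f) := by
  rw [← applyDiff_D, j.baseFn_applyDiff Dpow_one_mem_diff, j.base_Dpow, applyDiff_D]

lemma delFn_dx (f : Fn B') : j.delFn (Fn.dx f) = Fn.dx (j.delFn f) := by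
  rw [← applyDiff_D, j.delFn_applyDiff Dpow_one_mem_diff, j.base_Dpow, j.del_Dpow,
    applyDiff_zero_left, zero_add, applyDiff_D]

lemma baseFn_intx {f : Fn B'} (hf : f ∈ valuesIn K'.potGroup) :
    j.baseFn (K'.intx f) = K.intx (j.baseFn f) :=
  (FunctionClass.intx_eq (j.base_mem_pot _ (FunctionClass.intx_mem hf))
    (by rw [← j.baseFn_dx, FunctionClass.dx_intx hf])).symm

/-- A variation commutes with `∂` and preserves `pot`, so it carries antiderivatives in `pot` to
antiderivatives in `pot`. -/
lemma delFn_intx {f : Fn B'} (hf : f ∈ valuesIn K'.potGroup) :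
    j.delFn (K'.intx f) = K.intx (j.delFn f) :=
  (FunctionClass.intx_eq (j.del_mem_pot _ (FunctionClass.intx_mem hf))
    (by rw [← j.delFn_dx, FunctionClass.dx_intx hf])).symm

/-- `base` on eigenfunctions. -/
noncomputable def baseE : K'.EigFn →ₗ[ℚ] K.EigFn :=
  AddMonoidHom.toRatLinearMap (AddMonoidHom.mk' (fun f => ⟨j.baseFn f, j.base_mem_eig f f.2⟩)
    fun f g => Subtype.ext (j.baseFn.map_add f g))

/-- `del` on eigenfunctions. -/
noncomputable def delE : K'.EigFn →ₗ[ℚ] K.EigFn :=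
  AddMonoidHom.toRatLinearMap (AddMonoidHom.mk' (fun f => ⟨j.delFn f, j.del_mem_eig f f.2⟩)
    fun f g => Subtype.ext (j.delFn.map_add f g))

/-- `base` on adjoint eigenfunctions. -/
noncomputable def baseA : K'.AdjFn →ₗ[ℚ] K.AdjFn :=
  AddMonoidHom.toRatLinearMap (AddMonoidHom.mk' (fun f => ⟨j.baseFn f, j.base_mem_adj f f.2⟩)
    fun f g => Subtype.ext (j.baseFn.map_add f g))

/-- `del` on adjoint eigenfunctions. -/
noncomputable def delA : K'.AdjFn →ₗ[ℚ] K.AdjFn :=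
  AddMonoidHom.toRatLinearMap (AddMonoidHom.mk' (fun f => ⟨j.delFn f, j.del_mem_adj f f.2⟩)
    fun f g => Subtype.ext (j.delFn.map_add f g))

lemma coe_baseE (f : K'.EigFn) : (j.baseE f : Fn B) = j.baseFn f := rfl

lemma coe_delE (f : K'.EigFn) : (j.delE f : Fn B) = j.delFn f := rfl

lemma coe_baseA (f : K'.AdjFn) : (j.baseA f : Fn B) = j.baseFn f := rfl

lemma coe_delA (f : K'.AdjFn) : (j.delA f : Fn B) = j.delFn f := rfl

/-- `base` on kernels. -/
noncomputable def baseT : K'.EigFn ⊗[ℚ] K'.AdjFn →ₗ[ℚ] K.EigFn ⊗[ℚ] K.AdjFn :=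
  TensorProduct.map j.baseE j.baseA

/-- `del` on kernels. -/
noncomputable def delT : K'.EigFn ⊗[ℚ] K'.AdjFn →ₗ[ℚ] K.EigFn ⊗[ℚ] K.AdjFn :=
  TensorProduct.map j.delE j.baseA + TensorProduct.map j.baseE j.delA

lemma baseT_tmul (a : K'.EigFn) (b : K'.AdjFn) : j.baseT (a ⊗ₜ b) = j.baseE a ⊗ₜ j.baseA b := rfl

lemma delT_tmul (a : K'.EigFn) (b : K'.AdjFn) :
    j.delT (a ⊗ₜ b) = j.delE a ⊗ₜ j.baseA b + j.baseE a ⊗ₜ j.delA b := rfl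

/-- `base` on differential operators. -/
noncomputable def baseD (P : K'.diffOps) : K.diffOps :=
  ⟨j.base P, j.base_mem_diff P.2.1, j.base_mem_coeffs P P.2.2⟩

/-- `del` on differential operators. -/
noncomputable def delD (P : K'.diffOps) : K.diffOps :=
  ⟨j.del P, j.del_mem_diff P.2.1, j.del_mem_coeffs P P.2.2⟩

/-- The operator `X'` and its actions have base value `X` and variation `V`. -/
structure Varies (X' : K'.ActOps) (X V : K.ActOps) : Prop where
  base_op : j.base X'.op = X.op
  del_op : j.del X'.op = V.op
  base_eig : ∀ f, j.baseE (X'.eig f) = X.eig (j.baseE f)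
  base_adj : ∀ g, j.baseA (X'.adj g) = X.adj (j.baseA g)
  del_eig : ∀ f, j.delE (X'.eig f) = V.eig (j.baseE f) + X.eig (j.delE f)
  del_adj : ∀ g, j.delA (X'.adj g) = V.adj (j.baseA g) + X.adj (j.delA g)

variable {j}

lemma Varies.add {X' Y' : K'.ActOps} {X Y V U : K.ActOps} (hX : j.Varies X' X V)
    (hY : j.Varies Y' Y U) : j.Varies (X' + Y') (X + Y) (V + U) where
  base_op := by rw [map_add, map_add, map_add, hX.base_op, hY.base_op]
  del_op := by rw [map_add, map_add, map_add, hX.del_op, hY.del_op]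
  base_eig f := by
    rw [map_add, map_add, LinearMap.add_apply, LinearMap.add_apply, map_add, hX.base_eig,
      hY.base_eig]
  base_adj g := by
    rw [FunctionClass.ActOps.adj_add, FunctionClass.ActOps.adj_add, LinearMap.add_apply,
      LinearMap.add_apply, map_add, hX.base_adj, hY.base_adj]
  del_eig f := by
    rw [map_add, map_add, map_add, LinearMap.add_apply, LinearMap.add_apply, LinearMap.add_apply,
      map_add, hX.del_eig, hY.del_eig]
    abel
  del_adj g := by
    rw [FunctionClass.ActOps.adj_add, FunctionClass.ActOps.adj_add, FunctionClass.ActOps.adj_add,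
      LinearMap.add_apply, LinearMap.add_apply, LinearMap.add_apply, map_add, hX.del_adj,
      hY.del_adj]
    abel

lemma varies_diff (P : K'.diffOps) :
    j.Varies (K'.diff P) (K.diff (j.baseD P)) (K.diff (j.delD P)) where
  base_op := rfl
  del_op := rfl
  base_eig f := Subtype.ext (j.baseFn_applyDiff P.2.1 f)
  base_adj g := Subtype.ext (j.baseFn_applyAdj P.2.1 g)
  del_eig f := Subtype.ext (j.delFn_applyDiff P.2.1 f)
  del_adj g := Subtype.ext (j.delFn_applyAdj P.2.1 g)

/-- The product rule for `a D⁻¹ b` and for `a ∂ₓ⁻¹(b f)`: `D⁻¹` and `∂ₓ⁻¹` are constant under the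
variation. -/
lemma varies_pair (a : K'.EigFn) (b : K'.AdjFn) :
    j.Varies (K'.pair a b) (K.pair (j.baseE a) (j.baseA b))
      (K.pair (j.delE a) (j.baseA b) + K.pair (j.baseE a) (j.delA b)) where
  base_op := by
    rw [FunctionClass.op_pair, FunctionClass.op_pair, map_mul, map_mul, j.base_mulOp,
      j.base_mulOp, j.base_Dpow]
    rfl
  del_op := by
    rw [map_add, FunctionClass.op_pair, FunctionClass.op_pair, FunctionClass.op_pair, j.del_mul,
      j.del_mul, map_mul, j.base_mulOp, j.base_mulOp, j.del_mulOp, j.del_mulOp, j.base_Dpow,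
      j.del_Dpow, mul_zero, add_zero]
    rfl
  base_eig f := Subtype.ext <| by
    rw [coe_baseE, FunctionClass.coe_pair_eig, FunctionClass.coe_pair_eig, baseFn_mul,
      j.baseFn_intx (K'.mul_mem_pot' f.2 b.2), baseFn_mul]
    rfl
  base_adj g := Subtype.ext <| by
    rw [coe_baseA, FunctionClass.coe_pair_adj, FunctionClass.coe_pair_adj, map_neg, baseFn_mul,
      j.baseFn_intx (K'.mul_mem_pot a.2 g.2), baseFn_mul]
    rfl
  del_eig f := Subtype.ext <| by
    have h1 := K.mul_mem_pot' (j.baseE f).2 (j.delA b).2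
    have h2 := K.mul_mem_pot' (j.delE f).2 (j.baseA b).2
    rw [Submodule.coe_add, FunctionClass.ActOps.coe_eig_add, coe_delE, FunctionClass.coe_pair_eig,
      FunctionClass.coe_pair_eig, FunctionClass.coe_pair_eig, FunctionClass.coe_pair_eig,
      delFn_mul, j.delFn_intx (K'.mul_mem_pot' f.2 b.2), j.baseFn_intx (K'.mul_mem_pot' f.2 b.2),
      delFn_mul, baseFn_mul, ← coe_baseE, ← coe_baseE, ← coe_baseA, ← coe_delE, ← coe_delE,
      ← coe_delA, FunctionClass.intx_add h1 h2]
    ring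
  del_adj g := Subtype.ext <| by
    have h1 := K.mul_mem_pot (j.delE a).2 (j.baseA g).2
    have h2 := K.mul_mem_pot (j.baseE a).2 (j.delA g).2
    rw [Submodule.coe_add, FunctionClass.ActOps.coe_adj_add, coe_delA, FunctionClass.coe_pair_adj,
      FunctionClass.coe_pair_adj, FunctionClass.coe_pair_adj, FunctionClass.coe_pair_adj, map_neg,
      delFn_mul, j.delFn_intx (K'.mul_mem_pot a.2 g.2), j.baseFn_intx (K'.mul_mem_pot a.2 g.2),
      delFn_mul, baseFn_mul, ← coe_baseE, ← coe_baseA, ← coe_baseA, ← coe_delE, ← coe_delA,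
      ← coe_delA, FunctionClass.intx_add h1 h2]
    ring

lemma varies_ofKernel (T : K'.EigFn ⊗[ℚ] K'.AdjFn) :
    j.Varies (K'.ofKernel T) (K.ofKernel (j.baseT T)) (K.ofKernel (j.delT T)) := by
  induction T with
  | zero =>
    have h := varies_diff (j := j) 0
    have h1 : j.baseD 0 = 0 := Subtype.ext (map_zero j.base)
    have h2 : j.delD 0 = 0 := Subtype.ext (map_zero j.del)
    rw [h1, h2, map_zero, map_zero] at h
    simpa using h
  | add T S hT hS =>
    simp only [map_add]
    exact hT.add hS
  | tmul a b =>
    rw [baseT_tmul, delT_tmul, map_add]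
    exact varies_pair a b

lemma varies_mk (P : K'.diffOps) (T : K'.EigFn ⊗[ℚ] K'.AdjFn) :
    j.Varies (K'.diff P + K'.ofKernel T) (K.diff (j.baseD P) + K.ofKernel (j.baseT T))
      (K.diff (j.delD P) + K.ofKernel (j.delT T)) :=
  (varies_diff P).add (varies_ofKernel T)

end Jet

end

/-! ### Derivatives in the times as variations -/

section Time
variable {B : Type u} [CommRing B] [Differential B]

/-- `∂/∂t_l` on operators as an additive map. -/
noncomputable def dtOpHom : ℕ → Op B →+ Op B
  | 0 => 0
  | 1 => mapCoeffHom
      { toFun := PDO.dx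
        map_zero' := PDO.ext fun _ => map_zero _
        map_add' _ _ := PDO.ext fun _ => map_add _ _ _ }
  | n + 2 => timeDeriv.shift n

lemma dtOpHom_apply (l : ℕ) (P : Op B) : dtOpHom l P = dtOp l P := by
  match l with
  | 0 => rfl
  | 1 => rfl
  | n + 2 => rfl

/-- `∂/∂t_l` on functions as an additive map. -/
noncomputable def dtFnHom : ℕ → Fn B →+ Fn B
  | 0 => 0
  | 1 => Fn.dx
  | n + 2 => timeDeriv.shift n

lemma dtFnHom_apply (l : ℕ) (f : Fn B) : dtFnHom l f = dtFn l f := by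
  match l with
  | 0 => rfl
  | 1 => rfl
  | n + 2 => rfl

lemma dtOpHom_one (P : Op B) : dtOpHom 1 P = Dpow 1 * P - P * Dpow 1 := funext fun μ => by
  change (P μ).dx = (Dpow 1 * P : Op B) μ - (P * Dpow 1 : Op B) μ
  rw [Dpow, MvPowerSeries.mul_C_apply', MvPowerSeries.C_mul_apply', PDO.dx_eq]

lemma dtOpHom_mul (l : ℕ) (P Q : Op B) :
    dtOpHom l (P * Q) = dtOpHom l P * Q + P * dtOpHom l Q := by
  match l with
  | 0 => simp [dtOpHom]
  | 1 => rw [dtOpHom_one, dtOpHom_one, dtOpHom_one]; noncomm_ring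
  | n + 2 => exact timeDeriv.shift_mul n P Q

lemma smul_coeff (n : ℕ) (P : PDO B) (k : ℤ) : (n • P).coeff k = n • P.coeff k :=
  map_nsmul (PDO.coeffHom k) n P

lemma dtOpHom_mulOp (l : ℕ) (f : Fn B) : dtOpHom l (mulOp f) = mulOp (dtFnHom l f) := by
  match l with
  | 0 => exact mulOp_zero.symm
  | 1 => rw [dtOpHom_one, Dpow_one_mul_mulOp, add_sub_cancel_left]; rfl
  | n + 2 => exact funext fun μ => (map_nsmul (PDO.monomialHom 0) (μ n + 1) _).symm

lemma dtOpHom_Dpow (l : ℕ) (n : ℤ) : dtOpHom l (Dpow n : Op B) = 0 := by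
  match l with
  | 0 => rfl
  | 1 => rw [dtOpHom_one, Dpow_mul_Dpow, Dpow_mul_Dpow, add_comm, sub_self]
  | k + 2 =>
    refine funext fun μ => ?_
    change (μ k + 1) • (Dpow n : Op B) (μ + Finsupp.single k 1) = 0
    rw [Dpow_apply, if_neg, smul_zero]
    intro h
    have := DFunLike.congr_fun h k
    simp at this

lemma dtOpHom_plusPart (l : ℕ) (P : Op B) : dtOpHom l (plusPart P) = plusPart (dtOpHom l P) := by
  match l with
  | 0 => exact plusPart_zero.symm
  | 1 =>
    refine Op.ext' fun μ n => ?_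
    change ((if 0 ≤ n then (P μ).coeff n else 0 : B))′ = if 0 ≤ n then ((P μ).coeff n)′ else 0
    split_ifs
    · rfl
    · exact map_zero _
  | n + 2 => exact funext fun μ => (map_nsmul PDO.posHom (μ n + 1) _).symm

lemma dtOpHom_mem_coeffsIn {I : AddSubgroup B} (hI : derivStable I) (l : ℕ) {P : Op B}
    (hP : P ∈ coeffsIn I) : dtOpHom l P ∈ coeffsIn I := by
  match l with
  | 0 => exact zero_mem _
  | 1 => exact fun μ n => hI _ (hP μ n)
  | k + 2 =>
    intro μ n
    change ((μ k + 1) • P (μ + Finsupp.single k 1)).coeff n ∈ I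
    rw [smul_coeff]
    exact nsmul_mem (hP _ n) _

lemma dtFnHom_mem_valuesIn {I : AddSubgroup B} (hI : derivStable I) (l : ℕ) {f : Fn B}
    (hf : f ∈ valuesIn I) : dtFnHom l f ∈ valuesIn I := by
  match l with
  | 0 => exact zero_mem _
  | 1 => exact dx_mem_valuesIn hI hf
  | k + 2 => exact fun μ => nsmul_mem (hf (μ + Finsupp.single k 1)) _

/-- The variation along the time `t_l`. -/
noncomputable def timeJet [Algebra ℚ B] (K : FunctionClass B) (l : ℕ) : Jet K K where
  base := RingHom.id _
  del := dtOpHom l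
  baseFn := AddMonoidHom.id _
  delFn := dtFnHom l
  del_mul := dtOpHom_mul l
  base_mulOp _ := rfl
  del_mulOp := dtOpHom_mulOp l
  base_Dpow _ := rfl
  del_Dpow := dtOpHom_Dpow l
  base_plusPart _ := rfl
  del_plusPart := dtOpHom_plusPart l
  base_mem_coeffs _ h := h
  del_mem_coeffs _ h := dtOpHom_mem_coeffsIn K.coeffGroup_stable l h
  base_mem_eig _ h := h
  del_mem_eig _ h := dtFnHom_mem_valuesIn K.eigGroup_stable l h
  base_mem_adj _ h := h
  del_mem_adj _ h := dtFnHom_mem_valuesIn K.adjGroup_stable l h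
  base_mem_pot _ h := h
  del_mem_pot _ h := dtFnHom_mem_valuesIn K.potGroup_stable l h

end Time

/-! ### The `ε`-component over the dual numbers as a variation -/

section Dual
open TrivSqZeroExt
variable {B : Type u} [CommRing B] [Differential B]

lemma DualNumber.fst_iterD [Algebra ℚ B] (n : ℕ) (z : DualNumber B) :
    (iterD n z).fst = iterD n z.fst := by
  induction n with
  | zero => rfl
  | succ n ih => rw [iterD_succ, iterD_succ, DualNumber.fst_deriv, ih]

lemma DualNumber.snd_iterD [Algebra ℚ B] (n : ℕ) (z : DualNumber B) :
    (iterD n z).snd = iterD n z.snd := by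
  induction n with
  | zero => rfl
  | succ n ih => rw [iterD_succ, iterD_succ, DualNumber.snd_deriv, ih]

namespace PDO

/-- The coefficients of `ε⁰`. -/
def dualFst (P : PDO (DualNumber B)) : PDO B :=
  ⟨fun n => (P.coeff n).fst, bdd_of_imp P fun n h => by rw [h, fst_zero]⟩

lemma coeff_dualFst (P : PDO (DualNumber B)) (n : ℤ) : P.dualFst.coeff n = (P.coeff n).fst := rfl

lemma coeff_eps (P : PDO (DualNumber B)) (n : ℤ) : P.eps.coeff n = (P.coeff n).snd := rfl

lemma dualFst_mul [Algebra ℚ B] (P Q : PDO (DualNumber B)) :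
    (P * Q).dualFst = P.dualFst * Q.dualFst := ext fun n => by
  obtain ⟨N, J, hP, hQ, hJ⟩ := exists_bound₂ P Q n
  have hP' : ∀ n, N < n → P.dualFst.coeff n = 0 := fun n hn => by
    rw [coeff_dualFst, hP n hn, fst_zero]
  have hQ' : ∀ n, N < n → Q.dualFst.coeff n = 0 := fun n hn => by
    rw [coeff_dualFst, hQ n hn, fst_zero]
  rw [coeff_dualFst, coeff_mul_eq_sum hP hQ hJ, coeff_mul_eq_sum hP' hQ' hJ]
  simp only [fst_sum, fst_smul, fst_mul, DualNumber.fst_iterD, coeff_dualFst]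

lemma eps_mul [Algebra ℚ B] (P Q : PDO (DualNumber B)) :
    (P * Q).eps = P.eps * Q.dualFst + P.dualFst * Q.eps := ext fun n => by
  obtain ⟨N, J, hP, hQ, hJ⟩ := exists_bound₂ P Q n
  have hP' : ∀ n, N < n → P.dualFst.coeff n = 0 := fun n hn => by
    rw [coeff_dualFst, hP n hn, fst_zero]
  have hQ' : ∀ n, N < n → Q.dualFst.coeff n = 0 := fun n hn => by
    rw [coeff_dualFst, hQ n hn, fst_zero]
  have hP'' : ∀ n, N < n → P.eps.coeff n = 0 := fun n hn => by
    rw [coeff_eps, hP n hn, snd_zero]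
  have hQ'' : ∀ n, N < n → Q.eps.coeff n = 0 := fun n hn => by
    rw [coeff_eps, hQ n hn, snd_zero]
  rw [coeff_eps, coeff_add, coeff_mul_eq_sum hP hQ hJ, coeff_mul_eq_sum hP'' hQ' hJ,
    coeff_mul_eq_sum hP' hQ'' hJ]
  simp only [snd_sum, snd_smul, DualNumber.snd_mul, DualNumber.fst_iterD, DualNumber.snd_iterD,
    coeff_dualFst, coeff_eps, ← Finset.sum_add_distrib, ← smul_add]
  refine Finset.sum_congr rfl fun p _ => Finset.sum_congr rfl fun j _ => ?_
  rw [add_comm]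

/-- The coefficients of `ε⁰` as a ring homomorphism. -/
noncomputable def dualFstHom [Algebra ℚ B] : PDO (DualNumber B) →+* PDO B where
  toFun := dualFst
  map_one' := ext fun n => by
    rw [coeff_dualFst, coeff_one, coeff_one]
    split_ifs <;> rfl
  map_mul' := dualFst_mul
  map_zero' := rfl
  map_add' _ _ := rfl

/-- The coefficients of `ε` as an additive map. -/
noncomputable def epsHom : PDO (DualNumber B) →+ PDO B where
  toFun := eps
  map_zero' := rfl
  map_add' _ _ := rfl

end PDO

/-- The variation given by the dual numbers. -/
noncomputable def dualJet [Algebra ℚ B] (K : FunctionClass B) : Jet K.dual K where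
  base := MvPowerSeries.map PDO.dualFstHom
  del := mapCoeffHom PDO.epsHom
  baseFn := mapCoeffHom (TrivSqZeroExt.fstHom B B B).toAddMonoidHom
  delFn := mapCoeffHom (TrivSqZeroExt.sndHom B B).toAddMonoidHom
  del_mul P Q := funext fun μ => by
    change PDO.epsHom ((P * Q) μ) = (_ : Op B) μ + (_ : Op B) μ
    rw [MvPowerSeries.mul_apply', MvPowerSeries.mul_apply', MvPowerSeries.mul_apply', map_sum,
      ← Finset.sum_add_distrib]
    exact Finset.sum_congr rfl fun p _ => PDO.eps_mul _ _
  base_mulOp f := Op.ext' fun μ n => by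
    change ((mulOp f μ).coeff n).fst = (PDO.monomial 0 ((f μ).fst)).coeff n
    rw [mulOp_apply, PDO.coeff_monomial, PDO.coeff_monomial]
    split_ifs <;> rfl
  del_mulOp f := Op.ext' fun μ n => by
    change ((mulOp f μ).coeff n).snd = (PDO.monomial 0 ((f μ).snd)).coeff n
    rw [mulOp_apply, PDO.coeff_monomial, PDO.coeff_monomial]
    split_ifs <;> rfl
  base_Dpow k := Op.ext' fun μ n => by
    change (((Dpow k : Op (DualNumber B)) μ).coeff n).fst = _
    rw [Dpow_apply, Dpow_apply]
    split_ifs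
    · rw [PDO.coeff_monomial, PDO.coeff_monomial]
      split_ifs <;> rfl
    · rfl
  del_Dpow k := Op.ext' fun μ n => by
    change (((Dpow k : Op (DualNumber B)) μ).coeff n).snd = 0
    rw [Dpow_apply]
    split_ifs
    · rw [PDO.coeff_monomial]
      split_ifs <;> rfl
    · rfl
  base_plusPart P := Op.ext' fun μ n => by
    change (if 0 ≤ n then (P μ).coeff n else 0).fst = if 0 ≤ n then ((P μ).coeff n).fst else 0
    split_ifs <;> rfl
  del_plusPart P := Op.ext' fun μ n => by
    change (if 0 ≤ n then (P μ).coeff n else 0).snd = if 0 ≤ n then ((P μ).coeff n).snd else 0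
    split_ifs <;> rfl
  base_mem_coeffs P h := fun μ n => (h μ n).1
  del_mem_coeffs P h := fun μ n => (h μ n).2
  base_mem_eig f h := fun μ => (h μ).1
  del_mem_eig f h := fun μ => (h μ).2
  base_mem_adj f h := fun μ => (h μ).1
  del_mem_adj f h := fun μ => (h μ).2
  base_mem_pot f h := fun μ => (h μ).1
  del_mem_pot f h := fun μ => (h μ).2

variable [Algebra ℚ B] (K : FunctionClass B)

lemma dualJet_base_addEps (P Q : Op B) : (dualJet K).base (Op.addEps P Q) = P :=
  Op.ext' fun μ n => by
    change (inl ((P μ).coeff n) + inr ((Q μ).coeff n) : DualNumber B).fst = _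
    simp

lemma dualJet_del_addEps (P Q : Op B) : (dualJet K).del (Op.addEps P Q) = Q :=
  Op.ext' fun μ n => by
    change (inl ((P μ).coeff n) + inr ((Q μ).coeff n) : DualNumber B).snd = _
    simp

lemma dualJet_del (P : Op (DualNumber B)) : (dualJet K).del P = Op.eps P := rfl

lemma dualJet_baseFn_addEps (f g : Fn B) : (dualJet K).baseFn (Fn.addEps f g) = f :=
  funext fun μ => by
    change (inl (f μ) + inr (g μ) : DualNumber B).fst = _
    simp

lemma dualJet_delFn_addEps (f g : Fn B) : (dualJet K).delFn (Fn.addEps f g) = g :=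
  funext fun μ => by
    change (inl (f μ) + inr (g μ) : DualNumber B).snd = _
    simp

/-- An equation over `B[ε]` thus splits into the equation at the base point and its first variation.
-/
lemma dualJet_op_ext {P Q : Op (DualNumber B)} (h : (dualJet K).base P = (dualJet K).base Q)
    (h' : (dualJet K).del P = (dualJet K).del Q) : P = Q := Op.ext' fun μ n => by
  ext
  · exact congrArg (fun R : Op B => (R μ).coeff n) h
  · exact congrArg (fun R : Op B => (R μ).coeff n) h'

lemma dualJet_fn_ext {f g : Fn (DualNumber B)} (h : (dualJet K).baseFn f = (dualJet K).baseFn g)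
    (h' : (dualJet K).delFn f = (dualJet K).delFn g) : f = g := funext fun μ => by
  ext
  · exact congrFun h μ
  · exact congrFun h' μ

lemma dualJet_base_dtOp (l : ℕ) (P : Op (DualNumber B)) :
    (dualJet K).base (dtOp l P) = dtOp l ((dualJet K).base P) := by
  match l with
  | 0 => exact map_zero _
  | 1 => exact Op.ext' fun μ n => DualNumber.fst_deriv _
  | k + 2 => exact funext fun μ => map_nsmul PDO.dualFstHom (μ k + 1) _

lemma dualJet_del_dtOp (l : ℕ) (P : Op (DualNumber B)) :
    (dualJet K).del (dtOp l P) = dtOp l ((dualJet K).del P) := by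
  match l with
  | 0 => exact map_zero _
  | 1 => exact Op.ext' fun μ n => DualNumber.snd_deriv _
  | k + 2 => exact funext fun μ => map_nsmul PDO.epsHom (μ k + 1) _

lemma dualJet_base_dtFn (l : ℕ) (f : Fn (DualNumber B)) :
    (dualJet K).baseFn (dtFn l f) = dtFn l ((dualJet K).baseFn f) := by
  match l with
  | 0 => exact map_zero _
  | 1 => exact funext fun μ => DualNumber.fst_deriv _
  | k + 2 => exact funext fun μ => fst_smul (μ k + 1) _

lemma dualJet_del_dtFn (l : ℕ) (f : Fn (DualNumber B)) :
    (dualJet K).delFn (dtFn l f) = dtFn l ((dualJet K).delFn f) := by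
  match l with
  | 0 => exact map_zero _
  | 1 => exact funext fun μ => DualNumber.snd_deriv _
  | k + 2 => exact funext fun μ => snd_smul (μ k + 1) _

end Dual

/-! ### Commutators with powers of `D` -/

section Commutators

lemma pow_mul_sub_mul_pow {R : Type*} [Ring R] {d a c : R} (h : d * a - a * d = c)
    (hc : c * d = d * c) (n : ℕ) : d ^ (n + 1) * a - a * d ^ (n + 1) = (n + 1) • (d ^ n * c) := by
  induction n with
  | zero => simp [h]
  | succ n ih =>
    have h1 : d ^ (n + 2) * a - a * d ^ (n + 2) =
        d * (d ^ (n + 1) * a - a * d ^ (n + 1)) + (d * a - a * d) * d ^ (n + 1) := by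
      rw [pow_succ' d (n + 1)]
      noncomm_ring
    have h2 : c * d ^ (n + 1) = d ^ (n + 1) * c := (Commute.pow_right (show Commute c d from hc) _)
    rw [h1, ih, h, h2, mul_smul_comm, ← mul_assoc, ← pow_succ', succ_nsmul _ (n + 1)]

variable {B : Type u} [CommRing B] [Differential B]

lemma Dpow_natCast (n : ℕ) : (Dpow n : Op B) = Dpow 1 ^ n := by
  induction n with
  | zero => rw [pow_zero, Nat.cast_zero, Dpow_zero]
  | succ n ih => rw [pow_succ, ← ih, Dpow_mul_Dpow, Nat.cast_succ]

lemma D_commutator_mem {q : ℤ} {P : Op B} (hP : P ∈ ordLE B q) :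
    Dpow 1 * P - P * Dpow 1 ∈ ordLE B q := by
  rw [← dtOpHom_one]
  intro μ k hk
  change ((P μ).coeff k)′ = 0
  rw [hP μ k hk, map_zero]

/-- The commutator with `D` only differentiates coefficients and so does not raise the order; one
order is therefore lost against the product. For `q = -1` this is the source of the bound `r - 2`.
-/
lemma Dpow_commutator_mem {q : ℤ} {P : Op B} (hP : P ∈ ordLE B q) (n : ℕ) :
    Dpow n * P - P * Dpow n ∈ ordLE B (n + q - 1) := by
  rw [Dpow_natCast]
  induction n with
  | zero => simp only [pow_zero, one_mul, mul_one, sub_self]; exact zero_mem _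
  | succ n ih =>
    have h1 : Dpow 1 ^ (n + 1) * P - P * Dpow 1 ^ (n + 1) =
        Dpow 1 * (Dpow 1 ^ n * P - P * Dpow 1 ^ n) + (Dpow 1 * P - P * Dpow 1) * Dpow 1 ^ n := by
      rw [pow_succ']
      noncomm_ring
    rw [h1]
    refine add_mem (ordLE_mono ?_ (ordLE_mul (Dpow_mem_ordLE 1) ih)) ?_
    · push_cast; omega
    · rw [← Dpow_natCast]
      exact ordLE_mono (by push_cast; omega) (ordLE_mul (D_commutator_mem hP) (Dpow_mem_ordLE n))

end Commutators

/-! ### The undressed operator `M⁽⁰⁾` -/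

section BareM
variable {B : Type u} [CommRing B] [Algebra ℚ B] [Differential B] (K : FunctionClass B) (r : ℕ)

lemma time_one_apply (μ : ℕ →₀ ℕ) : K.time 1 μ = if μ = 0 then K.x else 0 :=
  MvPowerSeries.C_apply' _ _

lemma time_add_two_apply (n : ℕ) (μ : ℕ →₀ ℕ) :
    K.time (n + 2) μ = if μ = Finsupp.single n 1 then 1 else 0 :=
  MvPowerSeries.coeff_X μ n

lemma bareM_term_zero {n : ℤ} {q : ℚ} {b : B} (hb : b = 0) : PDO.monomial n (q • b) = 0 := by
  rw [hb, smul_zero, PDO.monomial_zero]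

/-- `M⁽⁰⁾` has degree at most one in the times `t₂, t₃, …`; its constant coefficient carries `t₁ =
x`. This and the next two lemmas list all coefficients, which removes the `finsum`. -/
lemma bareM_zero : bareM K r 0 = PDO.monomial (1 - r) ((1 / r : ℚ) • K.x) := by
  rw [bareM, finsum_eq_single _ 1 fun l hl => bareM_term_zero ?_]
  · rw [time_one_apply, if_pos rfl, Nat.cast_one, Nat.cast_one]
  · match l with
    | 0 => rfl
    | 1 => exact absurd rfl hl
    | n + 2 => rw [time_add_two_apply, if_neg fun h => by simpa using DFunLike.congr_fun h n]

lemma bareM_single (n : ℕ) : bareM K r (Finsupp.single n 1) =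
    PDO.monomial ((n + 2 : ℕ) - r) (((n + 2 : ℕ) / r : ℚ) • (1 : B)) := by
  rw [bareM, finsum_eq_single _ (n + 2) fun l hl => bareM_term_zero ?_]
  · rw [time_add_two_apply, if_pos rfl]
  · match l with
    | 0 => rfl
    | 1 => rw [time_one_apply, if_neg (by simp)]
    | k + 2 =>
      rw [time_add_two_apply, if_neg]
      intro h
      have := Finsupp.single_left_injective one_ne_zero h
      omega

lemma bareM_of_ne {μ : ℕ →₀ ℕ} (h0 : μ ≠ 0) (h : ∀ n, μ ≠ Finsupp.single n 1) :
    bareM K r μ = 0 := by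
  rw [bareM]
  refine finsum_eq_zero_of_forall_eq_zero fun l => bareM_term_zero ?_
  match l with
  | 0 => rfl
  | 1 => rw [time_one_apply, if_neg h0]
  | n + 2 => rw [time_add_two_apply, if_neg (h n)]

lemma bareM_mem : bareM K r ∈ K.coeffOps := fun μ n => by
  have key : ∀ (k : ℤ) (q : ℚ) (b : B), b ∈ K.coeffs →
      (PDO.monomial k (q • b)).coeff n ∈ K.coeffs := fun k q b hb => by
    rw [PDO.coeff_monomial]
    split_ifs
    · exact K.coeffs.smul_mem hb q
    · exact K.coeffs.zero_mem
  by_cases h0 : μ = 0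
  · subst h0
    rw [bareM_zero]
    exact key _ _ _ K.x_mem
  · by_cases h : ∀ n, μ ≠ Finsupp.single n 1
    · rw [bareM_of_ne K r h0 h]
      exact K.coeffs.zero_mem
    · push Not at h
      obtain ⟨k, rfl⟩ := h
      rw [bareM_single]
      exact key _ _ _ K.coeffs.one_mem

/-- The derivative of `M⁽⁰⁾` in `t_l` is `(l / r) Dˡ⁻ʳ`. -/
lemma dtOpHom_bareM {l : ℕ} (hl : 1 ≤ l) : dtOpHom l (bareM K r) =
    MvPowerSeries.C (PDO.monomial (l - r) ((l / r : ℚ) • (1 : B))) := by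
  refine funext fun μ => ?_
  rw [MvPowerSeries.C_apply']
  match l with
  | 1 =>
    have hq : ∀ (q : ℚ) (b : B), (q • b)′ = q • b′ := fun q b =>
      (Differential.deriv (R := B)).toLinearMap.toAddMonoidHom.toRatLinearMap.map_smul q b
    have hdx : ∀ (n : ℤ) (q : ℚ) (b : B),
        (PDO.monomial n (q • b)).dx = PDO.monomial n (q • b′) := fun n q b =>
      PDO.ext fun k => by
        rw [PDO.coeff_dx, PDO.coeff_monomial, PDO.coeff_monomial]
        split_ifs
        · exact hq q b
        · exact map_zero _
    change (bareM K r μ).dx = _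
    by_cases h0 : μ = 0
    · subst h0
      rw [bareM_zero, if_pos rfl, hdx, K.deriv_x, Nat.cast_one, Nat.cast_one]
    · rw [if_neg h0]
      by_cases h : ∀ n, μ ≠ Finsupp.single n 1
      · rw [bareM_of_ne K r h0 h]
        exact PDO.ext fun k => map_zero _
      · push Not at h
        obtain ⟨k, rfl⟩ := h
        rw [bareM_single, hdx, Derivation.map_one_eq_zero, bareM_term_zero rfl]
  | n + 2 =>
    change (μ n + 1) • bareM K r (μ + Finsupp.single n 1) = _
    by_cases h0 : μ = 0
    · subst h0
      rw [if_pos rfl, zero_add, bareM_single, Finsupp.coe_zero, Pi.zero_apply, zero_add, one_smul]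
    · rw [if_neg h0, bareM_of_ne, smul_zero]
      · intro h
        have := DFunLike.congr_fun h n
        simp at this
      · intro k h
        refine h0 ?_
        have hd := congrArg Finsupp.degree h
        exact (Finsupp.degree_eq_zero_iff μ).1 (by simpa using hd)

/-- In other words `M⁽⁰⁾` commutes with `∂/∂t_l - Dˡ`. After dressing, the case `l = r` gives `[L,
M] = 1`, and general `l` gives the isospectral evolution of `M`. -/
lemma Dpow_mul_bareM {l : ℕ} (hl : 1 ≤ l) :
    Dpow l * bareM K r - bareM K r * Dpow l = dtOpHom l (bareM K r) := by
  obtain ⟨n, rfl⟩ := Nat.exists_eq_add_of_le' hl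
  have h1 : Dpow 1 * bareM K r - bareM K r * Dpow 1 = _ := (dtOpHom_one _).symm
  rw [dtOpHom_bareM K r le_rfl] at h1
  have hq : ∀ q : ℚ, (MvPowerSeries.C (PDO.monomial ((1 : ℕ) - (r : ℤ)) (q • (1 : B))) : Op B) =
      mulOp (MvPowerSeries.C (algebraMap ℚ B q)) * Dpow (1 - r) := fun q => by
    refine funext fun μ => ?_
    rw [Dpow, MvPowerSeries.mul_C_apply', mulOp_apply, MvPowerSeries.C_apply',
      MvPowerSeries.C_apply', Algebra.algebraMap_eq_smul_one]
    split_ifs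
    · rw [PDO.monomial_mul_Dpow, zero_add, Nat.cast_one]
    · rw [PDO.monomial_zero, zero_mul]
  -- `[D, M⁽⁰⁾] = (1/r) D^{1-r}` has constant coefficients and hence commutes with `D`, so `[Dˡ,
  -- M⁽⁰⁾]` is `l D^{l-1}` times it.
  have h2 := pow_mul_sub_mul_pow h1 (by
    rw [hq, mul_assoc, Dpow_mul_Dpow, ← mul_assoc, FunctionClass.Dpow_mul_mulOp_C, mul_assoc,
      Dpow_mul_Dpow, add_comm]) n
  rw [Dpow_natCast, h2, dtOpHom_bareM K r (by omega), hq, ← mul_assoc, ← Dpow_natCast,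
    FunctionClass.Dpow_mul_mulOp_C, mul_assoc, Dpow_mul_Dpow]
  refine funext fun μ => ?_
  change (n + 1) • (mulOp _ * Dpow _ : Op B) μ = _
  rw [Dpow, MvPowerSeries.mul_C_apply', mulOp_apply, MvPowerSeries.C_apply',
    MvPowerSeries.C_apply']
  split_ifs
  · rw [PDO.monomial_mul_Dpow, zero_add]
    refine (map_nsmul (PDO.monomialHom _) (n + 1) _).symm.trans ?_
    change PDO.monomial _ _ = _
    congr 1
    · push_cast; ring
    · rw [Algebra.algebraMap_eq_smul_one, ← smul_assoc]
      congr 1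
      rw [nsmul_eq_mul]
      push_cast
      ring
  · rw [PDO.monomial_zero, zero_mul, smul_zero]

lemma dualJet_base_bareM : (dualJet K).base (bareM K.dual r) = bareM K r := funext fun μ => by
  have key : ∀ (n : ℤ) (q : ℚ) (b : DualNumber B),
      (PDO.monomial n (q • b)).dualFst = PDO.monomial n (q • b.fst) := fun n q b =>
    PDO.ext fun k => by
      rw [PDO.coeff_dualFst, PDO.coeff_monomial, PDO.coeff_monomial]
      split_ifs <;> rfl
  change (bareM K.dual r μ).dualFst = _
  by_cases h0 : μ = 0
  · subst h0
    rw [bareM_zero, bareM_zero, key]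
    rfl
  · by_cases h : ∀ n, μ ≠ Finsupp.single n 1
    · rw [bareM_of_ne _ r h0 h, bareM_of_ne _ r h0 h]
      rfl
    · push Not at h
      obtain ⟨k, rfl⟩ := h
      rw [bareM_single, bareM_single, key]
      rfl

/-- `M⁽⁰⁾` does not depend on the data `W`, `Φ`, `Ψ`, so along `∂*_k` the operator `M` moves only by
dressing. -/
lemma dualJet_del_bareM : (dualJet K).del (bareM K.dual r) = 0 := funext fun μ => by
  have key : ∀ (n : ℤ) (q : ℚ) (b : DualNumber B), b.snd = 0 →
      (PDO.monomial n (q • b)).eps = 0 := fun n q b hb =>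
    PDO.ext fun k => by
      rw [PDO.coeff_eps, PDO.coeff_monomial]
      split_ifs
      · rw [TrivSqZeroExt.snd_smul, hb, smul_zero]; rfl
      · rfl
  change (bareM K.dual r μ).eps = 0
  by_cases h0 : μ = 0
  · subst h0
    rw [bareM_zero, key]
    rfl
  · by_cases h : ∀ n, μ ≠ Finsupp.single n 1
    · rw [bareM_of_ne _ r h0 h]
      rfl
    · push Not at h
      obtain ⟨k, rfl⟩ := h
      rw [bareM_single, key]
      rfl

end BareM

/-! ### Operators attached to data of the right classes -/

section Regular
variable {B : Type u} [CommRing B] [Algebra ℚ B] [Differential B] {m : ℕ}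

/-- Data of the right classes, without the equations of the hierarchy. -/
structure State.Regular (K : FunctionClass B) (s : State B m) : Prop where
  plusPart_W : plusPart s.W = 1
  W_mem : s.W ∈ K.coeffOps
  Φ_mem : ∀ i, s.Φ i ∈ K.EigFn
  Ψ_mem : ∀ i, s.Ψ i ∈ K.AdjFn

lemma IsCKP.regular {K : FunctionClass B} {r : ℕ} {s : State B m} (hs : IsCKP K r s) :
    s.Regular K where
  plusPart_W := hs.plusPart_W
  W_mem := hs.W_mem
  Φ_mem := hs.Φ_mem
  Ψ_mem := hs.Ψ_mem

namespace State.Regular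
variable {K : FunctionClass B} {s : State B m} (h : s.Regular K) (r : ℕ)
include h

/-- `Ring.inverse` is meaningful only on units; here it is identified with the Neumann series, which
also controls its order and coefficients. -/
lemma inverse_spec : s.W * Ring.inverse s.W = 1 ∧ Ring.inverse s.W * s.W = 1 ∧
    plusPart (Ring.inverse s.W) = 1 ∧ Ring.inverse s.W ∈ K.coeffOps := by
  obtain ⟨V, h1, h2, h3, h4⟩ := exists_inverse h.plusPart_W
  have hu : Ring.inverse s.W = V := Ring.inverse_unit ⟨s.W, V, h1, h2⟩
  rw [hu]
  exact ⟨h1, h2, h3, h4 _ K.coeffGroup_stable K.one_mem_coeffGroup K.coeff_mul_coeff h.W_mem⟩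

lemma W_mul_inverse : s.W * Ring.inverse s.W = 1 := h.inverse_spec.1

lemma inverse_mul_W : Ring.inverse s.W * s.W = 1 := h.inverse_spec.2.1

lemma conj_mul (X Y : Op B) : s.W * X * Ring.inverse s.W * (s.W * Y * Ring.inverse s.W) =
    s.W * (X * Y) * Ring.inverse s.W := by
  have e : s.W * X * Ring.inverse s.W * (s.W * Y * Ring.inverse s.W) =
      s.W * X * (Ring.inverse s.W * s.W) * Y * Ring.inverse s.W := by noncomm_ring
  rw [e, h.inverse_mul_W]
  noncomm_ring

lemma W_mem_ordLE : s.W ∈ ordLE B 0 := by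
  rw [← plusPart_add_minusPart s.W, h.plusPart_W, ← mulOp_one]
  exact add_mem (mulOp_mem_ordLE 1) (ordLE_mono (by omega) (minusPart_mem _))

lemma inverse_mem_ordLE : Ring.inverse s.W ∈ ordLE B 0 := by
  rw [← plusPart_add_minusPart (Ring.inverse s.W), h.inverse_spec.2.2.1, ← mulOp_one]
  exact add_mem (mulOp_mem_ordLE 1) (ordLE_mono (by omega) (minusPart_mem _))

/-- The commutator of `L` with an operator of negative order has order at most `r - 2`. -/
lemma commutator_lax_mem {A : Op B} (hA : A ∈ ordLE B (-1)) :
    A * lax r s - lax r s * A ∈ ordLE B (r - 2) := by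
  have hA' : Ring.inverse s.W * A * s.W ∈ ordLE B (-1) := by
    have := ordLE_mul (ordLE_mul h.inverse_mem_ordLE hA) h.W_mem_ordLE
    exact ordLE_mono (by omega) this
  -- Undressing by `W`, which has order zero together with its inverse, replaces `L` by `Dʳ`.
  have e : A * lax r s - lax r s * A = -(s.W * (Dpow r * (Ring.inverse s.W * A * s.W) -
      Ring.inverse s.W * A * s.W * Dpow r) * Ring.inverse s.W) := by
    have e1 : s.W * (Dpow r * (Ring.inverse s.W * A * s.W) -
        Ring.inverse s.W * A * s.W * Dpow r) * Ring.inverse s.W =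
        s.W * Dpow r * Ring.inverse s.W * A * (s.W * Ring.inverse s.W) -
          (s.W * Ring.inverse s.W) * A * (s.W * Dpow r * Ring.inverse s.W) := by
      noncomm_ring
    rw [e1, h.W_mul_inverse, lax, dressedPow]
    noncomm_ring
  rw [e]
  exact neg_mem (ordLE_mono (by omega)
    (ordLE_mul (ordLE_mul h.W_mem_ordLE (Dpow_commutator_mem hA' r)) h.inverse_mem_ordLE))

lemma dressedPow_mem (l : ℕ) : dressedPow l s ∈ K.coeffOps :=
  mul_mem (mul_mem h.W_mem (Dpow_mem_coeffsIn K.one_mem_coeffGroup l)) h.inverse_spec.2.2.2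

lemma lax_mem : lax r s ∈ K.coeffOps := h.dressedPow_mem r

lemma opM_mem : opM K r s ∈ K.coeffOps :=
  mul_mem (mul_mem h.W_mem (bareM_mem K r)) h.inverse_spec.2.2.2

lemma dressedPow_comm (l n : ℕ) :
    dressedPow l s * dressedPow n s = dressedPow n s * dressedPow l s := by
  rw [dressedPow, dressedPow, h.conj_mul, h.conj_mul, Dpow_mul_Dpow, Dpow_mul_Dpow, add_comm]

lemma dressedPow_mul_opM {l : ℕ} (hl : 1 ≤ l) :
    dressedPow l s * opM K r s - opM K r s * dressedPow l s =
      s.W * dtOpHom l (bareM K r) * Ring.inverse s.W := by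
  rw [dressedPow, opM, h.conj_mul, h.conj_mul, ← sub_mul, ← mul_sub, Dpow_mul_bareM K r hl]

/-- The canonical commutation relation `[L, M] = 1`. -/
lemma lax_mul_opM (hr : 1 ≤ r) : lax r s * opM K r s = opM K r s * lax r s + 1 := by
  rw [← sub_eq_iff_eq_add', lax, h.dressedPow_mul_opM r hr, dtOpHom_bareM K r hr, sub_self,
    div_self (by exact_mod_cast (by omega : r ≠ 0)), one_smul]
  have : (MvPowerSeries.C (PDO.monomial 0 1) : Op B) = 1 := Dpow_zero
  rw [this, mul_one, h.W_mul_inverse]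

lemma lax_pow_mul_opM (hr : 1 ≤ r) (n : ℕ) :
    lax r s ^ n * opM K r s = opM K r s * lax r s ^ n + n • lax r s ^ (n - 1) := by
  induction n with
  | zero => simp
  | succ n ih =>
    rw [pow_succ', mul_assoc, ih, mul_add, ← mul_assoc, h.lax_mul_opM r hr, mul_smul_comm,
      ← pow_succ', Nat.add_sub_cancel]
    cases n with
    | zero => simp
    | succ n =>
      rw [Nat.add_sub_cancel, add_mul, one_mul, mul_assoc, ← pow_succ', add_assoc,
        succ_nsmul' (lax r s ^ (n + 1)) (n + 1)]

end State.Regular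

namespace State.Regular
variable {K : FunctionClass B} {s : State B m} (h : s.Regular K) (r : ℕ)

/-- `Φᵢ` as an eigenfunction. -/
def φ (i : Fin m) : K.EigFn := ⟨s.Φ i, h.Φ_mem i⟩

/-- `Ψᵢ` as an adjoint eigenfunction. -/
def ψ (i : Fin m) : K.AdjFn := ⟨s.Ψ i, h.Ψ_mem i⟩

/-- The differential part of `L`. -/
noncomputable def laxPlus : K.diffOps :=
  ⟨plusPart (lax r s), FunctionClass.plusPart_mem_diffOps (h.lax_mem r)⟩

/-- The differential part of `L^{l/r}`. -/
noncomputable def powPlus (l : ℕ) : K.diffOps :=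
  ⟨plusPart (dressedPow l s), FunctionClass.plusPart_mem_diffOps (h.dressedPow_mem l)⟩

/-- The differential part of `M Lᵏ`. -/
noncomputable def momPlus (k : ℕ) : K.diffOps :=
  ⟨plusPart (opM K r s * lax r s ^ k), FunctionClass.plusPart_mem_diffOps
    (mul_mem (h.opM_mem r) (pow_mem (h.lax_mem r) k))⟩

/-- The kernel `∑ᵢ Φᵢ ⊗ Ψᵢ` of `L₋`. -/
noncomputable def laxKernel : K.EigFn ⊗[ℚ] K.AdjFn := ∑ i, h.φ i ⊗ₜ h.ψ i

/-- `L₊ + ∑ᵢ Φᵢ D⁻¹ Ψᵢ` together with its actions. -/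
noncomputable def laxAct : K.ActOps := K.diff (h.laxPlus r) + K.ofKernel h.laxKernel

/-- `L^a(Φᵢ)`. -/
noncomputable def φPow (a : ℕ) (i : Fin m) : K.EigFn := (h.laxAct r ^ a).eig (h.φ i)

/-- `(L*)^a(Ψᵢ)`. -/
noncomputable def ψPow (a : ℕ) (i : Fin m) : K.AdjFn := (h.laxAct r ^ a).adj (h.ψ i)

/-- The kernel of `Y_k`. -/
noncomputable def ghostKernel (k : ℕ) : K.EigFn ⊗[ℚ] K.AdjFn :=
  ∑ i, ∑ j ∈ Finset.range (k - 1),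
    ghostCoeff k j • (h.φPow r (k - 2 - j) i ⊗ₜ[ℚ] h.ψPow r j i)

/-- `(M Lᵏ)₊ + Y_k` together with its actions. -/
noncomputable def genAct (k : ℕ) : K.ActOps :=
  K.diff (h.momPlus r k) + K.ofKernel (h.ghostKernel r k)

lemma φPow_zero (i : Fin m) : h.φPow r 0 i = h.φ i := by
  rw [φPow, pow_zero, map_one, Module.End.one_apply]

lemma ψPow_zero (i : Fin m) : h.ψPow r 0 i = h.ψ i := rfl

lemma φPow_succ (a : ℕ) (i : Fin m) :
    h.φPow r (a + 1) i = (h.laxAct r).eig (h.φPow r a i) := by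
  rw [φPow, pow_succ', map_mul, Module.End.mul_apply, φPow]

lemma ψPow_succ (a : ℕ) (i : Fin m) :
    h.ψPow r (a + 1) i = (h.laxAct r).adj (h.ψPow r a i) := by
  rw [ψPow, pow_succ, FunctionClass.ActOps.adj_mul, Module.End.mul_apply, ψPow]

lemma coe_ofKernel_sum_eig {ι : Type*} (t : Finset ι) (T : ι → K.EigFn ⊗[ℚ] K.AdjFn)
    (f : K.EigFn) : ((K.ofKernel (∑ i ∈ t, T i)).eig f : Fn B) =
      ∑ i ∈ t, ((K.ofKernel (T i)).eig f : Fn B) := by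
  rw [map_sum, map_sum, LinearMap.sum_apply, Submodule.coe_sum]

lemma coe_ofKernel_sum_adj {ι : Type*} (t : Finset ι) (T : ι → K.EigFn ⊗[ℚ] K.AdjFn)
    (f : K.AdjFn) : ((K.ofKernel (∑ i ∈ t, T i)).adj f : Fn B) =
      ∑ i ∈ t, ((K.ofKernel (T i)).adj f : Fn B) := by
  classical
  induction t using Finset.induction_on with
  | empty => rw [Finset.sum_empty, Finset.sum_empty, map_zero]; rfl
  | insert a t ha ih =>
    rw [Finset.sum_insert ha, Finset.sum_insert ha, map_add, FunctionClass.ActOps.coe_adj_add, ih]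

/-- This lemma and the ones up to `op_genAct` identify the symbols and actions in `ActOps` with the
explicit expressions for `L(f)`, `L*(g)`, `Y_k`, `Y_k(f)` and `Y_k*(g)`. -/
lemma coe_laxAct_eig (f : K.EigFn) : ((h.laxAct r).eig f : Fn B) = applyL K r s f := by
  rw [laxAct, FunctionClass.ActOps.coe_eig_add, FunctionClass.coe_diff_eig, laxKernel,
    coe_ofKernel_sum_eig]
  rfl

lemma coe_laxAct_adj (g : K.AdjFn) : ((h.laxAct r).adj g : Fn B) = applyLadj K r s g := by
  rw [laxAct, FunctionClass.ActOps.coe_adj_add, FunctionClass.coe_diff_adj, laxKernel,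
    coe_ofKernel_sum_adj, applyLadj, sub_eq_add_neg, ← Finset.sum_neg_distrib]
  rfl

lemma coe_φPow (a : ℕ) (i : Fin m) : (h.φPow r a i : Fn B) = eigPow K r s a i := by
  induction a with
  | zero => rw [φPow_zero]; rfl
  | succ a ih => rw [φPow_succ, coe_laxAct_eig, ih, eigPow, eigPow, Function.iterate_succ_apply']

lemma coe_ψPow (a : ℕ) (i : Fin m) : (h.ψPow r a i : Fn B) = adjPow K r s a i := by
  induction a with
  | zero => rfl
  | succ a ih => rw [ψPow_succ, coe_laxAct_adj, ih, adjPow, adjPow, Function.iterate_succ_apply']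

lemma coe_smul_eig (q : ℚ) (f : K.EigFn) : ((q • f : K.EigFn) : Fn B) = q • (f : Fn B) := rfl

lemma op_ghostKernel (k : ℕ) : (K.ofKernel (h.ghostKernel r k)).op = ghostY K r k s := by
  rw [ghostKernel, ghostY, map_sum, map_sum]
  refine Finset.sum_congr rfl fun i _ => ?_
  rw [map_sum, map_sum]
  refine Finset.sum_congr rfl fun j _ => ?_
  rw [TensorProduct.smul_tmul', FunctionClass.ofKernel_tmul, FunctionClass.op_pair, coe_smul_eig,
    coe_φPow, coe_ψPow]

lemma coe_ghostKernel_eig (k : ℕ) (f : K.EigFn) :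
    ((K.ofKernel (h.ghostKernel r k)).eig f : Fn B) = applyY K r k s f := by
  rw [ghostKernel, applyY, coe_ofKernel_sum_eig]
  refine Finset.sum_congr rfl fun i _ => ?_
  rw [coe_ofKernel_sum_eig]
  refine Finset.sum_congr rfl fun j _ => ?_
  rw [TensorProduct.smul_tmul', FunctionClass.ofKernel_tmul, FunctionClass.coe_pair_eig,
    coe_smul_eig, coe_φPow, coe_ψPow, smul_mul_assoc]

lemma coe_ghostKernel_adj (k : ℕ) (g : K.AdjFn) :
    ((K.ofKernel (h.ghostKernel r k)).adj g : Fn B) = applyYadj K r k s g := by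
  rw [ghostKernel, applyYadj, coe_ofKernel_sum_adj, ← Finset.sum_neg_distrib]
  refine Finset.sum_congr rfl fun i _ => ?_
  rw [coe_ofKernel_sum_adj, ← Finset.sum_neg_distrib]
  refine Finset.sum_congr rfl fun j _ => ?_
  rw [← TensorProduct.tmul_smul, FunctionClass.ofKernel_tmul, FunctionClass.coe_pair_adj,
    Submodule.coe_smul, coe_φPow, coe_ψPow, smul_mul_assoc]

lemma op_genAct (k : ℕ) :
    (h.genAct r k).op = plusPart (opM K r s * lax r s ^ k) + ghostY K r k s := by
  rw [genAct, map_add, op_ghostKernel]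
  rfl

/-- The decomposition `A_k = G_k + M Lᵏ`: commutators of the second summand are known from `[L, M] =
1`, while the first has negative order and drops out of differential parts. -/
lemma op_genAct_eq (k : ℕ) :
    (h.genAct r k).op = starGen K r k s + opM K r s * lax r s ^ k := by
  rw [op_genAct, starGen, minusPart_eq]
  abel

include h in
lemma starGen_mem_ordLE (k : ℕ) : starGen K r k s ∈ ordLE B (-1) := by
  rw [starGen, ← h.op_ghostKernel]
  exact add_mem (neg_mem (minusPart_mem _)) (FunctionClass.op_ofKernel_mem _)

include h in
lemma starGen_mem_coeffOps (k : ℕ) : starGen K r k s ∈ K.coeffOps := by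
  rw [starGen, ← h.op_ghostKernel]
  exact add_mem (neg_mem (minusPart_mem_coeffsIn
    (mul_mem (h.opM_mem r) (pow_mem (h.lax_mem r) k) : _ ∈ K.coeffOps)))
    (FunctionClass.op_ofKernel_mem_coeffOps _)

/-- `∂*_k Φᵢ`. -/
noncomputable def starφ (k : ℕ) (i : Fin m) : K.EigFn :=
  (h.genAct r k).eig (h.φ i) + ((k : ℚ) / 2) • h.φPow r (k - 1) i

/-- `∂*_k Ψᵢ`. -/
noncomputable def starψ (k : ℕ) (i : Fin m) : K.AdjFn :=
  -(h.genAct r k).adj (h.ψ i) + ((k : ℚ) / 2) • h.ψPow r (k - 1) i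

lemma coe_starφ (k : ℕ) (i : Fin m) : (h.starφ r k i : Fn B) = (starFlow K r k s).Φ i := by
  change ((h.genAct r k).eig (h.φ i) : Fn B) + ((k : ℚ) / 2) • (h.φPow r (k - 1) i : Fn B) = _
  rw [genAct, FunctionClass.ActOps.coe_eig_add, coe_ghostKernel_eig, FunctionClass.coe_diff_eig,
    coe_φPow, add_right_comm]
  rfl

lemma coe_starψ (k : ℕ) (i : Fin m) : (h.starψ r k i : Fn B) = (starFlow K r k s).Ψ i := by
  change -((h.genAct r k).adj (h.ψ i) : Fn B) + ((k : ℚ) / 2) • (h.ψPow r (k - 1) i : Fn B) = _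
  rw [genAct, FunctionClass.ActOps.coe_adj_add, coe_ghostKernel_adj, FunctionClass.coe_diff_adj,
    coe_ψPow, neg_add, add_right_comm, ← sub_eq_add_neg]
  rfl

end State.Regular

end Regular

/-! ### Identities for the coefficients of `Y_k` -/

section Sums
variable {V : Type*} [AddCommGroup V] [Module ℚ V]

/-- Summation by parts. The coefficients increase by one, which cancels the plain sum up to boundary
terms, and the centring at `(k - 2)/2` makes the two boundary terms equal to `k/2`. -/
lemma sum_ghostCoeff_smul_sub (k : ℕ) (f : ℕ → V) :
    ∑ j ∈ Finset.range (k - 1), ghostCoeff k j • (f (j + 1) - f j) +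
      ∑ j ∈ Finset.range k, f j = ((k : ℚ) / 2) • (f 0 + f (k - 1)) := by
  -- A free offset `α` lets the induction run; for `k = n + 1` the value `α = (n - 1)/2` gives `n -
  -- α = 1 + α = k/2`.
  have key : ∀ (n : ℕ) (α : ℚ), ∑ j ∈ Finset.range n, ((j : ℚ) - α) • (f (j + 1) - f j) =
      ((n : ℚ) - α) • f n + (1 + α) • f 0 - ∑ j ∈ Finset.range (n + 1), f j := by
    intro n α
    induction n with
    | zero => simp; module
    | succ n ih =>
      rw [Finset.sum_range_succ, ih, Finset.sum_range_succ _ (n + 1)]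
      push_cast
      module
  cases k with
  | zero => simp
  | succ n =>
    have h : ∀ j, ghostCoeff (n + 1) j = (j : ℚ) - ((n : ℚ) - 1) / 2 := fun j => by
      rw [ghostCoeff]; push_cast; ring
    simp only [h, Nat.add_sub_cancel]
    rw [key]
    push_cast
    module

/-- The part of `∂*_l Y_k` that does not come from the action of the generator. -/
def ghostShift (e : ℕ → ℕ → V) (l k : ℕ) : V :=
  ∑ j ∈ Finset.range (k - 1), ghostCoeff k j •
    ((((k - 2 - j : ℕ) : ℚ) + (l : ℚ) / 2) • e (k - 2 - j + l - 1) j +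
      ((j : ℚ) + (l : ℚ) / 2) • e (k - 2 - j) (j + l - 1))

/-- The case `l = 0` is separate because the indices `k - 2 - j - 1` and `j - 1` may be truncated;
exactly then their coefficients vanish. -/
lemma ghostShift_zero (e : ℕ → ℕ → V) (k : ℕ) :
    ghostShift e 0 k - ghostShift e k 0 =
      (k : ℤ) • ∑ j ∈ Finset.range (k - 1 - 1), ghostCoeff (k - 1) j • e (k - 1 - 2 - j) j := by
  have h0 : ghostShift e k 0 = 0 := by simp [ghostShift]
  rw [h0, sub_zero]
  match k with
  | 0 => simp [ghostShift]
  | 1 => simp [ghostShift]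
  | q + 2 =>
    have h1 : ghostShift e 0 (q + 2) =
        ∑ j ∈ Finset.range (q + 1), (((j : ℚ) - q / 2) * (q - j)) • e (q - j - 1) j +
          ∑ j ∈ Finset.range (q + 1), (((j : ℚ) - q / 2) * j) • e (q - j) (j - 1) := by
      rw [ghostShift, ← Finset.sum_add_distrib]
      refine Finset.sum_congr rfl fun j hj => ?_
      have hj : j ≤ q := by simpa [Nat.lt_succ_iff] using hj
      rw [ghostCoeff, show q + 2 - 2 - j = q - j by omega, Nat.cast_sub hj]
      push_cast
      simp only [add_zero]
      module
    rw [h1, Finset.sum_range_succ, Finset.sum_range_succ']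
    simp only [sub_self, mul_zero, zero_smul, add_zero, Nat.cast_zero, Nat.add_sub_cancel]
    rw [← Finset.sum_add_distrib, Finset.smul_sum, show q + 2 - 1 - 1 = q by omega]
    refine Finset.sum_congr rfl fun j hj => ?_
    have hj := Finset.mem_range.1 hj
    rw [show q - (j + 1) = q - j - 1 by omega, show q + 2 - 1 - 2 - j = q - j - 1 by omega,
      ghostCoeff, show q + 2 - 1 = q + 1 by omega]
    push_cast
    module

/-- The Virasoro relation for the coefficients of `Y_k`. -/
lemma ghostShift_sub (e : ℕ → ℕ → V) (l k : ℕ) :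
    ghostShift e l k - ghostShift e k l = ((k : ℤ) - l) •
      ∑ j ∈ Finset.range (k + l - 1 - 1),
        ghostCoeff (k + l - 1) j • e (k + l - 1 - 2 - j) j := by
  rcases Nat.eq_zero_or_pos l with rfl | hl
  · simpa using ghostShift_zero e k
  rcases Nat.eq_zero_or_pos k with rfl | hk
  · have h := ghostShift_zero e l
    rw [← neg_sub, h, zero_add, Nat.cast_zero, zero_sub, neg_smul]
  obtain ⟨l, rfl⟩ := Nat.exists_eq_add_of_le' hl
  obtain ⟨k, rfl⟩ := Nat.exists_eq_add_of_le' hk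
  let g : ℕ → V := fun p => e (k + l - 1 - p) p
  -- With `k` and `l` lowered by one, all terms lie on the antidiagonal of `g`. The second half of
  -- `ghostShift` occupies the range shifted by `l`, and its coefficient there is `-α l k`.
  let α : ℕ → ℕ → ℕ → ℚ := fun k l p => ((p : ℚ) - ((k : ℚ) - 1) / 2) * (k - 1 - p + (l + 1) / 2)
  have key : ∀ k l : ℕ, ghostShift e (l + 1) (k + 1) =
      ∑ p ∈ Finset.range k, α k l p • e (k + l - 1 - p) p -
        ∑ j ∈ Finset.range k, α l k (l + j) • e (k + l - 1 - (l + j)) (l + j) := by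
    intro k l
    rw [ghostShift, ← Finset.sum_sub_distrib, Nat.add_sub_cancel]
    refine Finset.sum_congr rfl fun j hj => ?_
    have hj := Finset.mem_range.1 hj
    have h1 : ((k + 1 - 2 - j : ℕ) : ℚ) = k - 1 - j := by
      rw [show k + 1 - 2 - j = k - 1 - j by omega, Nat.cast_sub (by omega),
        Nat.cast_sub (by omega), Nat.cast_one]
    rw [h1, show k + 1 - 2 - j + (l + 1) - 1 = k + l - 1 - j by omega,
      show k + l - 1 - (l + j) = k + 1 - 2 - j by omega, show j + (l + 1) - 1 = l + j by omega,
      ghostCoeff]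
    simp only [α]
    push_cast
    module
  have h2 : ghostShift e (k + 1) (l + 1) =
      ∑ p ∈ Finset.range l, α l k p • g p - ∑ j ∈ Finset.range l, α k l (k + j) • g (k + j) := by
    rw [key l k, add_comm l k]
  rw [h2, key k l]
  -- The pieces of the two shifts with the same coefficient function join to full sums over `range
  -- (k + l)`; then `α k l p - α l k p = (k - l)(p - (k + l - 1)/2)`.
  have h3 := Finset.sum_range_add (fun p => α k l p • g p) k l
  have h4 := Finset.sum_range_add (fun p => α l k p • g p) l k
  rw [add_comm l k] at h4
  have h5 : ∑ p ∈ Finset.range (k + l), α k l p • g p -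
      ∑ p ∈ Finset.range (k + l), α l k p • g p = ((k + 1 : ℕ) - (l + 1 : ℕ) : ℤ) •
        ∑ j ∈ Finset.range (k + 1 + (l + 1) - 1 - 1),
          ghostCoeff (k + 1 + (l + 1) - 1) j • e (k + 1 + (l + 1) - 1 - 2 - j) j := by
    rw [← Finset.sum_sub_distrib, show k + 1 + (l + 1) - 1 - 1 = k + l by omega, Finset.smul_sum]
    refine Finset.sum_congr rfl fun p _ => ?_
    rw [show k + 1 + (l + 1) - 1 - 2 - p = k + l - 1 - p by omega, ghostCoeff,
      show k + 1 + (l + 1) - 1 = k + l + 1 by omega]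
    simp only [α, g]
    rw [← Int.cast_smul_eq_zsmul ℚ]
    push_cast
    module
  rw [← h5, h3, h4]
  abel

end Sums

/-! ### Variation of dressed operators and of the kernels -/

section Evolution
variable {B' B : Type u} [CommRing B'] [Algebra ℚ B'] [Differential B']
  [CommRing B] [Algebra ℚ B] [Differential B] {m : ℕ}
  {K' : FunctionClass B'} {K : FunctionClass B}

namespace Jet
variable (j : Jet K' K)

/-- The variation of `X'` is the commutator with `Z`. -/
def Evolves (Z : Op B) (X' : Op B') : Prop := j.del X' = Z * j.base X' - j.base X' * Z

variable {j}

lemma Evolves.mul {Z : Op B} {X' Y' : Op B'} (hX : j.Evolves Z X') (hY : j.Evolves Z Y') :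
    j.Evolves Z (X' * Y') := by
  rw [Evolves, j.del_mul, hX, hY, map_mul]
  noncomm_ring

lemma Evolves.pow {Z : Op B} {X' : Op B'} (hX : j.Evolves Z X') (n : ℕ) :
    j.Evolves Z (X' ^ n) := by
  induction n with
  | zero => rw [pow_zero, Evolves, j.del_one, map_one, mul_one, one_mul, sub_self]
  | succ n ih => rw [pow_succ]; exact ih.mul hX

variable (j)

/-- The data `s'` have base value `s` and variation `v`. -/
structure Moves (s' : State B' m) (s v : State B m) : Prop where
  base_W : j.base s'.W = s.W
  del_W : j.del s'.W = v.W
  base_Φ : ∀ i, j.baseFn (s'.Φ i) = s.Φ i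
  del_Φ : ∀ i, j.delFn (s'.Φ i) = v.Φ i
  base_Ψ : ∀ i, j.baseFn (s'.Ψ i) = s.Ψ i
  del_Ψ : ∀ i, j.delFn (s'.Ψ i) = v.Ψ i

variable {j} {s' : State B' m} {s v : State B m}

namespace Moves

lemma base_inverse (hm : j.Moves s' s v) (h' : s'.Regular K') (h : s.Regular K) :
    j.base (Ring.inverse s'.W) = Ring.inverse s.W := by
  have h1 := congrArg j.base h'.W_mul_inverse
  rw [map_mul, map_one, hm.base_W] at h1
  rw [← one_mul (j.base _), ← h.inverse_mul_W, mul_assoc, h1, mul_one]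

lemma base_conj (hm : j.Moves s' s v) (h' : s'.Regular K') (h : s.Regular K) (X : Op B') :
    j.base (s'.W * X * Ring.inverse s'.W) = s.W * j.base X * Ring.inverse s.W := by
  rw [map_mul, map_mul, hm.base_W, hm.base_inverse h' h]

/-- Differentiating `W W⁻¹ = 1` turns `δW = A W` into `δ(W⁻¹) = -W⁻¹ A`. The last term is the
variation of the undressed operator, needed for the explicit times in `M⁽⁰⁾`. -/
lemma del_conj (hm : j.Moves s' s v) (h' : s'.Regular K') (h : s.Regular K) {A : Op B}
    (hA : v.W = A * s.W) (X : Op B') :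
    j.del (s'.W * X * Ring.inverse s'.W) =
      A * (s.W * j.base X * Ring.inverse s.W) - s.W * j.base X * Ring.inverse s.W * A +
        s.W * j.del X * Ring.inverse s.W := by
  have h1 := congrArg j.del h'.W_mul_inverse
  rw [j.del_mul, hm.del_W, hm.base_W, hm.base_inverse h' h, hA, j.del_one, mul_assoc,
    h.W_mul_inverse, mul_one] at h1
  have h2 : j.del (Ring.inverse s'.W) = -(Ring.inverse s.W * A) := by
    rw [← one_mul (j.del _), ← h.inverse_mul_W, mul_assoc, eq_neg_of_add_eq_zero_right h1, mul_neg]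
  rw [j.del_mul, j.del_mul, hm.del_W, hm.base_W, hm.base_inverse h' h, h2, hA, map_mul,
    hm.base_W]
  noncomm_ring

lemma base_dressedPow (hm : j.Moves s' s v) (h' : s'.Regular K') (h : s.Regular K) (l : ℕ) :
    j.base (dressedPow l s') = dressedPow l s := by
  rw [dressedPow, hm.base_conj h' h, j.base_Dpow, dressedPow]

lemma evolves_dressedPow (hm : j.Moves s' s v) (h' : s'.Regular K') (h : s.Regular K) {A : Op B}
    (hA : v.W = A * s.W) (l : ℕ) : j.Evolves A (dressedPow l s') := by
  rw [Evolves, hm.base_dressedPow h' h, dressedPow, hm.del_conj h' h hA, j.base_Dpow, j.del_Dpow,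
    mul_zero, zero_mul, add_zero, dressedPow]

lemma baseE_φ (hm : j.Moves s' s v) (h' : s'.Regular K') (h : s.Regular K) (i : Fin m) :
    j.baseE (h'.φ i) = h.φ i := Subtype.ext (hm.base_Φ i)

lemma baseA_ψ (hm : j.Moves s' s v) (h' : s'.Regular K') (h : s.Regular K) (i : Fin m) :
    j.baseA (h'.ψ i) = h.ψ i := Subtype.ext (hm.base_Ψ i)

lemma baseT_laxKernel (hm : j.Moves s' s v) (h' : s'.Regular K') (h : s.Regular K) :
    j.baseT h'.laxKernel = h.laxKernel := by
  rw [State.Regular.laxKernel, map_sum]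
  simp only [j.baseT_tmul, hm.baseE_φ h' h, hm.baseA_ψ h' h]
  rfl

lemma delT_laxKernel (hm : j.Moves s' s v) (h' : s'.Regular K') (h : s.Regular K) :
    j.delT h'.laxKernel =
      ∑ i, (j.delE (h'.φ i) ⊗ₜ h.ψ i + h.φ i ⊗ₜ j.delA (h'.ψ i)) := by
  rw [State.Regular.laxKernel, map_sum]
  simp only [j.delT_tmul, hm.baseE_φ h' h, hm.baseA_ψ h' h]

lemma varies_laxAct (hm : j.Moves s' s v) (h' : s'.Regular K') (h : s.Regular K) (r : ℕ) :
    j.Varies (h'.laxAct r) (h.laxAct r)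
      (K.diff (j.delD (h'.laxPlus r)) + K.ofKernel (j.delT h'.laxKernel)) := by
  have h1 := varies_mk (j := j) (h'.laxPlus r) h'.laxKernel
  have h2 : j.baseD (h'.laxPlus r) = h.laxPlus r := Subtype.ext <| by
    change j.base (plusPart (lax r s')) = plusPart (lax r s)
    rw [j.base_plusPart, lax, hm.base_dressedPow h' h, lax]
  rwa [h2, hm.baseT_laxKernel h' h] at h1

lemma baseE_φPow (hm : j.Moves s' s v) (h' : s'.Regular K') (h : s.Regular K) (r a : ℕ)
    (i : Fin m) : j.baseE (h'.φPow r a i) = h.φPow r a i := by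
  induction a with
  | zero => rw [h'.φPow_zero, h.φPow_zero, hm.baseE_φ h' h]
  | succ a ih => rw [h'.φPow_succ, h.φPow_succ, (hm.varies_laxAct h' h r).base_eig, ih]

lemma baseA_ψPow (hm : j.Moves s' s v) (h' : s'.Regular K') (h : s.Regular K) (r a : ℕ)
    (i : Fin m) : j.baseA (h'.ψPow r a i) = h.ψPow r a i := by
  induction a with
  | zero => rw [h'.ψPow_zero, h.ψPow_zero, hm.baseA_ψ h' h]
  | succ a ih => rw [h'.ψPow_succ, h.ψPow_succ, (hm.varies_laxAct h' h r).base_adj, ih]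

lemma baseT_ghostKernel (hm : j.Moves s' s v) (h' : s'.Regular K') (h : s.Regular K) (r k : ℕ) :
    j.baseT (h'.ghostKernel r k) = h.ghostKernel r k := by
  simp only [State.Regular.ghostKernel, map_sum, map_smul, j.baseT_tmul, hm.baseE_φPow h' h,
    hm.baseA_ψPow h' h]

lemma delT_ghostKernel (hm : j.Moves s' s v) (h' : s'.Regular K') (h : s.Regular K) (r k : ℕ) :
    j.delT (h'.ghostKernel r k) = ∑ i, ∑ n ∈ Finset.range (k - 1), ghostCoeff k n •
      (j.delE (h'.φPow r (k - 2 - n) i) ⊗ₜ[ℚ] h.ψPow r n i +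
        h.φPow r (k - 2 - n) i ⊗ₜ[ℚ] j.delA (h'.ψPow r n i)) := by
  simp only [State.Regular.ghostKernel, map_sum, map_smul, j.delT_tmul, hm.baseE_φPow h' h,
    hm.baseA_ψPow h' h]

/-- The base value of `M`, given the one of `M⁽⁰⁾`. -/
lemma base_opM (hm : j.Moves s' s v) (h' : s'.Regular K') (h : s.Regular K) {r : ℕ}
    (hM : j.base (bareM K' r) = bareM K r) : j.base (opM K' r s') = opM K r s := by
  rw [opM, hm.base_conj h' h, hM, opM]

lemma varies_genAct (hm : j.Moves s' s v) (h' : s'.Regular K') (h : s.Regular K) {r : ℕ}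
    (hM : j.base (bareM K' r) = bareM K r) (k : ℕ) :
    j.Varies (h'.genAct r k) (h.genAct r k)
      (K.diff (j.delD (h'.momPlus r k)) + K.ofKernel (j.delT (h'.ghostKernel r k))) := by
  have h1 := varies_mk (j := j) (h'.momPlus r k) (h'.ghostKernel r k)
  have h2 : j.baseD (h'.momPlus r k) = h.momPlus r k := Subtype.ext <| by
    change j.base (plusPart (opM K' r s' * lax r s' ^ k)) = plusPart (opM K r s * lax r s ^ k)
    rw [j.base_plusPart, map_mul, map_pow, hm.base_opM h' h hM, lax, hm.base_dressedPow h' h, lax]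
  rwa [h2, hm.baseT_ghostKernel h' h] at h1

end Moves
end Jet
end Evolution

/-! ### Kernels of powers of `L` and of commutators -/

section Kernels
variable {B : Type u} [CommRing B] [Algebra ℚ B] [Differential B] {m : ℕ}
  {K : FunctionClass B} {s : State B m}

namespace State.Regular
variable (h : s.Regular K) (r : ℕ)

/-- The kernel `∑ᵢ L^a(Φᵢ) ⊗ (L*)^b(Ψᵢ)`. -/
noncomputable def kern (a b : ℕ) : K.EigFn ⊗[ℚ] K.AdjFn := ∑ i, h.φPow r a i ⊗ₜ h.ψPow r b i

lemma rTensor_kern (a b : ℕ) :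
    (h.laxAct r).eig.rTensor K.AdjFn (h.kern r a b) = h.kern r (a + 1) b := by
  simp only [kern, map_sum, LinearMap.rTensor_tmul, φPow_succ]

lemma lTensor_kern (a b : ℕ) :
    (h.laxAct r).adj.lTensor K.EigFn (h.kern r a b) = h.kern r a (b + 1) := by
  simp only [kern, map_sum, LinearMap.lTensor_tmul, ψPow_succ]

lemma pow_rTensor_laxKernel (a : ℕ) :
    (h.laxAct r ^ a).eig.rTensor K.AdjFn h.laxKernel = h.kern r a 0 := by
  simp only [kern, laxKernel, map_sum, LinearMap.rTensor_tmul, ψPow_zero]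
  rfl

lemma ghostKernel_eq (k : ℕ) : h.ghostKernel r k =
    ∑ j ∈ Finset.range (k - 1), ghostCoeff k j • h.kern r (k - 2 - j) j := by
  rw [ghostKernel, Finset.sum_comm]
  simp only [kern, Finset.smul_sum]

/-- The kernel of `Lᵏ`. -/
lemma hasKernel_laxAct_pow (k : ℕ) : FunctionClass.HasKernel (h.laxAct r ^ k)
    (∑ j ∈ Finset.range k, h.kern r (k - 1 - j) j) := by
  induction k with
  | zero =>
    rw [pow_zero, Finset.sum_range_zero, ← map_one K.diff]
    exact FunctionClass.hasKernel_diff _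
  | succ k ih =>
    have h1 := ih.mul (FunctionClass.hasKernel_mk (h.laxPlus r) h.laxKernel)
    change FunctionClass.HasKernel (h.laxAct r ^ k * h.laxAct r)
      ((h.laxAct r ^ k).eig.rTensor K.AdjFn h.laxKernel +
        (h.laxAct r).adj.lTensor K.EigFn (∑ j ∈ Finset.range k, h.kern r (k - 1 - j) j)) at h1
    rw [pow_succ]
    convert h1 using 1
    -- In `Lᵏ · L` the first leg contributes the new term `j = 0`, and `L*` on the second leg shifts
    -- the old terms by one.
    rw [Finset.sum_range_succ', pow_rTensor_laxKernel, map_sum, add_comm]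
    simp only [lTensor_kern, Nat.add_sub_cancel, Nat.sub_zero]
    congr 1
    refine Finset.sum_congr rfl fun j _ => ?_
    rw [show k - (j + 1) = k - 1 - j by omega]

/-- `(C ⊗ 1 - 1 ⊗ C*)` on kernels, which is the kernel of a commutator with `C`. -/
noncomputable def adKernel (C : K.ActOps) (T : K.EigFn ⊗[ℚ] K.AdjFn) : K.EigFn ⊗[ℚ] K.AdjFn :=
  C.eig.rTensor K.AdjFn T - C.adj.lTensor K.EigFn T

/-- The four terms from the two products group by kernel: each operator acts on the kernel of the
other as `C ⊗ 1 - 1 ⊗ C*`. -/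
lemma hasKernel_commutator {X Y : K.ActOps} {T S : K.EigFn ⊗[ℚ] K.AdjFn}
    (hX : FunctionClass.HasKernel X T) (hY : FunctionClass.HasKernel Y S) :
    FunctionClass.HasKernel (X * Y - Y * X) (adKernel X S - adKernel Y T) := by
  convert (hX.mul hY).sub (hY.mul hX) using 1
  rw [adKernel, adKernel]
  abel

lemma adKernel_sum_tmul {ι : Type*} (t : Finset ι) (C : K.ActOps) (f : ι → K.EigFn)
    (g : ι → K.AdjFn) : adKernel C (∑ i ∈ t, f i ⊗ₜ g i) =
      ∑ i ∈ t, (C.eig (f i) ⊗ₜ g i - f i ⊗ₜ C.adj (g i)) := by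
  simp only [adKernel, map_sum, LinearMap.rTensor_tmul, LinearMap.lTensor_tmul]
  exact (Finset.sum_sub_distrib (G := K.EigFn ⊗[ℚ] K.AdjFn) _ _).symm

lemma adKernel_zero (C : K.ActOps) : adKernel C 0 = 0 := by
  rw [adKernel, map_zero, map_zero]
  exact sub_zero (0 : K.EigFn ⊗[ℚ] K.AdjFn)

/-- `L ⊗ 1` and `1 ⊗ L*` raise the power in one leg or the other, so the result lives in total
degree `k - 1`, like the kernel of `Lᵏ`, and consists of consecutive differences ready for summation
by parts. -/
lemma adKernel_laxAct_ghostKernel (k : ℕ) :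
    adKernel (h.laxAct r) (h.ghostKernel r k) = -∑ j ∈ Finset.range (k - 1),
      ghostCoeff k j • (h.kern r (k - 1 - (j + 1)) (j + 1) - h.kern r (k - 1 - j) j) := by
  rw [adKernel, ghostKernel_eq, map_sum, map_sum]
  refine ((Finset.sum_sub_distrib (G := K.EigFn ⊗[ℚ] K.AdjFn) _ _).symm.trans
    (Finset.sum_congr rfl fun j hj => ?_)).trans (Finset.sum_neg_distrib (G := K.EigFn ⊗[ℚ] K.AdjFn) _)
  have := Finset.mem_range.1 hj
  rw [map_smul, map_smul, rTensor_kern, lTensor_kern, show k - 2 - j + 1 = k - 1 - j by omega,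
    show k - 1 - (j + 1) = k - 2 - j by omega, smul_sub]
  abel

lemma hasKernel_genAct (k : ℕ) : FunctionClass.HasKernel (h.genAct r k) (h.ghostKernel r k) :=
  FunctionClass.hasKernel_mk _ _

lemma hasKernel_laxAct : FunctionClass.HasKernel (h.laxAct r) h.laxKernel :=
  FunctionClass.hasKernel_mk _ _

/-- The kernel of `[(M Lᵏ)₊ + Y_k, L] + Lᵏ` is the variation of the kernel of `L`. -/
lemma hasKernel_genAct_commutator (k : ℕ) : FunctionClass.HasKernel
    (h.genAct r k * h.laxAct r - h.laxAct r * h.genAct r k + h.laxAct r ^ k)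
    (∑ i, (h.starφ r k i ⊗ₜ h.ψ i + h.φ i ⊗ₜ h.starψ r k i)) := by
  convert (hasKernel_commutator (h.hasKernel_genAct r k) (h.hasKernel_laxAct r)).add
    (h.hasKernel_laxAct_pow r k) using 1
  have e : ∀ x y z : K.EigFn ⊗[ℚ] K.AdjFn, x - -y + z = x + (y + z) := fun x y z => by abel
  -- The contributions of `Y_k` and of `Lᵏ` collapse to `k/2` times the two end terms, the
  -- inhomogeneous terms of the flow on `Φᵢ` and `Ψᵢ`.
  rw [adKernel_laxAct_ghostKernel, e,
    sum_ghostCoeff_smul_sub k fun j => h.kern r (k - 1 - j) j]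
  simp only [Nat.sub_zero, Nat.sub_self]
  rw [laxKernel, adKernel_sum_tmul, kern, kern, ← Finset.sum_add_distrib, Finset.smul_sum,
    ← Finset.sum_add_distrib]
  refine Finset.sum_congr rfl fun i _ => ?_
  rw [starφ, starψ, TensorProduct.add_tmul, TensorProduct.tmul_add, TensorProduct.tmul_neg,
    ← TensorProduct.smul_tmul', TensorProduct.tmul_smul, φPow_zero, ψPow_zero, smul_add]
  abel

end State.Regular
end Kernels

/-! ### The constraint on `L` and the algebra generated by `L` and `M` -/

section Constraint
variable {B : Type u} [CommRing B] [Algebra ℚ B] [Differential B] {m : ℕ}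
  {K : FunctionClass B} {s : State B m}

namespace State.Regular
variable (h : s.Regular K) (r : ℕ)

lemma op_ofKernel_laxKernel : (K.ofKernel h.laxKernel).op =
    ∑ i, mulOp (s.Φ i) * Dpow (-1) * mulOp (s.Ψ i) := by
  rw [laxKernel, map_sum, map_sum]
  rfl

/-- Here the constraint ties the acting operator `L₊ + ∑ Φᵢ D⁻¹ Ψᵢ` to the dressed operator `W Dʳ
W⁻¹`. -/
lemma op_laxAct (hc : minusPart (lax r s) = ∑ i, mulOp (s.Φ i) * Dpow (-1) * mulOp (s.Ψ i)) :
    (h.laxAct r).op = lax r s := by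
  rw [laxAct, map_add, FunctionClass.op_diff, op_ofKernel_laxKernel, ← hc]
  exact plusPart_add_minusPart _

include h in
lemma mom_commutator_lax (hr : 1 ≤ r) (k : ℕ) :
    opM K r s * lax r s ^ k * lax r s - lax r s * (opM K r s * lax r s ^ k) = -lax r s ^ k := by
  rw [← mul_assoc (lax r s), h.lax_mul_opM r hr, mul_assoc, ← pow_succ, add_mul, one_mul,
    mul_assoc, ← pow_succ']
  abel

include h in
-- Moving `Lˡ` past `M` costs `l L^{l-1}`; the quadratic terms `M² L^{k+l}` cancel. The truncation
-- at `l = k = 0` is harmless, since the coefficient vanishes.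
lemma mom_commutator (hr : 1 ≤ r) (l k : ℕ) :
    opM K r s * lax r s ^ l * (opM K r s * lax r s ^ k) -
      opM K r s * lax r s ^ k * (opM K r s * lax r s ^ l) =
      ((l : ℤ) - k) • (opM K r s * lax r s ^ (k + l - 1)) := by
  have key : ∀ l k : ℕ, opM K r s * lax r s ^ l * (opM K r s * lax r s ^ k) =
      opM K r s * opM K r s * lax r s ^ (k + l) + l • (opM K r s * lax r s ^ (k + l - 1)) := by
    intro l k
    have e : opM K r s * lax r s ^ l * (opM K r s * lax r s ^ k) =
        opM K r s * (lax r s ^ l * opM K r s) * lax r s ^ k := by noncomm_ring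
    rw [e, h.lax_pow_mul_opM r hr, mul_add, add_mul, mul_smul_comm, smul_mul_assoc, add_comm k l]
    congr 1
    · rw [pow_add]; noncomm_ring
    · cases l with
      | zero => simp
      | succ l =>
        rw [mul_assoc, ← pow_add, show l + 1 - 1 + k = l + 1 + k - 1 by omega]
  rw [key, key, add_comm l k, add_sub_add_left_eq_sub, sub_smul, natCast_zsmul, natCast_zsmul]

lemma laxAct_pow_eig_φPow (k a : ℕ) (i : Fin m) :
    (h.laxAct r ^ k).eig (h.φPow r a i) = h.φPow r (a + k) i := by
  rw [φPow, φPow, ← Module.End.mul_apply, ← map_mul, ← pow_add, add_comm]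

lemma laxAct_pow_adj_ψPow (k a : ℕ) (i : Fin m) :
    (h.laxAct r ^ k).adj (h.ψPow r a i) = h.ψPow r (a + k) i := by
  rw [ψPow, ψPow, pow_add]
  rfl

end State.Regular
end Constraint

/-! ### Variation of the iterated eigenfunctions -/

section Evolution
variable {B' B : Type u} [CommRing B'] [Algebra ℚ B'] [Differential B']
  [CommRing B] [Algebra ℚ B] [Differential B] {m : ℕ}
  {K' : FunctionClass B'} {K : FunctionClass B} {j : Jet K' K}
  {s' : State B' m} {s v : State B m}

namespace Jet

/-- `X` generates the variation of the eigenfunctions and of `L`, up to `c` times the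
inhomogeneous terms of `∂*_k`. -/
structure Generates (j : Jet K' K) (h' : s'.Regular K') (h : s.Regular K) (r k : ℕ) (c : ℚ)
    (X : K.ActOps) : Prop where
  delE_laxAct : ∀ f, j.delE ((h'.laxAct r).eig f) =
    (X * h.laxAct r - h.laxAct r * X).eig (j.baseE f) + c • (h.laxAct r ^ k).eig (j.baseE f) +
      (h.laxAct r).eig (j.delE f)
  delA_laxAct : ∀ g, j.delA ((h'.laxAct r).adj g) =
    (X * h.laxAct r - h.laxAct r * X).adj (j.baseA g) + c • (h.laxAct r ^ k).adj (j.baseA g) +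
      (h.laxAct r).adj (j.delA g)
  delE_φ : ∀ i, j.delE (h'.φ i) = X.eig (h.φ i) + (c * (k / 2)) • h.φPow r (k - 1) i
  delA_ψ : ∀ i, j.delA (h'.ψ i) = -X.adj (h.ψ i) + (c * (k / 2)) • h.ψPow r (k - 1) i

namespace Generates
variable {h' : s'.Regular K'} {h : s.Regular K} {r k : ℕ} {c : ℚ} {X : K.ActOps}

/-- Each application of `L` contributes one more `c Lᵏ` from the variation of `L`, which adds `c a`
to the initial `c k/2`. The value `c = 1` serves `∂*_k`, and `c = 0` the isospectral flows. -/
lemma delE_φPow (hg : Generates j h' h r k c X) (hm : j.Moves s' s v) (a : ℕ) (i : Fin m) :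
    j.delE (h'.φPow r a i) =
      X.eig (h.φPow r a i) + (c * (a + k / 2)) • h.φPow r (a + k - 1) i := by
  induction a with
  | zero => rw [h'.φPow_zero, hg.delE_φ, h.φPow_zero, Nat.cast_zero, zero_add, zero_add]
  | succ a ih =>
    -- For `a + k = 0` the index is truncated, but then the coefficient is zero.
    have h1 : (c * (a + k / 2)) • (h.laxAct r).eig (h.φPow r (a + k - 1) i) =
        (c * (a + k / 2)) • h.φPow r (a + k) i := by
      rcases Nat.eq_zero_or_pos (a + k) with h0 | h0
      · obtain ⟨rfl, rfl⟩ := Nat.add_eq_zero_iff.1 h0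
        simp
      · rw [← h.φPow_succ, Nat.sub_add_cancel h0]
    rw [h'.φPow_succ, hg.delE_laxAct, hm.baseE_φPow h' h, ih, map_add, map_smul, h1,
      h.laxAct_pow_eig_φPow, map_sub, map_mul, map_mul, LinearMap.sub_apply,
      Module.End.mul_apply, Module.End.mul_apply, ← h.φPow_succ,
      show a + 1 + k - 1 = a + k by omega]
    push_cast
    module

lemma delA_ψPow (hg : Generates j h' h r k c X) (hm : j.Moves s' s v) (a : ℕ) (i : Fin m) :
    j.delA (h'.ψPow r a i) =
      -X.adj (h.ψPow r a i) + (c * (a + k / 2)) • h.ψPow r (a + k - 1) i := by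
  induction a with
  | zero => rw [h'.ψPow_zero, hg.delA_ψ, h.ψPow_zero, Nat.cast_zero, zero_add, zero_add]
  | succ a ih =>
    have h1 : (c * (a + k / 2)) • (h.laxAct r).adj (h.ψPow r (a + k - 1) i) =
        (c * (a + k / 2)) • h.ψPow r (a + k) i := by
      rcases Nat.eq_zero_or_pos (a + k) with h0 | h0
      · obtain ⟨rfl, rfl⟩ := Nat.add_eq_zero_iff.1 h0
        simp
      · rw [← h.ψPow_succ, Nat.sub_add_cancel h0]
    rw [h'.ψPow_succ, hg.delA_laxAct, hm.baseA_ψPow h' h, ih, map_add, map_smul, h1,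
      h.laxAct_pow_adj_ψPow, FunctionClass.ActOps.adj_sub, FunctionClass.ActOps.adj_mul,
      FunctionClass.ActOps.adj_mul, LinearMap.sub_apply, map_neg,
      Module.End.mul_apply, Module.End.mul_apply, ← h.ψPow_succ,
      show a + 1 + k - 1 = a + k by omega]
    push_cast
    module

/-- The homogeneous parts act as `X ⊗ 1 - 1 ⊗ X*`; the multiples of higher powers on the two legs
are collected in `ghostShift`. -/
lemma delT_ghostKernel (hg : Generates j h' h r k c X) (hm : j.Moves s' s v) (n : ℕ) :
    j.delT (h'.ghostKernel r n) =
      State.Regular.adKernel X (h.ghostKernel r n) + c • ghostShift (h.kern r) k n := by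
  rw [hm.delT_ghostKernel h' h, State.Regular.ghostKernel, Finset.sum_comm,
    Finset.sum_comm (s := Finset.univ), ghostShift, Finset.smul_sum]
  have e : ∀ t : ℕ → K.EigFn ⊗[ℚ] K.AdjFn,
      State.Regular.adKernel X (∑ p ∈ Finset.range (n - 1), t p) =
        ∑ p ∈ Finset.range (n - 1), State.Regular.adKernel X (t p) := fun t => by
    simp only [State.Regular.adKernel, map_sum]
    exact (Finset.sum_sub_distrib (G := K.EigFn ⊗[ℚ] K.AdjFn) _ _).symm
  rw [e, ← Finset.sum_add_distrib]
  refine Finset.sum_congr rfl fun p _ => ?_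
  have e2 : State.Regular.adKernel X (∑ i, ghostCoeff n p •
      (h.φPow r (n - 2 - p) i ⊗ₜ[ℚ] h.ψPow r p i)) = ghostCoeff n p •
        ∑ i, (X.eig (h.φPow r (n - 2 - p) i) ⊗ₜ[ℚ] h.ψPow r p i -
          h.φPow r (n - 2 - p) i ⊗ₜ[ℚ] X.adj (h.ψPow r p i)) := by
    rw [← Finset.smul_sum, ← State.Regular.adKernel_sum_tmul, State.Regular.adKernel,
      State.Regular.adKernel, map_smul, map_smul, smul_sub]
  rw [e2]
  simp only [State.Regular.kern, ← Finset.smul_sum]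
  rw [smul_comm c, ← smul_add]
  congr 1
  simp only [Finset.smul_sum, smul_add, ← Finset.sum_add_distrib]
  refine Finset.sum_congr rfl fun i _ => ?_
  rw [hg.delE_φPow hm, hg.delA_ψPow hm, TensorProduct.add_tmul, TensorProduct.tmul_add,
    TensorProduct.tmul_neg, ← TensorProduct.smul_tmul', TensorProduct.tmul_smul,
    smul_smul, smul_smul]
  abel

end Generates
end Jet
end Evolution

/-! ### Variation along `∂*_k` and the zero curvature equation -/

section StarVariation
variable {B : Type u} [CommRing B] [Algebra ℚ B] [Differential B] {m : ℕ}
  {K : FunctionClass B} {s : State B m}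

lemma FunctionClass.HasKernel.zsmul {X : K.ActOps} {T : K.EigFn ⊗[ℚ] K.AdjFn}
    (hX : FunctionClass.HasKernel X T) (z : ℤ) : FunctionClass.HasKernel (z • X) (z • T) := by
  obtain ⟨P, rfl⟩ := hX
  exact ⟨z • P, by rw [map_zsmul K.diff, map_zsmul K.ofKernel, smul_add]⟩

lemma Jet.del_mem_ordLE {B' : Type u} [CommRing B'] [Algebra ℚ B'] [Differential B']
    {K' : FunctionClass B'} (j : Jet K' K) {P : Op B'} (hP : P ∈ ordLE B' (-1)) :
    j.del P ∈ ordLE B (-1) :=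
  mem_ordLE_of_plusPart (by rw [← j.del_plusPart, plusPart_of_mem hP, map_zero])

lemma moves_addEps (K : FunctionClass B) (s v : State B m) :
    (dualJet K).Moves (s.addEps v) s v where
  base_W := dualJet_base_addEps K _ _
  del_W := dualJet_del_addEps K _ _
  base_Φ _ := dualJet_baseFn_addEps K _ _
  del_Φ _ := dualJet_delFn_addEps K _ _
  base_Ψ _ := dualJet_baseFn_addEps K _ _
  del_Ψ _ := dualJet_delFn_addEps K _ _

lemma moves_starMove (K : FunctionClass B) (r k : ℕ) (s : State B m) :
    (dualJet K).Moves (starMove K r k s) s (starFlow K r k s) := moves_addEps K s _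

namespace State.Regular
variable (h : s.Regular K) (r : ℕ)

include h in
-- The displaced data are again of the right classes, so the lemmas on regular data also apply over
-- `B[ε]`. The normalization of `W` survives because `G_k W` has negative order.
lemma regular_starMove (k : ℕ) : (starMove K r k s).Regular K.dual where
  plusPart_W := dualJet_op_ext K
    (by rw [Jet.base_plusPart, (moves_starMove K r k s).base_W, h.plusPart_W, map_one])
    (by rw [Jet.del_plusPart, (moves_starMove K r k s).del_W, Jet.del_one]
        exact plusPart_mul_of_mem (h.starGen_mem_ordLE r k) h.W_mem_ordLE)
  W_mem μ n := by
    refine ⟨?_, ?_⟩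
    · change ((dualJet K).base (starMove K r k s).W μ).coeff n ∈ K.coeffs
      rw [(moves_starMove K r k s).base_W]
      exact h.W_mem μ n
    · change ((dualJet K).del (starMove K r k s).W μ).coeff n ∈ K.coeffs
      rw [(moves_starMove K r k s).del_W]
      exact mul_mem (h.starGen_mem_coeffOps r k) h.W_mem μ n
  Φ_mem i μ := by
    refine ⟨?_, ?_⟩
    · change (dualJet K).baseFn ((starMove K r k s).Φ i) μ ∈ K.eig
      rw [(moves_starMove K r k s).base_Φ]
      exact h.Φ_mem i μ
    · change (dualJet K).delFn ((starMove K r k s).Φ i) μ ∈ K.eig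
      rw [(moves_starMove K r k s).del_Φ, ← h.coe_starφ]
      exact (h.starφ r k i).2 μ
  Ψ_mem i μ := by
    refine ⟨?_, ?_⟩
    · change (dualJet K).baseFn ((starMove K r k s).Ψ i) μ ∈ K.adj
      rw [(moves_starMove K r k s).base_Ψ]
      exact h.Ψ_mem i μ
    · change (dualJet K).delFn ((starMove K r k s).Ψ i) μ ∈ K.adj
      rw [(moves_starMove K r k s).del_Ψ, ← h.coe_starψ]
      exact (h.starψ r k i).2 μ

lemma delE_star_φ (k : ℕ) (i : Fin m) :
    (dualJet K).delE ((h.regular_starMove r k).φ i) = h.starφ r k i :=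
  Subtype.ext (((moves_starMove K r k s).del_Φ i).trans (h.coe_starφ r k i).symm)

lemma delA_star_ψ (k : ℕ) (i : Fin m) :
    (dualJet K).delA ((h.regular_starMove r k).ψ i) = h.starψ r k i :=
  Subtype.ext (((moves_starMove K r k s).del_Ψ i).trans (h.coe_starψ r k i).symm)

include h in
lemma base_star_lax (k : ℕ) : (dualJet K).base (lax r (starMove K r k s)) = lax r s :=
  (moves_starMove K r k s).base_dressedPow (h.regular_starMove r k) h r

include h in
lemma evolves_star_lax (k : ℕ) :
    (dualJet K).Evolves (starGen K r k s) (lax r (starMove K r k s)) :=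
  (moves_starMove K r k s).evolves_dressedPow (h.regular_starMove r k) h rfl r

include h in
lemma eps_star_lax (k : ℕ) : Op.eps (lax r (starMove K r k s)) = starLax K r k s := by
  rw [← dualJet_del, h.evolves_star_lax r k, h.base_star_lax r k, starLax]

include h in
lemma base_star_opM (k : ℕ) : (dualJet K).base (opM K.dual r (starMove K r k s)) = opM K r s :=
  (moves_starMove K r k s).base_opM (h.regular_starMove r k) h (dualJet_base_bareM K r)

include h in
lemma evolves_star_opM (k : ℕ) :
    (dualJet K).Evolves (starGen K r k s) (opM K.dual r (starMove K r k s)) := by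
  rw [Jet.Evolves, h.base_star_opM, opM, (moves_starMove K r k s).del_conj
    (h.regular_starMove r k) h rfl, dualJet_base_bareM, dualJet_del_bareM, mul_zero, zero_mul,
    add_zero, opM]

variable (hc : minusPart (lax r s) = ∑ i, mulOp (s.Φ i) * Dpow (-1) * mulOp (s.Ψ i))
  (hr : 1 ≤ r)

include hc hr in
/-- The operator that generates `∂*_k L`. -/
lemma op_star_commutator (k : ℕ) :
    (h.genAct r k * h.laxAct r - h.laxAct r * h.genAct r k + h.laxAct r ^ k).op =
      starLax K r k s := by
  have h1 := h.mom_commutator_lax r hr k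
  rw [map_add, map_sub, map_mul, map_mul, map_pow, h.op_laxAct r hc, h.op_genAct_eq r k, starLax,
    add_mul, mul_add, add_sub_add_comm, h1, neg_add_cancel_right]

include hc hr in
-- Equal kernels and equal differential parts: thus `∂*_k L = [A_k, L] + Lᵏ` holds also for the
-- actions `L(f)` and `L*(g)`, which is what the induction on `L^a(Φᵢ)` needs.
lemma star_delta_lax (k : ℕ) :
    K.diff ((dualJet K).delD ((h.regular_starMove r k).laxPlus r)) +
        K.ofKernel ((dualJet K).delT (h.regular_starMove r k).laxKernel) =
      h.genAct r k * h.laxAct r - h.laxAct r * h.genAct r k + h.laxAct r ^ k := by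
  have h1 := h.hasKernel_genAct_commutator r k
  refine (FunctionClass.hasKernel_mk _ _).ext ?_ ?_
  · convert h1 using 1
    rw [(moves_starMove K r k s).delT_laxKernel (h.regular_starMove r k) h]
    simp only [h.delE_star_φ, h.delA_star_ψ]
  · rw [h.op_star_commutator r hc hr k, map_add, plusPart_add, FunctionClass.op_diff,
      plusPart_of_mem (FunctionClass.op_ofKernel_mem _), add_zero]
    change plusPart ((dualJet K).del (plusPart (lax r (starMove K r k s)))) = _
    rw [Jet.del_plusPart, plusPart_of_diff (plusPart_mem _), dualJet_del, h.eps_star_lax]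

include h hc hr in
/-- The pseudo-differential part of `∂*_k L`. -/
lemma minusPart_starLax (k : ℕ) : minusPart (starLax K r k s) =
    ∑ i, (mulOp ((starFlow K r k s).Φ i) * Dpow (-1) * mulOp (s.Ψ i) +
      mulOp (s.Φ i) * Dpow (-1) * mulOp ((starFlow K r k s).Ψ i)) := by
  rw [← h.op_star_commutator r hc hr k, (h.hasKernel_genAct_commutator r k).minusPart_op, map_sum,
    map_sum]
  refine Finset.sum_congr rfl fun i _ => ?_
  rw [map_add, map_add, FunctionClass.ofKernel_tmul, FunctionClass.ofKernel_tmul,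
    FunctionClass.op_pair, FunctionClass.op_pair, h.coe_starφ, h.coe_starψ]
  rfl

include hc hr in
lemma generates_star (k : ℕ) : Jet.Generates (dualJet K) (h.regular_starMove r k) h r k 1
    (h.genAct r k) where
  delE_laxAct f := by
    have h1 := (moves_starMove K r k s).varies_laxAct (h.regular_starMove r k) h r
    rw [h.star_delta_lax r hc hr k] at h1
    rw [h1.del_eig, one_smul, map_add, LinearMap.add_apply]
  delA_laxAct g := by
    have h1 := (moves_starMove K r k s).varies_laxAct (h.regular_starMove r k) h r
    rw [h.star_delta_lax r hc hr k] at h1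
    rw [h1.del_adj, one_smul, FunctionClass.ActOps.adj_add, LinearMap.add_apply]
  delE_φ i := by rw [h.delE_star_φ, one_mul]; rfl
  delA_ψ i := by rw [h.delA_star_ψ, one_mul]; rfl

/-- The variation of `(M Lᵏ)₊ + Y_k` along `∂*_l`. -/
noncomputable def starDelta (l k : ℕ) : K.ActOps :=
  K.diff ((dualJet K).delD ((h.regular_starMove r l).momPlus r k)) +
    K.ofKernel ((dualJet K).delT ((h.regular_starMove r l).ghostKernel r k))

lemma varies_star_genAct (l k : ℕ) : (dualJet K).Varies ((h.regular_starMove r l).genAct r k)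
    (h.genAct r k) (h.starDelta r l k) :=
  (moves_starMove K r l s).varies_genAct (h.regular_starMove r l) h (dualJet_base_bareM K r) k

include h in
lemma base_star_starGen (l k : ℕ) :
    (dualJet K).base (starGen K.dual r k (starMove K r l s)) = starGen K r k s := by
  have h1 := (h.varies_star_genAct r l k).base_op
  rw [op_genAct_eq, op_genAct_eq, map_add, map_mul, map_pow, h.base_star_lax, h.base_star_opM] at h1
  exact add_right_cancel h1

/-- In `A_k = G_k + M Lᵏ` the second summand evolves by commutation with `G_l`, as `L` and `M` do;
the first is differentiated as it stands and keeps negative order. -/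
lemma op_starDelta (l k : ℕ) : (h.starDelta r l k).op =
    (dualJet K).del (starGen K.dual r k (starMove K r l s)) +
      (starGen K r l s * (opM K r s * lax r s ^ k) - opM K r s * lax r s ^ k * starGen K r l s) := by
  rw [← (h.varies_star_genAct r l k).del_op, op_genAct_eq, map_add,
    (h.evolves_star_opM r l).mul ((h.evolves_star_lax r l).pow k), map_mul, map_pow,
    h.base_star_lax, h.base_star_opM]

include hc hr in
lemma hasKernel_starDelta (l k : ℕ) : FunctionClass.HasKernel (h.starDelta r l k)
    (adKernel (h.genAct r l) (h.ghostKernel r k) + ghostShift (h.kern r) l k) := by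
  have h1 := (h.generates_star r hc hr l).delT_ghostKernel (moves_starMove K r l s) k
  rw [one_smul] at h1
  rw [← h1]
  exact FunctionClass.hasKernel_mk _ _

include hc hr in
/-- The Virasoro relations in zero curvature form. -/
lemma star_zero_curvature (l k : ℕ) :
    h.starDelta r l k - h.starDelta r k l +
        (h.genAct r k * h.genAct r l - h.genAct r l * h.genAct r k) =
      ((k : ℤ) - l) • h.genAct r (k + l - 1) := by
  refine (((h.hasKernel_starDelta r hc hr l k).sub (h.hasKernel_starDelta r hc hr k l)).add
    (hasKernel_commutator (h.hasKernel_genAct r k) (h.hasKernel_genAct r l))).ext ?_ ?_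
  · convert (h.hasKernel_genAct r (k + l - 1)).zsmul ((k : ℤ) - l) using 1
    rw [h.ghostKernel_eq r (k + l - 1)]
    refine Eq.trans ?_ (ghostShift_sub (h.kern r) l k)
    abel
  · refine plusPart_eq_of_sub_mem ?_
    have h1 := h.mom_commutator r hr k l
    rw [add_comm l k] at h1
    have hm : ∀ l k, (dualJet K).del (starGen K.dual r k (starMove K r l s)) ∈ ordLE B (-1) :=
      fun l k => Jet.del_mem_ordLE _ ((h.regular_starMove r l).starGen_mem_ordLE r k)
    have hA := h.starGen_mem_ordLE r
    have hAA : ∀ l k, starGen K r l s * starGen K r k s ∈ ordLE B (-1) := fun l k =>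
      ordLE_mono (by omega) (ordLE_mul (hA l) (hA k))
    rw [map_zsmul, map_add, map_sub, map_sub, map_mul, map_mul, op_starDelta, op_starDelta,
      op_genAct_eq, op_genAct_eq, op_genAct_eq, smul_add, ← h1]
    convert sub_mem (add_mem (sub_mem (hm l k) (hm k l)) (sub_mem (hAA k l) (hAA l k)))
      (zsmul_mem (hA (k + l - 1)) ((k : ℤ) - l)) using 1
    noncomm_ring

include h hc hr in
-- The symbol of the zero curvature equation after removal of the terms in `M`. This is the form
-- needed for `W` and `L`.
lemma star_curvature_starGen (l k : ℕ) :
    (dualJet K).del (starGen K.dual r k (starMove K r l s)) -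
        (dualJet K).del (starGen K.dual r l (starMove K r k s)) +
        (starGen K r k s * starGen K r l s - starGen K r l s * starGen K r k s) =
      ((k : ℤ) - l) • starGen K r (k + l - 1) s := by
  have h1 := congrArg FunctionClass.ActOps.op (h.star_zero_curvature r hc hr l k)
  have h2 := h.mom_commutator r hr k l
  rw [add_comm l k] at h2
  rw [map_zsmul, map_add, map_sub, map_sub, map_mul, map_mul, op_starDelta, op_starDelta,
    op_genAct_eq, op_genAct_eq, op_genAct_eq, smul_add, ← h2] at h1
  refine add_right_cancel (Eq.trans ?_ h1)
  noncomm_ring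

end State.Regular
end StarVariation

/-- These are the second variations of the inhomogeneous terms; the identity is `(k/2)(k - 1 + l/2)
- (l/2)(l - 1 + k/2) = (k - l)(k + l - 1)/2`. A truncated `k - 1` or `l - 1` comes with coefficient
zero. -/
lemma virasoro_shift_sub {V : Type*} [AddCommGroup V] [Module ℚ V] (e : ℕ → V) (l k : ℕ) :
    (((k : ℚ) / 2) * ((k - 1 : ℕ) + (l : ℚ) / 2)) • e (k - 1 + l - 1) -
        (((l : ℚ) / 2) * ((l - 1 : ℕ) + (k : ℚ) / 2)) • e (l - 1 + k - 1) =
      ((k : ℤ) - l) • (((k + l - 1 : ℕ) : ℚ) / 2) • e (k + l - 1 - 1) := by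
  rw [← Int.cast_smul_eq_zsmul ℚ]
  match l, k with
  | 0, 0 => simp
  | 0, k + 1 =>
    simp only [Nat.add_sub_cancel, Nat.add_zero]
    push_cast
    module
  | l + 1, 0 =>
    simp only [Nat.add_sub_cancel, Nat.add_zero, Nat.zero_add]
    push_cast
    module
  | l + 1, k + 1 =>
    rw [show k + 1 - 1 + (l + 1) - 1 = k + l by omega, show l + 1 - 1 + (k + 1) - 1 = k + l by omega,
      show k + 1 + (l + 1) - 1 = k + l + 1 by omega]
    simp only [Nat.add_sub_cancel]
    push_cast
    module

/-! ### The Virasoro relations on `W`, `Φᵢ`, `Ψᵢ` and `L` -/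

section StarBracket
variable {B : Type u} [CommRing B] [Algebra ℚ B] [Differential B] {m : ℕ}
  {K : FunctionClass B} {s : State B m}

lemma State.ext' {a b : State B m} (hW : a.W = b.W) (hΦ : ∀ i, a.Φ i = b.Φ i)
    (hΨ : ∀ i, a.Ψ i = b.Ψ i) : a = b := by
  obtain ⟨_, _, _⟩ := a
  obtain ⟨_, _, _⟩ := b
  obtain rfl : _ = _ := hW
  obtain rfl := funext hΦ
  obtain rfl := funext hΨ
  rfl

namespace State.Regular
variable (h : s.Regular K) (r : ℕ)
  (hc : minusPart (lax r s) = ∑ i, mulOp (s.Φ i) * Dpow (-1) * mulOp (s.Ψ i))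
  (hr : 1 ≤ r)

include hc hr in
-- The two middle terms are interchanged with each other when `l` and `k` are swapped, so they drop
-- out of the bracket. The first is governed by zero curvature, the last by `virasoro_shift_sub`.
lemma delE_starφ (l k : ℕ) (i : Fin m) :
    (dualJet K).delE ((h.regular_starMove r l).starφ r k i) =
      (h.starDelta r l k + h.genAct r k * h.genAct r l).eig (h.φ i) +
        ((l : ℚ) / 2) • (h.genAct r k).eig (h.φPow r (l - 1) i) +
        ((k : ℚ) / 2) • (h.genAct r l).eig (h.φPow r (k - 1) i) +
        (((k : ℚ) / 2) * ((k - 1 : ℕ) + (l : ℚ) / 2)) • h.φPow r (k - 1 + l - 1) i := by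
  have hm := moves_starMove K r l s
  rw [starφ, map_add, map_smul, (h.varies_star_genAct r l k).del_eig,
    hm.baseE_φ (h.regular_starMove r l) h, h.delE_star_φ,
    (h.generates_star r hc hr l).delE_φPow hm, starφ, map_add, map_smul, map_add, map_mul,
    LinearMap.add_apply, Module.End.mul_apply]
  module

include hc hr in
lemma delA_starψ (l k : ℕ) (i : Fin m) :
    (dualJet K).delA ((h.regular_starMove r l).starψ r k i) =
      -(h.starDelta r l k - h.genAct r l * h.genAct r k).adj (h.ψ i) -
        ((l : ℚ) / 2) • (h.genAct r k).adj (h.ψPow r (l - 1) i) -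
        ((k : ℚ) / 2) • (h.genAct r l).adj (h.ψPow r (k - 1) i) +
        (((k : ℚ) / 2) * ((k - 1 : ℕ) + (l : ℚ) / 2)) • h.ψPow r (k - 1 + l - 1) i := by
  have hm := moves_starMove K r l s
  rw [starψ, map_add, map_neg, map_smul, (h.varies_star_genAct r l k).del_adj,
    hm.baseA_ψ (h.regular_starMove r l) h, h.delA_star_ψ,
    (h.generates_star r hc hr l).delA_ψPow hm, starψ, map_add, map_neg, map_smul,
    FunctionClass.ActOps.adj_sub, FunctionClass.ActOps.adj_mul,
    LinearMap.sub_apply, Module.End.mul_apply]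
  module

include hc hr in
lemma star_bracket_φ (l k : ℕ) (i : Fin m) :
    (dualJet K).delE ((h.regular_starMove r l).starφ r k i) -
        (dualJet K).delE ((h.regular_starMove r k).starφ r l i) =
      ((k : ℤ) - l) • h.starφ r (k + l - 1) i := by
  have h1 := congrArg (fun X : K.ActOps => X.eig (h.φ i)) (h.star_zero_curvature r hc hr l k)
  have h2 := virasoro_shift_sub (fun a => h.φPow r a i) l k
  simp only [map_zsmul, map_add, map_sub, LinearMap.add_apply, LinearMap.sub_apply,
    LinearMap.smul_apply] at h1
  rw [h.delE_starφ r hc hr, h.delE_starφ r hc hr, starφ, smul_add, ← h1, ← h2, map_add, map_add,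
    LinearMap.add_apply, LinearMap.add_apply]
  abel

include hc hr in
lemma star_bracket_ψ (l k : ℕ) (i : Fin m) :
    (dualJet K).delA ((h.regular_starMove r l).starψ r k i) -
        (dualJet K).delA ((h.regular_starMove r k).starψ r l i) =
      ((k : ℤ) - l) • h.starψ r (k + l - 1) i := by
  let adjHom : K.ActOps →+ Module.End ℚ K.AdjFn :=
    { toFun X := X.adj, map_zero' := rfl, map_add' _ _ := rfl }
  have hz : ∀ (z : ℤ) (X : K.ActOps), (z • X).adj = z • X.adj := fun z X => map_zsmul adjHom z X
  have h1 := congrArg (fun X : K.ActOps => X.adj (h.ψ i)) (h.star_zero_curvature r hc hr l k)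
  have h2 := virasoro_shift_sub (fun a => h.ψPow r a i) l k
  simp only [hz, FunctionClass.ActOps.adj_add, FunctionClass.ActOps.adj_sub, LinearMap.add_apply,
    LinearMap.sub_apply, LinearMap.smul_apply] at h1
  rw [h.delA_starψ r hc hr, h.delA_starψ r hc hr, starψ, smul_add, smul_neg, ← h1, ← h2,
    FunctionClass.ActOps.adj_sub, FunctionClass.ActOps.adj_sub, LinearMap.sub_apply,
    LinearMap.sub_apply]
  abel

include h hc hr in
theorem starBracket_eq (l k : ℕ) :
    starBracket K r l k s = ((k : ℤ) - l) • starFlow K r (k + l - 1) s := by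
  refine State.ext' ?_ (fun i => ?_) fun i => ?_
  · change (dualJet K).del (starGen K.dual r k (starMove K r l s) * (starMove K r l s).W) -
      (dualJet K).del (starGen K.dual r l (starMove K r k s) * (starMove K r k s).W) =
      ((k : ℤ) - l) • (starGen K r (k + l - 1) s * s.W)
    -- Since `∂*_l(G_k W) = (∂*_l G_k) W + G_k G_l W`, the bracket on `W` is the zero curvature
    -- expression times `W`.
    rw [← smul_mul_assoc, ← h.star_curvature_starGen r hc hr l k, Jet.del_mul, Jet.del_mul,
      (moves_starMove K r l s).base_W, (moves_starMove K r k s).base_W,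
      (moves_starMove K r l s).del_W, (moves_starMove K r k s).del_W, h.base_star_starGen,
      h.base_star_starGen]
    change _ * s.W + _ * (_ * s.W) - (_ * s.W + _ * (_ * s.W)) = _
    noncomm_ring
  · change (dualJet K).delFn ((starFlow K.dual r k (starMove K r l s)).Φ i) -
      (dualJet K).delFn ((starFlow K.dual r l (starMove K r k s)).Φ i) =
      ((k : ℤ) - l) • (starFlow K r (k + l - 1) s).Φ i
    rw [← (h.regular_starMove r l).coe_starφ, ← (h.regular_starMove r k).coe_starφ, ← h.coe_starφ]
    exact congrArg Subtype.val (h.star_bracket_φ r hc hr l k i)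
  · change (dualJet K).delFn ((starFlow K.dual r k (starMove K r l s)).Ψ i) -
      (dualJet K).delFn ((starFlow K.dual r l (starMove K r k s)).Ψ i) =
      ((k : ℤ) - l) • (starFlow K r (k + l - 1) s).Ψ i
    rw [← (h.regular_starMove r l).coe_starψ, ← (h.regular_starMove r k).coe_starψ, ← h.coe_starψ]
    exact congrArg Subtype.val (h.star_bracket_ψ r hc hr l k i)

include h hc hr in
theorem starBracketLax_eq (l k : ℕ) :
    starBracketLax K r l k s = ((k : ℤ) - l) • starLax K r (k + l - 1) s := by
  change (dualJet K).del (starLax K.dual r k (starMove K r l s)) -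
    (dualJet K).del (starLax K.dual r l (starMove K r k s)) = _
  have e : ∀ l k, (dualJet K).del (starLax K.dual r k (starMove K r l s)) =
      (dualJet K).del (starGen K.dual r k (starMove K r l s)) * lax r s +
        starGen K r k s * (starGen K r l s * lax r s - lax r s * starGen K r l s) -
        ((starGen K r l s * lax r s - lax r s * starGen K r l s) * starGen K r k s +
          lax r s * (dualJet K).del (starGen K.dual r k (starMove K r l s))) := fun l k => by
    rw [starLax, map_sub, Jet.del_mul, Jet.del_mul, h.evolves_star_lax, h.base_star_lax,
      h.base_star_starGen]
  rw [e, e, starLax, smul_sub, ← smul_mul_assoc, ← mul_smul_comm,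
    ← h.star_curvature_starGen r hc hr l k]
  noncomm_ring

end State.Regular
end StarBracket

/-! ### Variation along the isospectral flows -/

section TimeVariation
variable {B : Type u} [CommRing B] [Algebra ℚ B] [Differential B] {m : ℕ}
  {K : FunctionClass B} {s : State B m}

lemma timeJet_base (l : ℕ) (P : Op B) : (timeJet K l).base P = P := rfl

lemma timeJet_del (l : ℕ) (P : Op B) : (timeJet K l).del P = dtOp l P := dtOpHom_apply l P

lemma timeJet_delFn (l : ℕ) (f : Fn B) : (timeJet K l).delFn f = dtFn l f := dtFnHom_apply l f

lemma timeJet_baseE (l : ℕ) (f : K.EigFn) : (timeJet K l).baseE f = f := rfl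

lemma timeJet_baseA (l : ℕ) (f : K.AdjFn) : (timeJet K l).baseA f = f := rfl

lemma moves_time (K : FunctionClass B) {l : ℕ} (hf : s.dt l = isoFlow l s) :
    (timeJet K l).Moves s s (isoFlow l s) where
  base_W := rfl
  del_W := (timeJet_del l _).trans (congrArg State.W hf)
  base_Φ _ := rfl
  del_Φ i := (timeJet_delFn l _).trans (congrArg (fun t : State B m => t.Φ i) hf)
  base_Ψ _ := rfl
  del_Ψ i := (timeJet_delFn l _).trans (congrArg (fun t : State B m => t.Ψ i) hf)

namespace State.Regular
variable (h : s.Regular K) (r : ℕ) {l : ℕ}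

/-- `(L^{l/r})₊` together with its actions. -/
noncomputable def powAct (l : ℕ) : K.ActOps := K.diff (h.powPlus l)

lemma hasKernel_powAct (l : ℕ) : FunctionClass.HasKernel (h.powAct l) 0 :=
  FunctionClass.hasKernel_diff _

lemma op_powAct (l : ℕ) : (h.powAct l).op = plusPart (dressedPow l s) := rfl

/-- The variation of `(L^{l/r})₊` along `∂*_k`. -/
noncomputable def powDelta (l k : ℕ) : K.diffOps :=
  ⟨plusPart (starGen K r k s * dressedPow l s - dressedPow l s * starGen K r k s),
    FunctionClass.plusPart_mem_diffOps (sub_mem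
      (mul_mem (h.starGen_mem_coeffOps r k) (h.dressedPow_mem l))
      (mul_mem (h.dressedPow_mem l) (h.starGen_mem_coeffOps r k)))⟩

lemma time_delE_φ (hf : s.dt l = isoFlow l s) (i : Fin m) :
    (timeJet K l).delE (h.φ i) = (h.powAct l).eig (h.φ i) :=
  Subtype.ext ((moves_time K hf).del_Φ i)

lemma time_delA_ψ (hf : s.dt l = isoFlow l s) (i : Fin m) :
    (timeJet K l).delA (h.ψ i) = -(h.powAct l).adj (h.ψ i) :=
  Subtype.ext ((moves_time K hf).del_Ψ i)

include h in
-- Dressing gives the commutator with `-(L^{l/r})₋`, which differs from `(L^{l/r})₊` by an operator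
-- commuting with all `L^{n/r}`.
lemma evolves_time_dressedPow (hf : s.dt l = isoFlow l s) (n : ℕ) :
    (timeJet K l).Evolves (plusPart (dressedPow l s)) (dressedPow n s) := by
  have h1 := (moves_time K hf).evolves_dressedPow h h (A := -minusPart (dressedPow l s)) rfl n
  have h2 := h.dressedPow_comm l n
  rw [Jet.Evolves, timeJet_base] at h1 ⊢
  rw [h1, minusPart_eq, neg_mul, mul_neg, sub_mul, mul_sub, h2]
  abel

include h in
-- Here `L^{l/r}` does not commute with `M`, but the explicit dependence of `M⁽⁰⁾` on `t_l`
-- contributes exactly `[L^{l/r}, M]` and compensates the change from `-(L^{l/r})₋` to `(L^{l/r})₊`.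
lemma evolves_time_opM (hf : s.dt l = isoFlow l s) (hl : 1 ≤ l) :
    (timeJet K l).Evolves (plusPart (dressedPow l s)) (opM K r s) := by
  have h1 := (moves_time K hf).del_conj h h (A := -minusPart (dressedPow l s)) rfl (bareM K r)
  have h2 := h.dressedPow_mul_opM r hl
  rw [timeJet_base, timeJet_del l (bareM K r), ← dtOpHom_apply, ← h2] at h1
  rw [Jet.Evolves, timeJet_base, opM, h1, minusPart_eq, opM]
  noncomm_ring

include h in
lemma evolves_time_mom (hf : s.dt l = isoFlow l s) (hl : 1 ≤ l) (k : ℕ) :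
    (timeJet K l).Evolves (plusPart (dressedPow l s)) (opM K r s * lax r s ^ k) :=
  (h.evolves_time_opM r hf hl).mul ((h.evolves_time_dressedPow hf r).pow k)

variable (hc : minusPart (lax r s) = ∑ i, mulOp (s.Φ i) * Dpow (-1) * mulOp (s.Ψ i))

include hc in
-- As for `∂*_k`, comparing kernels extends the Lax equation to the actions of `L` and `L*`. There
-- is no inhomogeneous term, because `(L^{l/r})₊` has kernel zero.
lemma time_delta_lax (hf : s.dt l = isoFlow l s) :
    K.diff ((timeJet K l).delD (h.laxPlus r)) + K.ofKernel ((timeJet K l).delT h.laxKernel) =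
      h.powAct l * h.laxAct r - h.laxAct r * h.powAct l := by
  have h1 := hasKernel_commutator (h.hasKernel_powAct l)
    (h.hasKernel_laxAct r)
  refine (FunctionClass.hasKernel_mk _ _).ext ?_ ?_
  · convert h1 using 1
    rw [(moves_time K hf).delT_laxKernel h h, adKernel_zero, laxKernel, adKernel_sum_tmul]
    refine Eq.trans ?_ (sub_zero (G := K.EigFn ⊗[ℚ] K.AdjFn) _).symm
    refine Finset.sum_congr rfl fun i _ => ?_
    rw [h.time_delE_φ hf, h.time_delA_ψ hf, TensorProduct.tmul_neg]
    exact (sub_eq_add_neg (G := K.EigFn ⊗[ℚ] K.AdjFn) _ _).symm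
  · rw [map_add, plusPart_add, FunctionClass.op_diff,
      plusPart_of_mem (FunctionClass.op_ofKernel_mem _), add_zero, map_sub, map_mul, map_mul,
      h.op_laxAct r hc, op_powAct]
    change plusPart ((timeJet K l).del (plusPart (lax r s))) = _
    rw [Jet.del_plusPart, plusPart_of_diff (plusPart_mem _), lax, h.evolves_time_dressedPow hf,
      timeJet_base]

include hc in
lemma generates_time (hf : s.dt l = isoFlow l s) :
    Jet.Generates (timeJet K l) h h r 0 0 (h.powAct l) where
  delE_laxAct f := by
    have h1 := (moves_time K hf).varies_laxAct h h r
    rw [h.time_delta_lax r hc hf] at h1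
    rw [h1.del_eig, zero_smul, add_zero]
  delA_laxAct f := by
    have h1 := (moves_time K hf).varies_laxAct h h r
    rw [h.time_delta_lax r hc hf] at h1
    rw [h1.del_adj, zero_smul, add_zero]
  delE_φ i := by rw [h.time_delE_φ hf, zero_mul, zero_smul, add_zero]
  delA_ψ i := by rw [h.time_delA_ψ hf, zero_mul, zero_smul, add_zero]

include hc in
/-- The variation of `(M Lᵏ)₊ + Y_k` along `t_l`. -/
lemma varies_time_genAct (hf : s.dt l = isoFlow l s) (hl : 1 ≤ l) (k : ℕ) :
    (timeJet K l).Varies (h.genAct r k) (h.genAct r k)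
      (h.powAct l * h.genAct r k - h.genAct r k * h.powAct l + K.diff (h.powDelta r l k)) := by
  have h1 := (moves_time K hf).varies_genAct h h (r := r) (timeJet_base l _) k
  convert h1 using 1
  refine FunctionClass.HasKernel.ext (T := (timeJet K l).delT (h.ghostKernel r k)) ?_
    (FunctionClass.hasKernel_mk _ _) ?_
  · convert (hasKernel_commutator (h.hasKernel_powAct l)
      (h.hasKernel_genAct r k)).add (FunctionClass.hasKernel_diff (h.powDelta r l k)) using 1
    rw [(h.generates_time r hc hf).delT_ghostKernel (moves_time K hf), zero_smul, adKernel_zero,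
      add_zero, add_zero]
    exact (sub_zero (G := K.EigFn ⊗[ℚ] K.AdjFn) _).symm
  · refine Eq.trans ?_ (congrArg plusPart h1.del_op)
    -- `G_k` and `(L^{l/r})₋` both have negative order, so in the differential part of the
    -- commutator with `G_k` only `(L^{l/r})₊` counts.
    have h2 : plusPart (starGen K r k s * minusPart (dressedPow l s) -
        minusPart (dressedPow l s) * starGen K r k s) = 0 :=
      plusPart_of_mem (ordLE_mono (by omega) (sub_mem
        (ordLE_mul (h.starGen_mem_ordLE r k) (minusPart_mem _))
        (ordLE_mul (minusPart_mem _) (h.starGen_mem_ordLE r k))))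
    have h3 : plusPart ((timeJet K l).del (starGen K r k s)) = 0 :=
      plusPart_of_mem (Jet.del_mem_ordLE _ (h.starGen_mem_ordLE r k))
    rw [op_genAct_eq, map_add (timeJet K l).del, plusPart_add (Jet.del _ _), h3, zero_add,
      h.evolves_time_mom r hf hl, timeJet_base, map_add, map_sub, map_mul, map_mul, op_powAct, op_genAct_eq,
      FunctionClass.op_diff, powDelta, plusPart_add, plusPart_of_diff (plusPart_mem _),
      ← plusPart_add, ← add_zero (plusPart (_ - _)), ← h2, ← plusPart_add, minusPart_eq]
    congr 1
    noncomm_ring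

include h hc in
lemma time_starGen (hf : s.dt l = isoFlow l s) (hl : 1 ≤ l) (k : ℕ) :
    dtOp l (starGen K r k s) = plusPart (dressedPow l s) * starGen K r k s -
      starGen K r k s * plusPart (dressedPow l s) +
      plusPart (starGen K r k s * dressedPow l s - dressedPow l s * starGen K r k s) := by
  have h1 := (h.varies_time_genAct r hc hf hl k).del_op
  rw [op_genAct_eq, map_add, h.evolves_time_mom r hf hl, timeJet_base, map_add, map_sub, map_mul,
    map_mul, op_powAct, op_genAct_eq, FunctionClass.op_diff, powDelta] at h1
  rw [← timeJet_del (K := K), eq_sub_of_add_eq h1]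
  noncomm_ring

include hc in
-- The right side is the product rule for `∂*_k` applied to `(L^{l/r})₊(Φᵢ)`, so this is the
-- commutation of the two flows on `Φᵢ`.
lemma time_starφ (hf : s.dt l = isoFlow l s) (hl : 1 ≤ l) (k : ℕ) (i : Fin m) :
    (timeJet K l).delE (h.starφ r k i) =
      (K.diff (h.powDelta r l k)).eig (h.φ i) + (h.powAct l).eig (h.starφ r k i) := by
  have hg := (h.generates_time r hc hf).delE_φPow (moves_time K hf) (k - 1) i
  rw [zero_mul, zero_smul, add_zero] at hg
  rw [starφ, map_add, map_smul, (h.varies_time_genAct r hc hf hl k).del_eig, timeJet_baseE,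
    h.time_delE_φ hf, hg, map_add, map_sub, map_mul, map_mul, LinearMap.add_apply,
    LinearMap.sub_apply, Module.End.mul_apply, Module.End.mul_apply, map_add, map_smul]
  abel

include hc in
lemma time_starψ (hf : s.dt l = isoFlow l s) (hl : 1 ≤ l) (k : ℕ) (i : Fin m) :
    (timeJet K l).delA (h.starψ r k i) =
      -((K.diff (h.powDelta r l k)).adj (h.ψ i) + (h.powAct l).adj (h.starψ r k i)) := by
  have hg := (h.generates_time r hc hf).delA_ψPow (moves_time K hf) (k - 1) i
  rw [zero_mul, zero_smul, add_zero] at hg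
  rw [starψ, map_add, map_neg, map_smul, (h.varies_time_genAct r hc hf hl k).del_adj,
    timeJet_baseA, h.time_delA_ψ hf, hg, FunctionClass.ActOps.adj_add,
    FunctionClass.ActOps.adj_sub, FunctionClass.ActOps.adj_mul, FunctionClass.ActOps.adj_mul,
    LinearMap.add_apply, LinearMap.sub_apply, Module.End.mul_apply, Module.End.mul_apply, map_add,
    map_smul, map_neg, map_neg]
  module

end State.Regular
end TimeVariation

/-! ### Commutation with the isospectral flows and the displaced solution -/

section Symmetry
variable {B : Type u} [CommRing B] [Algebra ℚ B] [Differential B] {m : ℕ}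
  {K : FunctionClass B} {s : State B m}

namespace State.Regular
variable (h : s.Regular K) (r : ℕ) {l : ℕ}

include h in
lemma base_star_dressedPow (l k : ℕ) :
    (dualJet K).base (dressedPow l (starMove K r k s)) = dressedPow l s :=
  (moves_starMove K r k s).base_dressedPow (h.regular_starMove r k) h l

include h in
lemma evolves_star_dressedPow (l k : ℕ) :
    (dualJet K).Evolves (starGen K r k s) (dressedPow l (starMove K r k s)) :=
  (moves_starMove K r k s).evolves_dressedPow (h.regular_starMove r k) h rfl l

lemma varies_star_powAct (l k : ℕ) : (dualJet K).Varies ((h.regular_starMove r k).powAct l)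
    (h.powAct l) (K.diff (h.powDelta r l k)) := by
  have h1 := Jet.varies_diff (j := dualJet K) ((h.regular_starMove r k).powPlus l)
  have h2 : (dualJet K).baseD ((h.regular_starMove r k).powPlus l) = h.powPlus l :=
    Subtype.ext <| by
      change (dualJet K).base (plusPart (dressedPow l (starMove K r k s))) =
        plusPart (dressedPow l s)
      rw [Jet.base_plusPart, h.base_star_dressedPow]
  have h3 : (dualJet K).delD ((h.regular_starMove r k).powPlus l) = h.powDelta r l k :=
    Subtype.ext <| by
      change (dualJet K).del (plusPart (dressedPow l (starMove K r k s))) = plusPart _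
      rw [Jet.del_plusPart, h.evolves_star_dressedPow, h.base_star_dressedPow]
  rwa [h2, h3] at h1

variable (hc : minusPart (lax r s) = ∑ i, mulOp (s.Φ i) * Dpow (-1) * mulOp (s.Ψ i))

include h hc in
/-- `∂*_k` commutes with the isospectral flows. -/
lemma eps_isoFlow_starMove (hf : s.dt l = isoFlow l s) (hl : 1 ≤ l) (k : ℕ) :
    (isoFlow l (starMove K r k s)).eps = (starFlow K r k s).dt l := by
  have hm := moves_starMove K r k s
  have h' := h.regular_starMove r k
  refine State.ext' ?_ (fun i => ?_) fun i => ?_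
  · change (dualJet K).del (-minusPart (dressedPow l (starMove K r k s)) * (starMove K r k s).W) =
      dtOp l (starGen K r k s * s.W)
    have h1 : dtOp l s.W = -minusPart (dressedPow l s) * s.W := congrArg State.W hf
    have h2 : (starFlow K r k s).W = starGen K r k s * s.W := rfl
    -- Once minus parts are written as differences, both sides are noncommutative polynomials in
    -- `G_k`, `W`, `L^{l/r}` and the differential parts of `L^{l/r}` and `[G_k, L^{l/r}]`.
    rw [← timeJet_del (K := K), Jet.del_mul, Jet.del_mul, timeJet_base, timeJet_base, timeJet_del,
      timeJet_del, h.time_starGen r hc hf hl, h1, hm.base_W, hm.del_W, map_neg, map_neg,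
      Jet.del_minusPart, Jet.base_minusPart, h.evolves_star_dressedPow, h.base_star_dressedPow, h2,
      minusPart_eq, minusPart_eq]
    noncomm_ring
  · change (dualJet K).delFn _ = dtFn l _
    rw [← timeJet_delFn (K := K), ← h.coe_starφ]
    refine Eq.trans ?_ (congrArg Subtype.val (h.time_starφ r hc hf hl k i)).symm
    have h1 := (h.varies_star_powAct r l k).del_eig (h'.φ i)
    rw [hm.baseE_φ h' h, h.delE_star_φ] at h1
    exact congrArg Subtype.val h1
  · change (dualJet K).delFn ((isoFlow l (starMove K r k s)).Ψ i) =
      dtFn l ((starFlow K r k s).Ψ i)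
    rw [← timeJet_delFn (K := K), ← h.coe_starψ]
    refine Eq.trans ?_ (congrArg Subtype.val (h.time_starψ r hc hf hl k i)).symm
    have h1 := (h.varies_star_powAct r l k).del_adj (h'.ψ i)
    rw [hm.baseA_ψ h' h, h.delA_star_ψ] at h1
    exact (map_neg (dualJet K).delFn _).trans (congrArg (fun g : K.AdjFn => -(g : Fn B)) h1)

include h hc in
/-- `∂*_k` commutes with the isospectral flows on `L`. -/
lemma eps_isoLax_starMove (hf : s.dt l = isoFlow l s) (hl : 1 ≤ l) (k : ℕ) :
    Op.eps (isoLax r l (starMove K r k s)) = dtOp l (starLax K r k s) := by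
  have h1 : (timeJet K l).del (lax r s) = _ := h.evolves_time_dressedPow hf r
  change _ = _ * lax r s - lax r s * _ at h1
  rw [← dualJet_del K, ← timeJet_del (K := K), isoLax, starLax, map_sub, map_sub, Jet.del_mul,
    Jet.del_mul, Jet.del_mul, Jet.del_mul, timeJet_base, timeJet_base, h1, timeJet_del,
    h.time_starGen r hc hf hl, Jet.del_plusPart, Jet.base_plusPart, h.evolves_star_dressedPow,
    h.evolves_star_lax, h.base_star_dressedPow, h.base_star_lax]
  noncomm_ring

end State.Regular

/-- The displaced data solve the constrained hierarchy to first order. -/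
lemma IsCKP.starMove {r : ℕ} (hr : 1 ≤ r) (hs : IsCKP K r s) (k : ℕ) :
    IsCKP K.dual r (starMove K r k s) := by
  have h := hs.regular
  have h' := h.regular_starMove r k
  have hm := moves_starMove K r k s
  refine ⟨h'.plusPart_W, h'.W_mem, h'.Φ_mem, h'.Ψ_mem, fun l hl => ?_, ?_⟩
  · have hf := hs.flow l hl
    have he := h.eps_isoFlow_starMove r hs.constraint hf hl k
    have hv := h.varies_star_powAct r l k
    -- For each component, the base part is the given flow equation and the `ε`-part is the
    -- commutation of `∂*_k` with `∂/∂t_l`.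
    refine State.ext' ?_ (fun i => ?_) fun i => ?_
    · refine dualJet_op_ext K ?_ ?_
      · change (dualJet K).base (dtOp l _) = (dualJet K).base (-minusPart _ * _)
        rw [dualJet_base_dtOp, map_mul, map_neg, Jet.base_minusPart, h.base_star_dressedPow,
          hm.base_W]
        exact congrArg State.W hf
      · change (dualJet K).del (dtOp l _) = _
        rw [dualJet_del_dtOp, hm.del_W]
        exact (congrArg State.W he).symm
    · refine dualJet_fn_ext K ?_ ?_
      · change (dualJet K).baseFn (dtFn l _) = _
        rw [dualJet_base_dtFn, hm.base_Φ]
        have h1 := hv.base_eig (h'.φ i)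
        rw [hm.baseE_φ h' h] at h1
        exact (congrArg (fun t : State B m => t.Φ i) hf).trans (congrArg Subtype.val h1).symm
      · change (dualJet K).delFn (dtFn l _) = _
        rw [dualJet_del_dtFn, hm.del_Φ]
        exact (congrArg (fun t : State B m => t.Φ i) he).symm
    · refine dualJet_fn_ext K ?_ ?_
      · change (dualJet K).baseFn (dtFn l _) = _
        rw [dualJet_base_dtFn, hm.base_Ψ]
        have h1 := hv.base_adj (h'.ψ i)
        rw [hm.baseA_ψ h' h] at h1
        exact (congrArg (fun t : State B m => t.Ψ i) hf).trans
          ((map_neg (dualJet K).baseFn _).trans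
            (congrArg (fun g : K.AdjFn => -(g : Fn B)) h1)).symm
      · change (dualJet K).delFn (dtFn l _) = _
        rw [dualJet_del_dtFn, hm.del_Ψ]
        exact (congrArg (fun t : State B m => t.Ψ i) he).symm
  · refine dualJet_op_ext K ?_ ?_
    · rw [Jet.base_minusPart, h.base_star_lax, hs.constraint, map_sum]
      simp only [map_mul, Jet.base_mulOp, Jet.base_Dpow, hm.base_Φ, hm.base_Ψ]
    -- The first variation of the constraint is the preservation of the form of `L`.
    · rw [Jet.del_minusPart, dualJet_del, h.eps_star_lax, h.minusPart_starLax r hs.constraint hr,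
        map_sum]
      simp only [Jet.del_mul, map_mul, Jet.base_mulOp, Jet.del_mulOp, Jet.base_Dpow, Jet.del_Dpow,
        hm.base_Φ, hm.base_Ψ, hm.del_Φ, hm.del_Ψ, mul_zero, add_zero]

end Symmetry

theorem proposition2 {B : Type*} [CommRing B] [Algebra ℚ B] [Differential B]
    (K : FunctionClass B) {r m : ℕ} (hr : 1 ≤ r) (s : State B m) (hs : IsCKP K r s) :
    -- each `∂*_k` is a symmetry of the constrained hierarchy
    (∀ k : ℕ,
      -- the flow induced on `L` is the commutator with `-(M L^k)₋ + Y_k`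
      Op.eps (lax r (starMove K r k s)) = starLax K r k s ∧
      -- the form of `L` is preserved: `∂*_k L` has order at most `r - 2`, and its
      -- pseudo-differential part is induced by the flows on `Φᵢ` and `Ψᵢ`
      (∀ μ, ∀ n : ℤ, (r : ℤ) - 1 ≤ n → (starLax K r k s μ).coeff n = 0) ∧
      minusPart (starLax K r k s) =
        ∑ i, (mulOp ((starFlow K r k s).Φ i) * Dpow (-1) * mulOp (s.Ψ i) +
          mulOp (s.Φ i) * Dpow (-1) * mulOp ((starFlow K r k s).Ψ i)) ∧
      -- `∂*_k` commutes with the isospectral flows, on `L` and on `W`, `Φᵢ`, `Ψᵢ`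
      (∀ l, 1 ≤ l →
        Op.eps (isoLax r l (starMove K r k s)) = dtOp l (starLax K r k s) ∧
        (isoFlow l (starMove K r k s)).eps = (starFlow K r k s).dt l) ∧
      -- the displaced data solve the constrained hierarchy to first order
      IsCKP K.dual r (starMove K r k s)) ∧
    -- the Virasoro relations, on `L` and on `W`, `Φᵢ`, `Ψᵢ`
    (∀ l k : ℕ,
      starBracketLax K r l k s = ((k : ℤ) - l) • starLax K r (k + l - 1) s ∧
      starBracket K r l k s = ((k : ℤ) - l) • starFlow K r (k + l - 1) s) := by
  have h := hs.regular
  have hc := hs.constraint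
  refine ⟨fun k => ⟨h.eps_star_lax r k, fun μ n hn => ?_, h.minusPart_starLax r hc hr k,
    fun l hl => ⟨h.eps_isoLax_starMove r hc (hs.flow l hl) hl k,
      h.eps_isoFlow_starMove r hc (hs.flow l hl) hl k⟩, hs.starMove hr k⟩,
    fun l k => ⟨h.starBracketLax_eq r hc hr l k, h.starBracket_eq r hc hr l k⟩⟩
  exact h.commutator_lax_mem r (h.starGen_mem_ordLE r k) μ n (by omega)
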